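/- **Model.** A test unit has a failure time $T>0$ and a cause of failure $C\in\{1,\dots,J\}$, with sub-densities $g(j,t\mid\theta)$, $\theta\in\Theta\subseteq\mathbb R^s$. Let $G(j,t\mid\theta)=P_\theta(C=j,\,T\le t)=\int_0^t g(j,x\mid\theta)\,dx$, let $f_T=\sum_j g(j,\cdot)$ be the density of $T$ and $F_T=\sum_jG(j,\cdot)$ its distribution function. The pairs $(T_k,C_k)$, $k=1,2,\dots$, are i.i.d. with this law at the true value $\theta=\theta^0$. In an $M$-point progressive Type-I interval censored (PIC-I) life test $n$ units are inspected at fixed times $0=L_0<L_1<\dots<L_M$. Let $N_i$ be the number of units at risk at the start of $(L_{i-1},L_i]$ and $D_{ij}$ the number of them observed to fail in that interval from cause $j$; only these counts are observed. At $L_i$, $R_i=\lfloor p_i(N_i-\sum_jD_{ij})\rfloor$ of the surviving units are withdrawn, where $0\le p_i<1$ for $i<M$ and $p_M=1$; the units to be withdrawn are chosen by a rule that depends only on the failures observed so far and on a randomization independent of all $(T_k,C_k)$. Thus $N_1=n$ and $N_{i+1}=N_i-\sum_jD_{ij}-R_i$. Put $$q_{ij}(\theta)=\frac{G(j,L_i\mid\theta)-G(j,L_{i-1}\mid\theta)}{1-F_T(L_{i-1}\mid\theta)},\qquad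 q_i(\theta)=\frac{F_T(L_i\mid\theta)-F_T(L_{i-1}\mid\theta)}{1-F_T(L_{i-1}\mid\theta)} ,$$ and let the likelihood be $\prod_{i=1}^M\bigl[\prod_{j=1}^J q_{ij}(\theta)^{D_{ij}}\bigr](1-q_i(\theta))^{N_i-\sum_jD_{ij}}$. Its critical points with respect to $\theta$ (for the logarithm) are the solutions of the likelihood equations. With $\zeta$ denoting the scheme, put $$I(\theta\mid\zeta)=\sum_{i=1}^M E[N_i]\,\sigma_i^2(\theta),\qquad \sigma_i^2=\sum_{j=1}^J\frac{\nabla q_{ij}\nabla q_{ij}^{T}}{q_{ij}}+\frac{\nabla q_i\nabla q_i^{T}}{1-q_i},$$ $$I^1(\theta)=\sum_{i=1}^M b_i\,\sigma_i^2(\theta),\qquad b_i=\prod_{l<i}(1-p_l)(1-q_l(\theta)).$$ **Regularity conditions.** The number $J$ of causes is finite and the $(T_k,C_k)$ are i.i.d. as above; the supports of $f_T(\cdot\mid\theta)$ and $g(j,\cdot\mid\theta)$ do not depend on $\theta$ (up to null sets); $\Theta$ contains an open set $\Theta_0\ni\theta^0$; for each $t\in\{L_1,\dots,L_M\}$ and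 each $j$, $F_T(t\mid\theta)$ and $G(j,t\mid\theta)$ have all partial derivatives in $\theta$ of orders one, two and three on $\Theta_0$, and these are bounded on $\Theta_0$; at $\theta=\theta^0$, $0<q_{ij}<1$ and $0<q_i<1$ for all $i,j$, and the $s\times M$ matrix $(\partial q_i/\partial\theta_u)$ has rank $s$. **Theorem.** Under these conditions, as $n\to\infty$: 0. $I^1(\theta^0)$ is positive definite, and $\frac1n I(\theta^0\mid\zeta)\to I^1(\theta^0)$. 1. For every sufficiently small $r>0$, the closed ball $B_r$ of radius $r$ about $\theta^0$ lies in $\Theta_0$ and, with probability tending to one, the likelihood equations have exactly one solution in $B_r$, which lies in the open ball and is the unique maximizer of the likelihood over $B_r$. Any estimator $\hat\theta_n$ that, with probability tending to one, maximizes the likelihood over $B_r$ is (I) consistent, $\hat\theta_n\to\theta^0$ in probability, and (II) asymptotically normal with mean $\theta^0$ and covariance matrix $[I(\theta^0\mid\zeta)]^{-1}$, in the sense that $\sqrt n(\hat\theta_n-\theta^0)$ converges in distribution to $N\bigl(0,[I^1(\theta^0)]^{-1}\bigr)$. 2. Any consistent estimator that solves the likelihood equations with probability tending to one is asymptotically normal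 as in (II). 3. Suppose that $\hat\theta_n$ maximizes the likelihood over all of $\Theta$ with probability tending to one. If for every $\varepsilon>0$ there is $\delta>0$ such that each $\theta\in\Theta$ with $|\theta-\theta^0|\ge\varepsilon$ satisfies $|q_{ij}(\theta)-q_{ij}(\theta^0)|\ge\delta$ for some $i,j$, then $\hat\theta_n$ is consistent. Whenever $\hat\theta_n$ is consistent, it is asymptotically normal as in (II). -/

import Mathlib

open MeasureTheory ProbabilityTheory Filter Topology

/-- The space of parameter vectors `θ = (θ₁, …, θₛ)`, with its Euclidean norm. -/
abbrev ParamSpace (s : ℕ) : Type := EuclideanSpace ℝ (Fin s)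

noncomputable section

/-! ### Partial derivatives with respect to the parameters -/

/-- The `u`-th coordinate direction. -/
def coordDir {s : ℕ} (u : Fin s) : ParamSpace s := EuclideanSpace.single u (1 : ℝ)

/-- The partial derivative `∂f/∂θᵤ`, as a function of `θ`. -/
def partialDeriv {s : ℕ} (u : Fin s) (f : ParamSpace s → ℝ) : ParamSpace s → ℝ :=
  fun θ => lineDeriv ℝ f θ (coordDir u)

/-- All partial derivatives of `f` of orders one, two and three exist at every point of `U`,
and they are all bounded on `U`. -/
def HasBoundedPartials {s : ℕ} (f : ParamSpace s → ℝ) (U : Set (ParamSpace s)) : Prop :=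
  ∃ B : ℝ, ∀ θ ∈ U, ∀ u v w : Fin s,
    (LineDifferentiableAt ℝ f θ (coordDir u) ∧ |partialDeriv u f θ| ≤ B) ∧
    (LineDifferentiableAt ℝ (partialDeriv u f) θ (coordDir v) ∧
      |partialDeriv v (partialDeriv u f) θ| ≤ B) ∧
    (LineDifferentiableAt ℝ (partialDeriv v (partialDeriv u f)) θ (coordDir w) ∧
      |partialDeriv w (partialDeriv v (partialDeriv u f)) θ| ≤ B)

/-! ### The competing risks model -/

/-- A parametric competing risks model with `J` causes of failure and `s` parameters, given by the
sub-densities `g j t θ` of the pair (cause of failure, positive failure time). -/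
structure CompetingRisksModel (J s : ℕ) where
  /-- the parameter space -/
  Θ : Set (ParamSpace s)
  /-- the sub-density functions -/
  g : Fin J → ℝ → ParamSpace s → ℝ
  g_nonneg : ∀ θ ∈ Θ, ∀ j t, 0 ≤ g j t θ
  g_eq_zero : ∀ θ ∈ Θ, ∀ j, ∀ t ≤ 0, g j t θ = 0
  g_integrable : ∀ θ ∈ Θ, ∀ j, Integrable (fun t => g j t θ)
  g_total : ∀ θ ∈ Θ, ∑ j, ∫ t, g j t θ = 1

namespace CompetingRisksModel

variable {J s : ℕ} (m : CompetingRisksModel J s)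

/-- Sub-distribution function `G(j, t | θ) = P(C = j, T ≤ t)`. -/
def G (j : Fin J) (t : ℝ) (θ : ParamSpace s) : ℝ := ∫ x in Set.Iic t, m.g j x θ

/-- Density `f_T(t | θ)` of the failure time. -/
def fT (t : ℝ) (θ : ParamSpace s) : ℝ := ∑ j, m.g j t θ

/-- Distribution function `F_T(t | θ)` of the failure time. -/
def FT (t : ℝ) (θ : ParamSpace s) : ℝ := ∫ x in Set.Iic t, m.fT x θ

end CompetingRisksModel

/-! ### Progressive Type-I interval censoring -/

/-- An `M`-point scheme. Indices start at zero: for `i < M`, the `i`-th interval is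
`(L i, L (i + 1)]`, with `L 0 = 0`, and `p i` is the withdrawal proportion at its right end
`L (i + 1)`. Everything left is withdrawn at the end of the last interval, and not before. -/
structure PICScheme (M : ℕ) where
  /-- inspection times -/
  L : ℕ → ℝ
  /-- withdrawal proportions -/
  p : ℕ → ℝ
  L_zero : L 0 = 0
  L_lt : ∀ i < M, L i < L (i + 1)
  p_nonneg : ∀ i, i + 1 < M → 0 ≤ p i
  p_lt_one : ∀ i, i + 1 < M → p i < 1
  p_last : ∀ i, i + 1 = M → p i = 1

/-- The units among `0, …, n - 1` that are at risk at the start of the `i`-th interval, when unit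
`k` has failure time `t k` and the units in `W l` are withdrawn at the end of interval `l`. -/
def atRisk (L t : ℕ → ℝ) (W : ℕ → Finset ℕ) (n : ℕ) : ℕ → Finset ℕ
  | 0 => Finset.range n
  | i + 1 => ((atRisk L t W n i).filter fun k => L (i + 1) < t k) \ W i

/-- The units at risk in the `i`-th interval that are still alive at its right end. -/
def survivors (L t : ℕ → ℝ) (W : ℕ → Finset ℕ) (n i : ℕ) : Finset ℕ :=
  (atRisk L t W n i).filter fun k => L (i + 1) < t k

/-- The units that are observed to fail in the `i`-th interval from cause `j`. -/
def failures {J : ℕ} (L t : ℕ → ℝ) (c : ℕ → Fin J) (W : ℕ → Finset ℕ) (n i : ℕ) (j : Fin J) :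
    Finset ℕ :=
  (atRisk L t W n i).filter fun k => t k ≤ L (i + 1) ∧ c k = j

/-- What the experimenter has observed by the end of the `i`-th interval: the sets of units that
failed in each interval up to the `i`-th, by cause. -/
def history {J : ℕ} (L t : ℕ → ℝ) (c : ℕ → Fin J) (W : ℕ → Finset ℕ) (n i : ℕ) :
    ℕ → Fin J → Finset ℕ :=
  fun l j => if l ≤ i then failures L t c W n l j else ∅

/-- Observed numbers of failures, by interval and cause. -/
abbrev CountData (M J : ℕ) : Type := Fin M → Fin J → ℕ

/-- The total number of failures in the `i`-th interval. -/
def totalFailures {M J : ℕ} (d : CountData M J) (i : ℕ) : ℕ :=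
  if h : i < M then ∑ j, d ⟨i, h⟩ j else 0

/-- The number of units at risk at the start of the `i`-th interval, computed from the failure
counts: initially `n`; in each interval the failures leave, and then the withdrawals, whose number
is `⌊p i * (number of survivors)⌋`. -/
def atRiskCount {M J : ℕ} (p : ℕ → ℝ) (n : ℕ) (d : CountData M J) : ℕ → ℕ
  | 0 => n
  | i + 1 => atRiskCount p n d i - totalFailures d i
      - ⌊p i * ((atRiskCount p n d i - totalFailures d i : ℕ) : ℝ)⌋₊

namespace CompetingRisksModel

variable {J s M : ℕ} (m : CompetingRisksModel J s) (ζ : PICScheme M)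

/-- Conditional probability `q_{ij}` that a unit fails in the `i`-th interval from cause `j`, given
that it is alive at the start of that interval. -/
def qc (i : ℕ) (j : Fin J) (θ : ParamSpace s) : ℝ :=
  (m.G j (ζ.L (i + 1)) θ - m.G j (ζ.L i) θ) / (1 - m.FT (ζ.L i) θ)

/-- Conditional probability `q_i` that a unit fails in the `i`-th interval, given that it is alive
at the start of that interval. -/
def q (i : ℕ) (θ : ParamSpace s) : ℝ :=
  (m.FT (ζ.L (i + 1)) θ - m.FT (ζ.L i) θ) / (1 - m.FT (ζ.L i) θ)

/-- Likelihood of `θ` (up to a factor free of `θ`), for `n` units and failure counts `d`. -/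
def likelihood (n : ℕ) (d : CountData M J) (θ : ParamSpace s) : ℝ :=
  ∏ i : Fin M, (∏ j, m.qc ζ i j θ ^ d i j) *
    (1 - m.q ζ i θ) ^ (atRiskCount ζ.p n d i - totalFailures d i)

/-- Log-likelihood of `θ`, for `n` units and failure counts `d`. -/
def logLikelihood (n : ℕ) (d : CountData M J) (θ : ParamSpace s) : ℝ :=
  ∑ i : Fin M, (∑ j, (d i j : ℝ) * Real.log (m.qc ζ i j θ) +
    ((atRiskCount ζ.p n d i - totalFailures d i : ℕ) : ℝ) * Real.log (1 - m.q ζ i θ))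

/-- `θ` maximizes the likelihood over `K`. -/
def IsMLE (K : Set (ParamSpace s)) (n : ℕ) (d : CountData M J) (θ : ParamSpace s) : Prop :=
  θ ∈ K ∧ IsMaxOn (m.likelihood ζ n d) K θ

/-- `θ` solves the likelihood equations `∂l/∂θᵤ = 0`, `u = 1, …, s` (the derivatives exist). -/
def IsLikelihoodRoot (n : ℕ) (d : CountData M J) (θ : ParamSpace s) : Prop :=
  ∀ u : Fin s, HasLineDerivAt ℝ (m.logLikelihood ζ n d) 0 θ (coordDir u)

/-- The information in the `i`-th interval per unit at risk,
`∑ⱼ ∇q_{ij} ∇q_{ij}ᵀ / q_{ij} + ∇q_i ∇q_iᵀ / (1 - q_i)`. -/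
def stageInfo (i : ℕ) (θ : ParamSpace s) : Matrix (Fin s) (Fin s) ℝ :=
  Matrix.of fun u v =>
    ∑ j, partialDeriv u (m.qc ζ i j) θ * partialDeriv v (m.qc ζ i j) θ / m.qc ζ i j θ +
      partialDeriv u (m.q ζ i) θ * partialDeriv v (m.q ζ i) θ / (1 - m.q ζ i θ)

/-- The Fisher information matrix `I(θ | ζ)`, where `N i` stands for the expected number of units
at risk at the start of the `i`-th interval. -/
def fisherInfo (N : Fin M → ℝ) (θ : ParamSpace s) : Matrix (Fin s) (Fin s) ℝ :=
  ∑ i : Fin M, N i • m.stageInfo ζ i θ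

/-- The limiting fraction `∏_{l < i} (1 - p_l)(1 - q_l)` of units at risk at the start of the
`i`-th interval. -/
def limitFraction (i : ℕ) (θ : ParamSpace s) : ℝ :=
  ∏ l ∈ Finset.range i, (1 - ζ.p l) * (1 - m.q ζ l θ)

/-- The asymptotic Fisher information per unit, `∑ᵢ bᵢ (information in the i-th interval)`. -/
def unitInfo (θ : ParamSpace s) : Matrix (Fin s) (Fin s) ℝ :=
  m.fisherInfo ζ (fun i => m.limitFraction ζ i θ) θ

/-- The vector of the `q_{ij}(θ)` stays away from that at `θ₀` when `θ` ranges over the points of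
`K` that are at least a given distance away from `θ₀`. -/
def SeparatedOn (K : Set (ParamSpace s)) (θ₀ : ParamSpace s) : Prop :=
  ∀ ε > 0, ∃ δ > 0, ∀ θ ∈ K, ε ≤ dist θ θ₀ →
    ∃ (i : Fin M) (j : Fin J), δ ≤ |m.qc ζ i j θ - m.qc ζ i j θ₀|

/-- The regularity conditions on the family of distributions and on the scheme; `Θ₀` is the open
set of parameters and `θ₀` the true parameter. -/
structure Regular (Θ₀ : Set (ParamSpace s)) (θ₀ : ParamSpace s) : Prop where
  support_g : ∀ θ ∈ m.Θ, ∀ θ' ∈ m.Θ, ∀ j,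
    Function.support (fun t => m.g j t θ) =ᵐ[volume] Function.support fun t => m.g j t θ'
  support_fT : ∀ θ ∈ m.Θ, ∀ θ' ∈ m.Θ,
    Function.support (fun t => m.fT t θ) =ᵐ[volume] Function.support fun t => m.fT t θ'
  isOpen : IsOpen Θ₀
  subset : Θ₀ ⊆ m.Θ
  mem : θ₀ ∈ Θ₀
  FT_partials : ∀ i < M, HasBoundedPartials (m.FT (ζ.L (i + 1))) Θ₀
  G_partials : ∀ i < M, ∀ j, HasBoundedPartials (m.G j (ζ.L (i + 1))) Θ₀
  qc_mem : ∀ i < M, ∀ j, 0 < m.qc ζ i j θ₀ ∧ m.qc ζ i j θ₀ < 1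
  q_mem : ∀ i < M, 0 < m.q ζ i θ₀ ∧ m.q ζ i θ₀ < 1
  rank_grad :
    (Matrix.of fun (u : Fin s) (i : Fin M) => partialDeriv u (m.q ζ i) θ₀).rank = s

/-- The life tests under the scheme `ζ`, one for each sample size `n`, when `θ₀` is the true
parameter. Unit `k` has failure time `T k` and cause of failure `C k`; in the test of size `n`, the
set `W n ω i` of units is withdrawn at the end of interval `i`. The pairs `(T k, C k)` are i.i.d.
with sub-distribution function `G(·, · | θ₀)`. The withdrawn units are survivors, in the number
that the scheme prescribes, and they are picked in a non-informative way: by a rule that uses only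
the history observed so far and a randomization `V` that is independent of the lifetimes. -/
structure IsLifeTest {Ω 𝒱 : Type*} [MeasurableSpace Ω] [MeasurableSpace 𝒱] (P : Measure Ω)
    (θ₀ : ParamSpace s) (T : ℕ → Ω → ℝ) (C : ℕ → Ω → Fin J) (V : Ω → 𝒱)
    (rule : ℕ → ℕ → 𝒱 → (ℕ → Fin J → Finset ℕ) → Finset ℕ)
    (W : ℕ → Ω → ℕ → Finset ℕ) : Prop where
  measurable_T : ∀ k, Measurable (T k)
  measurable_C : ∀ k, Measurable (C k)
  indep : iIndepFun (fun k ω => (T k ω, C k ω)) P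
  law : ∀ k j t, P.real {ω | C k ω = j ∧ T k ω ≤ t} = m.G j t θ₀
  measurable_V : Measurable V
  indep_V : IndepFun V (fun ω k => (T k ω, C k ω)) P
  measurable_rule : ∀ n i h S, MeasurableSet {v | rule n i v h = S}
  withdrawn_eq : ∀ n, ∀ i < M, ∀ ω, W n ω i =
    rule n i (V ω) (history ζ.L (fun k => T k ω) (fun k => C k ω) (W n ω) n i)
  withdrawn_subset : ∀ n, ∀ i < M, ∀ ω,
    W n ω i ⊆ survivors ζ.L (fun k => T k ω) (W n ω) n i
  withdrawn_card : ∀ n, ∀ i < M, ∀ ω, (W n ω i).card =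
    ⌊ζ.p i * ((survivors ζ.L (fun k => T k ω) (W n ω) n i).card : ℝ)⌋₊

/-- The failure counts `D_{ij}` observed in the test of size `n`. -/
def counts {Ω : Type*} (T : ℕ → Ω → ℝ) (C : ℕ → Ω → Fin J) (W : ℕ → Ω → ℕ → Finset ℕ)
    (n : ℕ) (ω : Ω) : CountData M J :=
  fun i j => (failures ζ.L (fun k => T k ω) (fun k => C k ω) (W n ω) n i j).card

end CompetingRisksModel

/-! ### Asymptotic properties of estimators -/

/-- The estimators `est n`, evaluated at the data `D n`, converge in probability to `θ₀`. -/
def IsConsistent {Ω : Type*} [MeasurableSpace Ω] {M J s : ℕ} (P : Measure Ω)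
    (D : ℕ → Ω → CountData M J) (est : ℕ → CountData M J → ParamSpace s) (θ₀ : ParamSpace s) :
    Prop :=
  TendstoInMeasure P (fun n ω => est n (D n ω)) atTop fun _ => θ₀

/-- `√n (est n - θ₀)` converges in distribution to the centred normal law with covariance `Γ`. -/
def IsAsymptoticallyNormal {Ω : Type*} [MeasurableSpace Ω] {M J s : ℕ} (P : Measure Ω)
    [IsProbabilityMeasure P]
    (D : ℕ → Ω → CountData M J) (est : ℕ → CountData M J → ParamSpace s) (θ₀ : ParamSpace s)
    (Γ : Matrix (Fin s) (Fin s) ℝ) : Prop :=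
  TendstoInDistribution (fun (n : ℕ) ω => √(n : ℝ) • (est n (D n ω) - θ₀)) atTop
    (id : ParamSpace s → ParamSpace s) (fun _ => P) (multivariateGaussian 0 Γ)

/-- The event that `A n ω` holds has probability tending to one as `n → ∞`. -/
def WithProbTendingToOne {Ω : Type*} [MeasurableSpace Ω] (P : Measure Ω) (A : ℕ → Ω → Prop) :
    Prop :=
  Tendsto (fun n => P {ω | A n ω}) atTop (𝓝 1)

end

/-!
In each interval a unit at risk meets one of `J + 1` outcomes: it fails from one of the causes, or
it survives. The withdrawals are chosen from past failures and independent randomization, so given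
the history the outcomes of the units at risk are independent, with the conditional probabilities
`q_{ij}` and `1 - q_i` (`IsLifeTest.setIntegral_prod_outcome`): the outcome counts of an interval
are conditionally multinomial. The likelihood is therefore a product of powers of finitely many
smooth cell probabilities `πₖ`, and everything depends on the vector `w` of cell counts divided
by `n`.

* *Law of large numbers.* `w` tends in probability to `(aₖ πₖ(θ⁰))`, where `aₖ` is the limiting
  fraction of units at risk (`IsLifeTest.tendsto_numOutcome_div`); rounding in the numbers of
  withdrawals costs at most `1 / n`.
* *Deterministic part.* For every `w` near that limit, `∑ wₖ log πₖ` is strictly concave on a fixed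
  ball about `θ⁰`, with a small gradient at the centre. It has exactly one critical point in the
  ball, which is its maximizer and tends to `θ⁰` with `w`
  (`exists_forall_eventually_unique_critical_point`, `tendsto_of_isMaxOn_closedBall`).
  Its Hessian is governed by the information matrix, which is positive definite by the rank condition
  (`Regular.cellInfo_pos`).
* *Central limit theorem.* The score at `θ⁰` is a sum over the intervals of linear functions of the
  counts that are centred given the past. The conditional characteristic functions in an interval
  have a constant limit in probability, so the intervals can be split off one after the other
  (`IsLifeTest.tendsto_integral_prod_exp`).
* *Linearization.* For a consistent root, strict differentiability of the score in `(w, θ)` shows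
  that the error is the inverse information applied to the score, up to a relative error tending to
  zero (`isLittleO_cellScore_sub_cellInfo`). This gives asymptotic normality; a consistent maximizer
  over a neighbourhood of `θ⁰` is such a root.
* *Global maximizers.* A maximizer over `Θ` fits `w` at least as well as `θ⁰`, which bounds a
  Hellinger distance between the cell probabilities (`tendsto_of_sum_mul_log_le`). Separation of the
  `q_{ij}` turns this into consistency.

The calculus of limits and of `o(·)` is applied to random variables through the filter
`inProbability P` on `ℕ × Ω`, along which convergence to a constant is convergence in probability.
-/

/-! ### Functions with bounded partial derivatives -/

/-- Changing the coordinates of `x` into those of `y` one at a time never leaves the ball about `x`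
through `y`, so bounds on the partial derivatives in that ball control the increment of `f`. -/
lemma abs_sub_sub_sum_le_of_partialDeriv {s : ℕ} {f : ParamSpace s → ℝ} {x y : ParamSpace s}
    {r K : ℝ} {c : Fin s → ℝ} (hy : y ∈ Metric.ball x r)
    (hf : ∀ z ∈ Metric.ball x r, ∀ u, LineDifferentiableAt ℝ f z (coordDir u) ∧
      |partialDeriv u f z - c u| ≤ K) :
    |f y - f x - ∑ u, c u * (y u - x u)| ≤ K * ∑ u, |y u - x u| := by
  classical
  let z : Finset (Fin s) → ParamSpace s :=
    fun A => WithLp.toLp 2 fun u => if u ∈ A then y u else x u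
  have key : ∀ A : Finset (Fin s), |f (z A) - f x - ∑ u ∈ A, c u * (y u - x u)| ≤
      K * ∑ u ∈ A, |y u - x u| := by
    intro A
    induction A using Finset.induction_on with
    | empty =>
      have : z ∅ = x := by ext u; simp [z]
      simp [this]
    | insert a A ha ih =>
      have hz : z (insert a A) = z A + (y a - x a) • coordDir a := by
        ext u
        by_cases hu : u = a
        · subst hu; simp [z, coordDir, ha]
        · simp [z, coordDir, hu]
      have hmem : ∀ t ∈ Set.uIcc 0 (y a - x a), z A + t • coordDir a ∈ Metric.ball x r := by
        intro t ht
        rw [Metric.mem_ball] at hy ⊢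
        refine lt_of_le_of_lt ?_ hy
        rw [EuclideanSpace.dist_eq, EuclideanSpace.dist_eq]
        refine Real.sqrt_le_sqrt (Finset.sum_le_sum fun u _ => ?_)
        rw [Real.dist_eq, Real.dist_eq, sq_le_sq, abs_abs, abs_abs]
        by_cases hu : u = a
        · subst hu
          simpa [z, coordDir, ha] using Set.abs_sub_left_of_mem_uIcc ht
        · by_cases hA : u ∈ A <;> simp [z, coordDir, hu, hA]
      have hderiv : ∀ t ∈ Set.uIcc 0 (y a - x a),
          HasDerivWithinAt (fun t => f (z A + t • coordDir a) - c a * t)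
            (partialDeriv a f (z A + t • coordDir a) - c a) (Set.uIcc 0 (y a - x a)) t := by
        intro t ht
        have h1 := ((hf _ (hmem t ht) a).1).hasLineDerivAt
        have h2 : HasDerivAt (fun t' => f (z A + t' • coordDir a))
            (partialDeriv a f (z A + t • coordDir a)) t := by
          have h1' : HasDerivAt (fun t' => f (z A + t • coordDir a + t' • coordDir a))
            (partialDeriv a f (z A + t • coordDir a)) (t + -t) := by
            rw [add_neg_cancel]; exact h1
          have h3 := HasDerivAt.comp_add_const t (-t) h1'
          refine h3.congr_of_eventuallyEq (Eventually.of_forall fun t' => ?_)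
          simp only
          rw [add_assoc, ← add_smul]
          congr 3
          ring
        have h4 : HasDerivAt (fun t : ℝ => c a * t) (c a) t := by
          simpa using (hasDerivAt_id t).const_mul (c a)
        exact (h2.sub h4).hasDerivWithinAt
      have hmvt := Convex.norm_image_sub_le_of_norm_hasDerivWithin_le (C := K) hderiv
        (fun t ht => by simpa using (hf _ (hmem t ht) a).2) (convex_uIcc _ _)
        Set.left_mem_uIcc Set.right_mem_uIcc
      simp only [zero_smul, add_zero, mul_zero, sub_zero, Real.norm_eq_abs, ← hz] at hmvt
      rw [Finset.sum_insert ha, Finset.sum_insert ha]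
      calc _ = |(f (z (insert a A)) - c a * (y a - x a) - f (z A)) +
            (f (z A) - f x - ∑ u ∈ A, c u * (y u - x u))| := by congr 1; ring
        _ ≤ _ := (abs_add_le _ _).trans (add_le_add hmvt ih)
        _ = _ := by ring
  have hzu : z Finset.univ = y := by ext u; simp [z]
  simpa [hzu] using key Finset.univ

lemma sum_abs_coord_le {s : ℕ} (x : ParamSpace s) : ∑ u, |x u| ≤ s * ‖x‖ := by
  calc ∑ u, |x u| ≤ ∑ _u : Fin s, ‖x‖ :=
        Finset.sum_le_sum fun u _ => by simpa using PiLp.norm_apply_le x u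
    _ = s * ‖x‖ := by simp

/-- A function with bounded partial derivatives on an open set is continuous there. -/
lemma continuousOn_of_abs_partialDeriv_le {s : ℕ} {f : ParamSpace s → ℝ} {U : Set (ParamSpace s)}
    (hU : IsOpen U) {B : ℝ} (hf : ∀ z ∈ U, ∀ u, LineDifferentiableAt ℝ f z (coordDir u) ∧
      |partialDeriv u f z| ≤ B) : ContinuousOn f U := by
  intro x hx
  obtain ⟨r, hr, hrU⟩ := Metric.isOpen_iff.1 hU x hx
  refine ContinuousAt.continuousWithinAt ?_
  rw [ContinuousAt, tendsto_iff_dist_tendsto_zero]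
  have hlim : Tendsto (fun y => |B| * (s * ‖y - x‖)) (𝓝 x) (𝓝 0) := by
    have : Continuous fun y : ParamSpace s => |B| * (s * ‖y - x‖) := by fun_prop
    simpa using this.tendsto x
  refine tendsto_of_tendsto_of_tendsto_of_le_of_le' tendsto_const_nhds hlim
    (Eventually.of_forall fun _ => dist_nonneg) ?_
  filter_upwards [Metric.ball_mem_nhds x hr] with y hy
  have h := abs_sub_sub_sum_le_of_partialDeriv (c := 0) (K := |B|) hy fun z hz u =>
    ⟨(hf z (hrU hz) u).1, by simpa using ((hf z (hrU hz) u).2).trans (le_abs_self B)⟩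
  simp only [Pi.zero_apply, zero_mul, Finset.sum_const_zero, sub_zero] at h
  rw [Real.dist_eq]
  exact h.trans (mul_le_mul_of_nonneg_left (sum_abs_coord_le (y - x)) (abs_nonneg B))

/-- A function with continuous partial derivatives on an open set is differentiable there. -/
lemma hasFDerivAt_of_continuousOn_partialDeriv {s : ℕ} {f : ParamSpace s → ℝ}
    {U : Set (ParamSpace s)} (hU : IsOpen U)
    (hf : ∀ z ∈ U, ∀ u, LineDifferentiableAt ℝ f z (coordDir u))
    (hc : ∀ u, ContinuousOn (partialDeriv u f) U) {x : ParamSpace s} (hx : x ∈ U) :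
    HasFDerivAt f (∑ u, partialDeriv u f x • (EuclideanSpace.proj u : ParamSpace s →L[ℝ] ℝ)) x := by
  rw [hasFDerivAt_iff_isLittleO, Asymptotics.isLittleO_iff]
  intro ε hε
  have hs : 0 < ε / (s + 1) := by positivity
  have hev : ∀ᶠ z in 𝓝 x, z ∈ U ∧ ∀ u, |partialDeriv u f z - partialDeriv u f x| ≤ ε / (s + 1) := by
    refine (hU.eventually_mem hx).and (eventually_all.2 fun u => ?_)
    have := ((hc u).continuousAt (hU.mem_nhds hx)).eventually (Metric.closedBall_mem_nhds _ hs)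
    filter_upwards [this] with z hz
    rwa [← Real.dist_eq]
  obtain ⟨r, hr, hball⟩ := Metric.eventually_nhds_iff_ball.1 hev
  filter_upwards [Metric.ball_mem_nhds x hr] with y hy
  have h := abs_sub_sub_sum_le_of_partialDeriv (c := fun u => partialDeriv u f x) hy
    fun z hz u => ⟨hf z (hball z hz).1 u, (hball z hz).2 u⟩
  have hsum : (∑ u, partialDeriv u f x • (EuclideanSpace.proj u : ParamSpace s →L[ℝ] ℝ)) (y - x) =
      ∑ u, partialDeriv u f x * (y u - x u) := by
    simp
  rw [hsum, Real.norm_eq_abs]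
  refine h.trans ((mul_le_mul_of_nonneg_left (sum_abs_coord_le (y - x)) hs.le).trans ?_)
  have : ε / (s + 1) * (s * ‖y - x‖) = (s / (s + 1) : ℝ) * (ε * ‖y - x‖) := by
    field_simp
  rw [this]
  refine mul_le_of_le_one_left (by positivity) ?_
  rw [div_le_one (by positivity)]
  linarith

lemma contDiffOn_succ_of_partialDeriv {s : ℕ} {f : ParamSpace s → ℝ} {U : Set (ParamSpace s)}
    (hU : IsOpen U) (n : ℕ) (hf : ∀ z ∈ U, ∀ u, LineDifferentiableAt ℝ f z (coordDir u))
    (hc : ∀ u, ContDiffOn ℝ n (partialDeriv u f) U) : ContDiffOn ℝ (n + 1) f U := by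
  have hd : ∀ x ∈ U, HasFDerivAt f
      (∑ u, partialDeriv u f x • (EuclideanSpace.proj u : ParamSpace s →L[ℝ] ℝ)) x := fun x hx =>
    hasFDerivAt_of_continuousOn_partialDeriv hU hf (fun u => (hc u).continuousOn) hx
  rw [contDiffOn_succ_iff_fderiv_of_isOpen hU]
  refine ⟨fun x hx => (hd x hx).differentiableAt.differentiableWithinAt, by simp, ?_⟩
  refine ContDiffOn.congr ?_ fun x hx => (hd x hx).fderiv
  exact ContDiffOn.sum fun u _ => (hc u).smul contDiffOn_const

/-- Boundedness of the third order partial derivatives makes those of second order continuous, and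
so on downwards. -/
lemma HasBoundedPartials.contDiffOn {s : ℕ} {f : ParamSpace s → ℝ} {U : Set (ParamSpace s)}
    (hU : IsOpen U) (hf : HasBoundedPartials f U) : ContDiffOn ℝ 2 f U := by
  obtain ⟨B, hB⟩ := hf
  refine contDiffOn_succ_of_partialDeriv hU 1 (fun z hz u => (hB z hz u u u).1.1) fun u => ?_
  refine contDiffOn_succ_of_partialDeriv hU 0 (fun z hz v => (hB z hz u v v).2.1.1) fun v => ?_
  refine contDiffOn_zero.2 (continuousOn_of_abs_partialDeriv_le (B := B) hU fun z hz w => ?_)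
  exact (hB z hz u v w).2.2

/-! ### Weighted sums of logarithms of cell probabilities -/

section CellLogLikelihood

variable {κ E : Type*} [Fintype κ]

/-- The log-likelihood `∑ wₖ log πₖ(θ)` of cell probabilities `πₖ(θ)`, when the `k`-th cell has
weight (count, or relative frequency) `wₖ`. -/
noncomputable def cellLogLik (π : κ → E → ℝ) (w : κ → ℝ) (θ : E) : ℝ :=
  ∑ k, w k * Real.log (π k θ)

variable [NormedAddCommGroup E] [NormedSpace ℝ E]

/-- The score `∑ wₖ ∇πₖ(θ) / πₖ(θ)` of the cell log-likelihood, as a continuous linear form. -/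
noncomputable def cellScore (π : κ → E → ℝ) (w : κ → ℝ) (θ : E) : E →L[ℝ] ℝ :=
  ∑ k, w k • ((π k θ)⁻¹ • fderiv ℝ (π k) θ)

/-- The form `∑ aₖ ∇πₖ ∇πₖᵀ / πₖ` at `θ`. It is the Fisher information if the cells have relative
frequencies `aₖ πₖ(θ)`. -/
noncomputable def cellInfo (π : κ → E → ℝ) (a : κ → ℝ) (θ : E) : E →L[ℝ] E →L[ℝ] ℝ :=
  ∑ k, (a k / π k θ) • (fderiv ℝ (π k) θ).smulRight (fderiv ℝ (π k) θ)

lemma cellInfo_apply (π : κ → E → ℝ) (a : κ → ℝ) (θ c d : E) :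
    cellInfo π a θ c d = ∑ k, a k / π k θ * (fderiv ℝ (π k) θ c * fderiv ℝ (π k) θ d) := by
  simp [cellInfo, sum_apply]

variable {π : κ → E → ℝ} {U : Set E} {θ₀ : E} {a : κ → ℝ} {A : ℝ}

lemma hasFDerivAt_cellLogLik (hU : IsOpen U) (hC : ∀ k, ContDiffOn ℝ 2 (π k) U)
    (hpos : ∀ k, ∀ θ ∈ U, 0 < π k θ) (w : κ → ℝ) {θ : E} (hθ : θ ∈ U) :
    HasFDerivAt (cellLogLik π w) (cellScore π w θ) θ := by
  unfold cellLogLik cellScore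
  refine HasFDerivAt.fun_sum fun k _ => ?_
  have h : DifferentiableAt ℝ (π k) θ :=
    ((hC k).contDiffAt (hU.mem_nhds hθ)).differentiableAt (by norm_num)
  exact (h.hasFDerivAt.log (hpos k θ hθ).ne').const_mul (w k)

lemma cellScore_smul (c : ℝ) (w : κ → ℝ) (θ : E) :
    cellScore π (c • w) θ = c • cellScore π w θ := by
  simp [cellScore, Finset.smul_sum, smul_smul, mul_assoc]

lemma cellScore_eq_zero (hU : IsOpen U) (hθ₀ : θ₀ ∈ U) (hC : ∀ k, ContDiffOn ℝ 2 (π k) U)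
    (hpos : ∀ k, ∀ θ ∈ U, 0 < π k θ) (hsum : ∀ θ ∈ U, ∑ k, a k * π k θ = A) :
    cellScore π (fun k => a k * π k θ₀) θ₀ = 0 := by
  have h1 : HasFDerivAt (fun θ => ∑ k, a k * π k θ) (∑ k, a k • fderiv ℝ (π k) θ₀) θ₀ :=
    HasFDerivAt.fun_sum fun k _ => (((hC k).contDiffAt (hU.mem_nhds hθ₀)).differentiableAt
      (by norm_num)).hasFDerivAt.const_mul (a k)
  have h2 : HasFDerivAt (fun θ => ∑ k, a k * π k θ) (0 : E →L[ℝ] ℝ) θ₀ :=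
    (hasFDerivAt_const A θ₀).congr_of_eventuallyEq
      (by filter_upwards [hU.mem_nhds hθ₀] with θ hθ using hsum θ hθ)
  rw [← h1.unique h2, cellScore]
  refine Finset.sum_congr rfl fun k _ => ?_
  rw [smul_smul, mul_assoc, mul_inv_cancel₀ (hpos k θ₀ hθ₀).ne', mul_one]

/-- At the limiting frequencies the second derivatives of the cell probabilities cancel, because the
cell probabilities have a constant sum; what remains of the derivative of the score is the negative
Fisher information. The derivative is strict, and it is so jointly in frequencies and parameter. -/
lemma hasStrictFDerivAt_cellScore (hU : IsOpen U) (hθ₀ : θ₀ ∈ U)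
    (hC : ∀ k, ContDiffOn ℝ 2 (π k) U) (hpos : ∀ k, ∀ θ ∈ U, 0 < π k θ)
    (hsum : ∀ θ ∈ U, ∑ k, a k * π k θ = A) :
    ∃ D : ((κ → ℝ) × E) →L[ℝ] (E →L[ℝ] ℝ),
      HasStrictFDerivAt (fun x : (κ → ℝ) × E => cellScore π x.1 x.2) D
        ((fun k => a k * π k θ₀), θ₀) ∧ ∀ v, D (0, v) = -cellInfo π a θ₀ v := by
  have hC' : ∀ k, ContDiffAt ℝ 2 (π k) θ₀ := fun k => (hC k).contDiffAt (hU.mem_nhds hθ₀)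
  have hne : ∀ k, π k θ₀ ≠ 0 := fun k => (hpos k θ₀ hθ₀).ne'
  have hπ : ∀ k, HasStrictFDerivAt (π k) (fderiv ℝ (π k) θ₀) θ₀ := fun k =>
    (hC' k).hasStrictFDerivAt (by norm_num)
  have hπ' : ∀ k, HasStrictFDerivAt (fderiv ℝ (π k)) (fderiv ℝ (fderiv ℝ (π k)) θ₀) θ₀ := fun k =>
    ((hC' k).fderiv_right (m := 1) (by norm_num)).hasStrictFDerivAt (by norm_num)
  have hinv : ∀ k, HasStrictFDerivAt (fun θ => (π k θ)⁻¹)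
      (-(π k θ₀ ^ 2)⁻¹ • fderiv ℝ (π k) θ₀) θ₀ := fun k =>
    (hasStrictDerivAt_inv (hne k)).comp_hasStrictFDerivAt θ₀ (hπ k)
  have hl : ∀ k, HasStrictFDerivAt (fun θ => (π k θ)⁻¹ • fderiv ℝ (π k) θ) _ θ₀ := fun k =>
    (hinv k).smul (hπ' k)
  let w₀ : κ → ℝ := fun k => a k * π k θ₀
  have hl2 := fun k => HasStrictFDerivAt.comp (g := fun θ => (π k θ)⁻¹ • fderiv ℝ (π k) θ)
    (f := (Prod.snd : (κ → ℝ) × E → E)) (w₀, θ₀) (hl k) hasStrictFDerivAt_snd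
  have hw := fun k => ((ContinuousLinearMap.proj (R := ℝ) (φ := fun _ : κ => ℝ) k).comp
    (ContinuousLinearMap.fst ℝ (κ → ℝ) E)).hasStrictFDerivAt (x := (w₀, θ₀))
  have hall := HasStrictFDerivAt.fun_sum (u := Finset.univ) fun k _ => (hw k).smul (hl2 k)
  refine ⟨_, hall, fun v => ?_⟩
  have h2 : ∑ k, a k • fderiv ℝ (fderiv ℝ (π k)) θ₀ = 0 := by
    have h1 : HasFDerivAt (fun θ => ∑ k, a k • fderiv ℝ (π k) θ)
        (∑ k, a k • fderiv ℝ (fderiv ℝ (π k)) θ₀) θ₀ :=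
      HasFDerivAt.fun_sum fun k _ => (hπ' k).hasFDerivAt.const_smul (a k)
    refine h1.unique ((hasFDerivAt_const (0 : E →L[ℝ] ℝ) θ₀).congr_of_eventuallyEq ?_)
    filter_upwards [hU.mem_nhds hθ₀] with θ hθ
    have h3 : HasFDerivAt (fun θ => ∑ k, a k * π k θ) (∑ k, a k • fderiv ℝ (π k) θ) θ :=
      HasFDerivAt.fun_sum fun k _ => (((hC k).contDiffAt (hU.mem_nhds hθ)).differentiableAt
        (by norm_num)).hasFDerivAt.const_mul (a k)
    refine h3.unique ((hasFDerivAt_const A θ).congr_of_eventuallyEq ?_)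
    filter_upwards [hU.mem_nhds hθ] with θ hθ using hsum θ hθ
  ext d
  have h2' : ∑ k, a k * fderiv ℝ (fderiv ℝ (π k)) θ₀ v d = 0 := by
    simpa [sum_apply] using DFunLike.congr_fun (DFunLike.congr_fun h2 v) d
  rw [neg_apply, cellInfo_apply, ← sub_eq_zero, sub_neg_eq_add, ← h2']
  simp only [sum_apply, add_apply, smul_apply, ContinuousLinearMap.comp_apply,
    ContinuousLinearMap.smulRight_apply, ContinuousLinearMap.coe_fst', ContinuousLinearMap.coe_snd',
    ContinuousLinearMap.proj_apply, Pi.zero_apply, zero_smul, add_zero,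
    smul_eq_mul, ← Finset.sum_add_distrib]
  refine Finset.sum_congr rfl fun k _ => ?_
  have := hne k
  simp only [w₀]
  field_simp
  ring

end CellLogLikelihood

/-! ### Critical points and maximizers near the true parameter -/

section LocalMaximizers

variable {κ E : Type*} [Fintype κ] [NormedAddCommGroup E] [NormedSpace ℝ E]
  {π : κ → E → ℝ} {U : Set E} {θ₀ : E} {a : κ → ℝ} {A : ℝ}

lemma exists_pos_mul_sq_le_of_posDef [FiniteDimensional ℝ E] (B : E →L[ℝ] E →L[ℝ] ℝ)
    (hB : ∀ c, c ≠ 0 → 0 < B c c) : ∃ μ > 0, ∀ c, μ * ‖c‖ ^ 2 ≤ B c c := by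
  rcases subsingleton_or_nontrivial E with hE | hE
  · exact ⟨1, one_pos, fun c => by simp [Subsingleton.elim c 0]⟩
  have hcont : Continuous fun c => B c c := by fun_prop
  obtain ⟨c₀, hc₀, hmin⟩ := (isCompact_sphere (0 : E) 1).exists_isMinOn
    (NormedSpace.sphere_nonempty.2 zero_le_one) hcont.continuousOn
  have hc₀' : c₀ ≠ 0 := by
    rintro rfl
    simp at hc₀
  refine ⟨B c₀ c₀, hB c₀ hc₀', fun c => ?_⟩
  rcases eq_or_ne c 0 with rfl | hc
  · simp
  have hn : ‖c‖ ≠ 0 := norm_ne_zero_iff.2 hc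
  have h := hmin (show ‖c‖⁻¹ • c ∈ Metric.sphere (0 : E) 1 by simp [norm_smul, hn])
  simp only [Set.mem_ofPred_eq, map_smul, smul_apply, smul_eq_mul] at h
  calc B c₀ c₀ * ‖c‖ ^ 2 ≤ ‖c‖⁻¹ * (‖c‖⁻¹ * B c c) * ‖c‖ ^ 2 := by gcongr
    _ = B c c := by field_simp

/-- Near the true parameter the score is strongly monotone, uniformly for frequencies near the
limiting ones: the log-likelihood is uniformly strictly concave there. -/
lemma exists_cellScore_sub_apply_le [FiniteDimensional ℝ E] (hU : IsOpen U) (hθ₀ : θ₀ ∈ U)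
    (hC : ∀ k, ContDiffOn ℝ 2 (π k) U) (hpos : ∀ k, ∀ θ ∈ U, 0 < π k θ)
    (hsum : ∀ θ ∈ U, ∑ k, a k * π k θ = A) (hinfo : ∀ c, c ≠ 0 → 0 < cellInfo π a θ₀ c c) :
    ∃ μ > 0, ∃ r₀ > 0, Metric.closedBall θ₀ r₀ ⊆ U ∧ ∀ᶠ w in 𝓝 fun k => a k * π k θ₀,
      ∀ θ ∈ Metric.closedBall θ₀ r₀, ∀ θ' ∈ Metric.closedBall θ₀ r₀,
        (cellScore π w θ - cellScore π w θ') (θ - θ') ≤ -(μ * ‖θ - θ'‖ ^ 2) := by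
  obtain ⟨μ, hμ, hle⟩ := exists_pos_mul_sq_le_of_posDef _ hinfo
  obtain ⟨D, hD, hDv⟩ := hasStrictFDerivAt_cellScore hU hθ₀ hC hpos hsum
  have ho := (Asymptotics.isLittleO_iff.1 hD.isLittleO) (half_pos hμ)
  rw [nhds_prod_eq, nhds_prod_eq] at ho
  obtain ⟨S, hS, S', hS', hSS⟩ := Filter.mem_prod_iff.1 ho
  obtain ⟨V, hV, N, hN, hVN⟩ := Filter.mem_prod_iff.1 hS
  obtain ⟨V', hV', N', hN', hVN'⟩ := Filter.mem_prod_iff.1 hS'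
  obtain ⟨r₀, hr₀, hball⟩ := Metric.nhds_basis_closedBall.mem_iff.1
    (inter_mem (inter_mem hN hN') (hU.mem_nhds hθ₀))
  refine ⟨μ / 2, half_pos hμ, r₀, hr₀, fun θ hθ => (hball hθ).2, ?_⟩
  filter_upwards [hV, hV'] with w hw hw' θ hθ θ' hθ'
  have h := hSS (Set.mk_mem_prod (hVN (Set.mk_mem_prod hw (hball hθ).1.1))
    (hVN' (Set.mk_mem_prod hw' (hball hθ').1.2)))
  simp only [Set.mem_ofPred_eq, Prod.mk_sub_mk, sub_self, hDv, Prod.norm_mk, norm_zero,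
    sub_neg_eq_add] at h
  rw [max_eq_right (norm_nonneg _)] at h
  have h2 := (ContinuousLinearMap.le_opNorm (cellScore π w θ - cellScore π w θ' +
    cellInfo π a θ₀ (θ - θ')) (θ - θ')).trans (mul_le_mul_of_nonneg_right h (norm_nonneg _))
  have h3 := (le_abs_self _).trans h2
  rw [add_apply] at h3
  have h4 := hle (θ - θ')
  nlinarith

lemma cellScore_apply_sub_nonneg_of_isMaxOn (hU : IsOpen U) (hC : ∀ k, ContDiffOn ℝ 2 (π k) U)
    (hpos : ∀ k, ∀ θ ∈ U, 0 < π k θ) {w : κ → ℝ} {r : ℝ} (hr : 0 ≤ r)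
    (hrU : Metric.closedBall θ₀ r ⊆ U) {θ : E} (hθ : θ ∈ Metric.closedBall θ₀ r)
    (hmax : IsMaxOn (cellLogLik π w) (Metric.closedBall θ₀ r) θ) :
    0 ≤ cellScore π w θ (θ - θ₀) := by
  have h := hmax.localize.hasFDerivWithinAt_nonpos
    (hasFDerivAt_cellLogLik hU hC hpos w (hrU hθ)).hasFDerivWithinAt
    (sub_mem_posTangentConeAt_of_segment_subset
      ((convex_closedBall θ₀ r).segment_subset hθ (Metric.mem_closedBall_self hr)))
  rw [← neg_sub, map_neg]
  linarith

/-- For frequencies near the limiting ones, the log-likelihood has exactly one critical point in a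
small closed ball about the true parameter, and it is the only maximizer over that ball. -/
theorem exists_forall_eventually_unique_critical_point [FiniteDimensional ℝ E] (hU : IsOpen U)
    (hθ₀ : θ₀ ∈ U) (hC : ∀ k, ContDiffOn ℝ 2 (π k) U) (hpos : ∀ k, ∀ θ ∈ U, 0 < π k θ)
    (hsum : ∀ θ ∈ U, ∑ k, a k * π k θ = A) (hinfo : ∀ c, c ≠ 0 → 0 < cellInfo π a θ₀ c c) :
    ∃ r₀ > 0, Metric.closedBall θ₀ r₀ ⊆ U ∧ ∀ r, 0 < r → r ≤ r₀ →
      ∀ᶠ w in 𝓝 fun k => a k * π k θ₀, ∃ θ ∈ Metric.ball θ₀ r, cellScore π w θ = 0 ∧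
        IsMaxOn (cellLogLik π w) (Metric.closedBall θ₀ r) θ ∧
        ∀ θ' ∈ Metric.closedBall θ₀ r, cellScore π w θ' = 0 ∨
          IsMaxOn (cellLogLik π w) (Metric.closedBall θ₀ r) θ' → θ' = θ := by
  obtain ⟨μ, hμ, r₀, hr₀, hrU, hmono⟩ := exists_cellScore_sub_apply_le hU hθ₀ hC hpos hsum hinfo
  refine ⟨r₀, hr₀, hrU, fun r hr hrr => ?_⟩
  have hsub : Metric.closedBall θ₀ r ⊆ Metric.closedBall θ₀ r₀ :=
    Metric.closedBall_subset_closedBall hrr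
  have hsmall : ∀ᶠ w in 𝓝 fun k => a k * π k θ₀, ‖cellScore π w θ₀‖ < μ * r := by
    have hcont : Continuous fun w => ‖cellScore π w θ₀‖ := by
      unfold cellScore
      fun_prop
    have := hcont.tendsto fun k => a k * π k θ₀
    rw [cellScore_eq_zero hU hθ₀ hC hpos hsum, norm_zero] at this
    exact this.eventually_lt_const (by positivity)
  filter_upwards [hmono, hsmall] with w hmono hsmall
  have hmem₀ : θ₀ ∈ Metric.closedBall θ₀ r₀ := Metric.mem_closedBall_self hr₀.le
  have hint : ∀ θ ∈ Metric.closedBall θ₀ r, IsMaxOn (cellLogLik π w) (Metric.closedBall θ₀ r) θ →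
      θ ∈ Metric.ball θ₀ r ∧ cellScore π w θ = 0 := by
    intro θ hθ hmax
    have h1 := cellScore_apply_sub_nonneg_of_isMaxOn hU hC hpos hr.le (hsub.trans hrU) hθ hmax
    have h2 := hmono θ (hsub hθ) θ₀ hmem₀
    have h3 := (abs_le.1 ((cellScore π w θ₀).le_opNorm (θ - θ₀))).2
    rw [sub_apply] at h2
    have hball : θ ∈ Metric.ball θ₀ r := by
      rw [mem_ball_iff_norm]
      rcases (norm_nonneg (θ - θ₀)).eq_or_lt with h0 | h0
      · rwa [← h0]
      · have h4 : μ * ‖θ - θ₀‖ ≤ ‖cellScore π w θ₀‖ := by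
          refine le_of_mul_le_mul_right ?_ h0
          linarith
        exact lt_of_mul_lt_mul_left (h4.trans_lt hsmall) hμ.le
    refine ⟨hball, ?_⟩
    have hloc : IsLocalMax (cellLogLik π w) θ :=
      hmax.isLocalMax (mem_of_superset (Metric.isOpen_ball.mem_nhds hball)
        Metric.ball_subset_closedBall)
    exact hloc.hasFDerivAt_eq_zero (hasFDerivAt_cellLogLik hU hC hpos w (hrU (hsub hθ)))
  have huniq : ∀ θ ∈ Metric.closedBall θ₀ r, ∀ θ' ∈ Metric.closedBall θ₀ r,
      cellScore π w θ = 0 → cellScore π w θ' = 0 → θ' = θ := by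
    intro θ hθ θ' hθ' h h'
    have h2 := hmono θ' (hsub hθ') θ (hsub hθ)
    rw [h, h', sub_self, zero_apply] at h2
    have h3 : ‖θ' - θ‖ ^ 2 ≤ 0 := nonpos_of_mul_nonpos_right (by linarith) hμ
    exact sub_eq_zero.1 (norm_eq_zero.1 (pow_eq_zero_iff (two_ne_zero) |>.1
      (le_antisymm h3 (sq_nonneg _))))
  obtain ⟨θ, hθ, hmax⟩ := (isCompact_closedBall θ₀ r).exists_isMaxOn
    (Metric.nonempty_closedBall.2 hr.le) (f := cellLogLik π w) fun x hx =>
      (hasFDerivAt_cellLogLik hU hC hpos w (hrU (hsub hx))).continuousAt.continuousWithinAt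
  refine ⟨θ, (hint θ hθ hmax).1, (hint θ hθ hmax).2, hmax, fun θ' hθ' h => ?_⟩
  refine huniq θ hθ θ' hθ' (hint θ hθ hmax).2 ?_
  exact h.elim id fun h => (hint θ' hθ' h).2

/-- Maximizers over a small ball converge to the true parameter: they solve the likelihood
equations, and so they are the maximizers over every smaller ball. -/
lemma tendsto_of_isMaxOn_closedBall {r₀ : ℝ} {w₀ : κ → ℝ}
    (huniq : ∀ r, 0 < r → r ≤ r₀ →
      ∀ᶠ w in 𝓝 w₀, ∃ θ ∈ Metric.ball θ₀ r, cellScore π w θ = 0 ∧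
        IsMaxOn (cellLogLik π w) (Metric.closedBall θ₀ r) θ ∧
        ∀ θ' ∈ Metric.closedBall θ₀ r, cellScore π w θ' = 0 ∨
          IsMaxOn (cellLogLik π w) (Metric.closedBall θ₀ r) θ' → θ' = θ)
    {r : ℝ} (hr : 0 < r) (hrr : r ≤ r₀) {α : Type*} {l : Filter α} {w : α → κ → ℝ} {θ : α → E}
    (hw : Tendsto w l (𝓝 w₀)) (hθ : ∀ᶠ x in l, θ x ∈ Metric.closedBall θ₀ r ∧
      IsMaxOn (cellLogLik π (w x)) (Metric.closedBall θ₀ r) (θ x)) :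
    Tendsto θ l (𝓝 θ₀) := by
  rw [Metric.tendsto_nhds]
  intro ε hε
  have hr' : 0 < min ε r := lt_min hε hr
  filter_upwards [hθ, hw.eventually (huniq r hr hrr),
    hw.eventually (huniq (min ε r) hr' ((min_le_right _ _).trans hrr))] with x hx h1 h2
  obtain ⟨θ₁, hθ₁, -, -, hu₁⟩ := h1
  obtain ⟨θ₂, hθ₂, hs₂, -, -⟩ := h2
  rw [hu₁ _ hx.1 (Or.inr hx.2), ← hu₁ θ₂ (Metric.closedBall_subset_closedBall (min_le_right _ _)
    (Metric.ball_subset_closedBall hθ₂)) (Or.inl hs₂)]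
  exact (Metric.mem_ball.1 hθ₂).trans_le (min_le_left _ _)

/-- The linearized likelihood equations. -/
lemma isLittleO_cellScore_sub_cellInfo (hU : IsOpen U) (hθ₀ : θ₀ ∈ U)
    (hC : ∀ k, ContDiffOn ℝ 2 (π k) U) (hpos : ∀ k, ∀ θ ∈ U, 0 < π k θ)
    (hsum : ∀ θ ∈ U, ∑ k, a k * π k θ = A) {α : Type*} {l : Filter α} {w : α → κ → ℝ} {θ : α → E}
    (hw : Tendsto w l (𝓝 fun k => a k * π k θ₀)) (hθ : Tendsto θ l (𝓝 θ₀))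
    (hroot : ∀ᶠ x in l, cellScore π (w x) (θ x) = 0) :
    (fun x => cellScore π (w x) θ₀ - cellInfo π a θ₀ (θ x - θ₀)) =o[l] fun x => θ x - θ₀ := by
  obtain ⟨D, hD, hDv⟩ := hasStrictFDerivAt_cellScore hU hθ₀ hC hpos hsum
  have h := hD.isLittleO.comp_tendsto
    ((hw.prodMk_nhds hθ).prodMk_nhds (hw.prodMk_nhds (tendsto_const_nhds (x := θ₀))))
  refine (h.neg_left.congr' ?_ EventuallyEq.rfl).trans_isBigO ?_
  · filter_upwards [hroot] with x hx
    simp only [Function.comp_apply, hx, Prod.mk_sub_mk, sub_self, hDv]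
    abel
  · refine Asymptotics.isBigO_of_le _ fun x => ?_
    simp [Prod.norm_def]

end LocalMaximizers

/-! ### Frequencies fitted at least as well as by the truth -/

/-- If cell probabilities `p` fit the frequencies `w` at least as well as `p₀` does, and `w` tends
to the frequencies `aₖ p₀ₖ`, then `p` tends to `p₀`: by `log x ≤ 2 (√x - 1)` the weighted squared
Hellinger distance of `p` and `p₀` is bounded by a multiple of the distance of `w` to its limit. -/
lemma tendsto_of_sum_mul_log_le {κ α : Type*} [Fintype κ] {l : Filter α} {a p₀ : κ → ℝ}
    (ha : ∀ k, 0 < a k) (hp₀ : ∀ k, 0 < p₀ k) {w p : α → κ → ℝ}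
    (hw : Tendsto w l (𝓝 fun k => a k * p₀ k))
    (hp : ∀ᶠ x in l, (∀ k, 0 ≤ w x k) ∧ (∀ k, 0 < p x k ∧ p x k ≤ 1) ∧
      ∑ k, a k * p x k = ∑ k, a k * p₀ k ∧
      ∑ k, w x k * Real.log (p₀ k) ≤ ∑ k, w x k * Real.log (p x k)) (k : κ) :
    Tendsto (fun x => p x k) l (𝓝 (p₀ k)) := by
  let B : α → ℝ := fun x => 2 * ∑ j, |w x j - a j * p₀ j| * ((√(p₀ j))⁻¹ + 1)
  have hB : Tendsto B l (𝓝 0) := by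
    have h : Tendsto B l (𝓝 (2 * ∑ j : κ, |a j * p₀ j - a j * p₀ j| * ((√(p₀ j))⁻¹ + 1))) := by
      refine (tendsto_finsetSum _ fun j _ => Tendsto.mul_const _ (Tendsto.abs ?_)).const_mul 2
      exact ((tendsto_pi_nhds.1 hw j).sub_const _)
    simpa using h
  have hle : ∀ᶠ x in l, (√(p x k) - √(p₀ k)) ^ 2 ≤ B x / a k ∧ 0 < p x k := by
    filter_upwards [hp] with x hx
    obtain ⟨hw0, hpx, hs, hlog⟩ := hx
    refine ⟨?_, (hpx k).1⟩
    rw [le_div_iff₀ (ha k)]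
    have h1 : 0 ≤ 2 * ∑ j, w x j * (√(p x j) / √(p₀ j) - 1) := by
      calc 0 ≤ ∑ j, (w x j * Real.log (p x j) - w x j * Real.log (p₀ j)) := by
            rw [Finset.sum_sub_distrib]; linarith
        _ ≤ ∑ j, 2 * (w x j * (√(p x j) / √(p₀ j) - 1)) := by
            refine Finset.sum_le_sum fun j _ => ?_
            have hlog2 := Real.log_le_sub_one_of_pos
              (div_pos (Real.sqrt_pos.2 (hpx j).1) (Real.sqrt_pos.2 (hp₀ j)))
            rw [Real.log_div (Real.sqrt_pos.2 (hpx j).1).ne' (Real.sqrt_pos.2 (hp₀ j)).ne',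
              Real.log_sqrt (hpx j).1.le, Real.log_sqrt (hp₀ j).le] at hlog2
            have := mul_le_mul_of_nonneg_left hlog2 (hw0 j)
            linarith
        _ = _ := by rw [Finset.mul_sum]
    have h2 : ∑ j, a j * (√(p x j) - √(p₀ j)) ^ 2 =
        -(2 * ∑ j, a j * p₀ j * (√(p x j) / √(p₀ j) - 1)) := by
      have h3 : ∀ j, a j * (√(p x j) - √(p₀ j)) ^ 2 = (a j * p x j - a j * p₀ j) -
          2 * (a j * p₀ j * (√(p x j) / √(p₀ j) - 1)) := by
        intro j
        have e1 := Real.sq_sqrt (hpx j).1.le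
        have e2 := Real.sq_sqrt (hp₀ j).le
        have e3 := (Real.sqrt_pos.2 (hp₀ j)).ne'
        have e4 : p₀ j * (√(p x j) / √(p₀ j)) = √(p₀ j) * √(p x j) := by
          nth_rw 1 [← e2]
          field_simp
        linear_combination a j * e1 + a j * e2 + 2 * a j * e4
      rw [Finset.sum_congr rfl fun j _ => h3 j, Finset.sum_sub_distrib, Finset.sum_sub_distrib, hs,
        ← Finset.mul_sum]
      ring
    have h4 : (∑ j, w x j * (√(p x j) / √(p₀ j) - 1)) -
        ∑ j, a j * p₀ j * (√(p x j) / √(p₀ j) - 1) ≤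
          ∑ j, |w x j - a j * p₀ j| * ((√(p₀ j))⁻¹ + 1) := by
      rw [← Finset.sum_sub_distrib]
      refine Finset.sum_le_sum fun j _ => ?_
      rw [← sub_mul]
      refine (le_abs_self _).trans ?_
      rw [abs_mul]
      refine mul_le_mul_of_nonneg_left ?_ (abs_nonneg _)
      refine (abs_sub _ _).trans ?_
      rw [abs_one, abs_of_nonneg (by positivity), div_eq_mul_inv]
      have : √(p x j) ≤ 1 := Real.sqrt_le_one.2 (hpx j).2
      have := mul_le_mul_of_nonneg_right this (inv_nonneg.2 (Real.sqrt_nonneg (p₀ j)))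
      linarith
    calc (√(p x k) - √(p₀ k)) ^ 2 * a k = a k * (√(p x k) - √(p₀ k)) ^ 2 := mul_comm _ _
      _ ≤ ∑ j, a j * (√(p x j) - √(p₀ j)) ^ 2 :=
          Finset.single_le_sum (f := fun j => a j * (√(p x j) - √(p₀ j)) ^ 2)
            (fun j _ => mul_nonneg (ha j).le (sq_nonneg _)) (Finset.mem_univ k)
      _ ≤ B x := by rw [h2]; simp only [B]; linarith
  have hsq : Tendsto (fun x => (√(p x k) - √(p₀ k)) ^ 2) l (𝓝 0) := by
    have := hB.div_const (a k)
    rw [zero_div] at this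
    exact tendsto_of_tendsto_of_tendsto_of_le_of_le' tendsto_const_nhds this
      (Eventually.of_forall fun x => sq_nonneg _) (hle.mono fun x hx => hx.1)
  have habs : Tendsto (fun x => |√(p x k) - √(p₀ k)|) l (𝓝 0) := by
    have := hsq.sqrt
    simpa [Real.sqrt_sq_eq_abs] using this
  have hsqrt : Tendsto (fun x => √(p x k)) l (𝓝 √(p₀ k)) :=
    tendsto_iff_dist_tendsto_zero.2 habs
  have := hsqrt.pow 2
  rw [Real.sq_sqrt (hp₀ k).le] at this
  refine this.congr' ?_
  filter_upwards [hle] with x hx using Real.sq_sqrt hx.2.le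

/-! ### The filter of events whose probability tends to one -/

section InProbability

variable {Ω : Type*} [MeasurableSpace Ω] {P : Measure Ω}

/-- The filter on `ℕ × Ω` whose members are the sequences of events with exceptional probability
tending to zero. Convergence to a constant along it is convergence in probability, so that the
calculus of limits and of `o(·)` along filters applies to sequences of random variables. -/
def inProbability (P : Measure Ω) : Filter (ℕ × Ω) where
  sets := {A | Tendsto (fun n => P {ω | (n, ω) ∉ A}) atTop (𝓝 0)}
  univ_sets := by simp
  sets_of_superset {A B} hA hAB :=
    tendsto_of_tendsto_of_tendsto_of_le_of_le tendsto_const_nhds hA (fun _ => zero_le)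
      fun n => measure_mono fun ω hω h => hω (hAB h)
  inter_sets {A B} hA hB := by
    have h := Tendsto.add (f := fun n => P {ω | (n, ω) ∉ A}) hA hB
    rw [add_zero] at h
    refine tendsto_of_tendsto_of_tendsto_of_le_of_le tendsto_const_nhds h (fun _ => zero_le)
      fun n => (measure_mono ?_).trans (measure_union_le _ _)
    intro ω hω
    by_contra hc
    simp only [Set.mem_union, Set.mem_ofPred_eq, not_or, not_not] at hc
    exact hω hc

lemma eventually_inProbability_iff {A : ℕ × Ω → Prop} :
    (∀ᶠ x in inProbability P, A x) ↔ Tendsto (fun n => P {ω | ¬ A (n, ω)}) atTop (𝓝 0) :=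
  Iff.rfl

lemma tendsto_fst_inProbability : Tendsto Prod.fst (inProbability P) atTop := by
  refine tendsto_atTop.2 fun N => eventually_inProbability_iff.2 ?_
  refine tendsto_const_nhds.congr' ?_
  filter_upwards [eventually_ge_atTop N] with n hn
  simp [hn]

lemma tendstoInMeasure_const_iff {E : Type*} [PseudoMetricSpace E] {f : ℕ → Ω → E} {c : E} :
    TendstoInMeasure P f atTop (fun _ => c) ↔
      Tendsto (fun x : ℕ × Ω => f x.1 x.2) (inProbability P) (𝓝 c) := by
  simp only [tendstoInMeasure_iff_dist, Metric.tendsto_nhds, eventually_inProbability_iff, not_lt]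

lemma withProbTendingToOne_of_eventually [IsProbabilityMeasure P] {A : ℕ → Ω → Prop}
    (h : ∀ᶠ x in inProbability P, A x.1 x.2) : WithProbTendingToOne P A := by
  have h' := ENNReal.Tendsto.sub (tendsto_const_nhds (x := (1 : ENNReal)) (f := atTop))
    (eventually_inProbability_iff.1 h) (Or.inl ENNReal.one_ne_top)
  rw [tsub_zero] at h'
  refine tendsto_of_tendsto_of_tendsto_of_le_of_le h' tendsto_const_nhds (fun n => ?_)
    fun n => prob_le_one
  rw [tsub_le_iff_right, ← measure_univ (μ := P)]
  refine (measure_mono fun ω _ => ?_).trans (measure_union_le _ _)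
  exact em (A n ω)

lemma WithProbTendingToOne.eventually [IsProbabilityMeasure P] {A : ℕ → Ω → Prop}
    (h : WithProbTendingToOne P A) (hA : ∀ n, MeasurableSet {ω | A n ω}) :
    ∀ᶠ x in inProbability P, A x.1 x.2 := by
  rw [eventually_inProbability_iff]
  have h' := ENNReal.Tendsto.sub (tendsto_const_nhds (x := (1 : ENNReal)) (f := atTop)) h
    (Or.inl ENNReal.one_ne_top)
  rw [tsub_self] at h'
  exact h'.congr fun n => (prob_compl_eq_one_sub (hA n)).symm

/-- Bounded convergence, for convergence in probability to a constant. -/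
lemma tendsto_integral_of_tendsto_inProbability [IsProbabilityMeasure P] {F : Type*}
    [NormedAddCommGroup F] [NormedSpace ℝ F] [CompleteSpace F] {f : ℕ → Ω → F} {c : F} {K : ℝ}
    (hf : ∀ n, AEStronglyMeasurable (f n) P) (hK : ∀ n ω, ‖f n ω‖ ≤ K)
    (h : Tendsto (fun x : ℕ × Ω => f x.1 x.2) (inProbability P) (𝓝 c)) :
    Tendsto (fun n => ∫ ω, f n ω ∂P) atTop (𝓝 c) := by
  refine tendsto_of_subseq_tendsto fun ns hns => ?_
  obtain ⟨ms, -, hms⟩ := ((tendstoInMeasure_const_iff.2 h).comp hns).exists_seq_tendsto_ae'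
  refine ⟨ms, ?_⟩
  have := tendsto_integral_of_dominated_convergence (μ := P) (fun _ => K)
    (F := fun n ω => f (ns (ms n)) ω) (f := fun _ => c) (fun n => hf _) (integrable_const K)
    (fun n => Eventually.of_forall fun ω => hK _ ω) hms
  simpa using this

/-- Random vectors with a relative difference that tends to zero in probability have the same limit
in distribution. -/
lemma tendstoInDistribution_of_isLittleO [IsProbabilityMeasure P] {Ω' E : Type*}
    [MeasurableSpace Ω'] {μ : Measure Ω'} [IsProbabilityMeasure μ] [NormedAddCommGroup E]
    [NormedSpace ℝ E] [MeasurableSpace E] [BorelSpace E] [SecondCountableTopology E]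
    {X Y : ℕ → Ω → E} {Z : Ω' → E} (hX : TendstoInDistribution X atTop Z (fun _ => P) μ)
    (hY : ∀ n, AEMeasurable (Y n) P)
    (hXY : (fun x : ℕ × Ω => Y x.1 x.2 - X x.1 x.2) =o[inProbability P] fun x => X x.1 x.2) :
    TendstoInDistribution Y atTop Z (fun _ => P) μ := by
  let δ : ℕ → Ω → E := fun n ω => ‖X n ω‖⁻¹ • (Y n ω - X n ω)
  have hδm : ∀ n, AEMeasurable (δ n) P := fun n =>
    (hX.forall_aemeasurable n).norm.inv.smul ((hY n).sub (hX.forall_aemeasurable n))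
  have hδ : TendstoInMeasure P δ atTop fun _ => 0 := by
    rw [tendstoInMeasure_const_iff, tendsto_zero_iff_norm_tendsto_zero]
    refine (hXY.norm_norm.tendsto_div_nhds_zero).congr fun x => ?_
    simp only [δ]
    rw [norm_smul, norm_inv, norm_norm, div_eq_inv_mul]
  have h1 := hX.continuous_comp_prodMk_of_tendstoInMeasure_const
    (g := fun z : E × E => z.1 + ‖z.1‖ • z.2) (by fun_prop) hδ hδm
  simp only [smul_zero, add_zero] at h1
  refine tendstoInDistribution_of_tendstoInMeasure_sub Y Z h1 ?_ hY
  refine (tendstoInMeasure_const_iff (c := (0 : E))).2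
    ((tendsto_const_nhds (x := (0 : E))).congr' ?_)
  filter_upwards [Asymptotics.isLittleO_iff.1 hXY one_pos] with x hx
  rcases eq_or_ne (X x.1 x.2) 0 with h0 | h0
  · have : Y x.1 x.2 = 0 := by simpa [h0] using hx
    simp [h0, this]
  · simp only [δ, Pi.sub_apply]
    rw [smul_smul, mul_inv_cancel₀ (norm_ne_zero_iff.2 h0), one_smul]
    abel

end InProbability

noncomputable section

/-! ### The history of a life test -/

/-- What happens to a unit with failure time and cause `x` that enters the `i`-th interval: it
survives (`none`) or it fails from a cause `j` (`some j`). -/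
def outcome {J : ℕ} (L : ℕ → ℝ) (i : ℕ) (x : ℝ × Fin J) : Option (Fin J) :=
  if L (i + 1) < x.1 then none else some x.2

/-- The failure times and causes of the units that live beyond `L i`; no condition for `i = 0`. -/
def aliveAt {J : ℕ} (L : ℕ → ℝ) : ℕ → Set (ℝ × Fin J)
  | 0 => Set.univ
  | i + 1 => {x | L (i + 1) < x.1}

/-- The number of units at risk in the `i`-th interval that meet the outcome `o` in it. -/
def outcomeCount {J : ℕ} (L t : ℕ → ℝ) (c : ℕ → Fin J) (W : ℕ → Finset ℕ) (n i : ℕ)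
    (o : Option (Fin J)) : ℕ :=
  ((atRisk L t W n i).filter fun k => outcome L i (t k, c k) = o).card

/-- What happens in one interval: the sets of units that fail, by cause, and the set of units that
are withdrawn at its right end. -/
abbrev StageRecord (J : ℕ) : Type := (Fin J → Finset ℕ) × Finset ℕ

/-- The record of the `i`-th interval of a test. -/
def stageRecord {J : ℕ} (L t : ℕ → ℝ) (c : ℕ → Fin J) (W : ℕ → Finset ℕ) (n i : ℕ) :
    StageRecord J :=
  (failures L t c W n i, W i)

/-- The units at risk at the start of the `i`-th interval, computed from the records of the earlier
intervals. -/
def recordedAtRisk {J : ℕ} (n : ℕ) (h : ℕ → StageRecord J) : ℕ → Finset ℕ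
  | 0 => Finset.range n
  | i + 1 => (recordedAtRisk n h i \ Finset.univ.biUnion (h i).1) \ (h i).2

section Deterministic

variable {J : ℕ} {L t : ℕ → ℝ} {c : ℕ → Fin J} {W : ℕ → Finset ℕ} {n i : ℕ}

lemma outcome_eq_none_iff {x : ℝ × Fin J} : outcome L i x = none ↔ L (i + 1) < x.1 := by
  simp [outcome]

lemma outcome_eq_some_iff {x : ℝ × Fin J} {j : Fin J} :
    outcome L i x = some j ↔ x.1 ≤ L (i + 1) ∧ x.2 = j := by
  unfold outcome
  split_ifs with h
  · simp [h]
  · simp [not_lt.1 h]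

lemma failures_eq_filter_outcome (j : Fin J) : failures L t c W n i j =
    (atRisk L t W n i).filter fun k => outcome L i (t k, c k) = some j := by
  simp [failures, outcome_eq_some_iff]

lemma outcomeCount_some (j : Fin J) :
    outcomeCount L t c W n i (some j) = (failures L t c W n i j).card := by
  rw [outcomeCount, failures_eq_filter_outcome]

lemma outcomeCount_none : outcomeCount L t c W n i none = (survivors L t W n i).card := by
  simp [outcomeCount, survivors, outcome_eq_none_iff]

lemma sum_outcomeCount : ∑ o, outcomeCount L t c W n i o = (atRisk L t W n i).card :=
  (Finset.card_eq_sum_card_fiberwise fun _ _ => Finset.mem_univ _).symm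

lemma survivors_eq : survivors L t W n i =
    atRisk L t W n i \ Finset.univ.biUnion (failures L t c W n i) := by
  ext k
  simp only [survivors, failures, Finset.mem_filter, Finset.mem_sdiff, Finset.mem_biUnion,
    Finset.mem_univ, true_and, not_exists, not_and]
  constructor
  · rintro ⟨h1, h2⟩
    exact ⟨h1, fun j _ h => absurd h2 (not_lt.2 h)⟩
  · rintro ⟨h1, h2⟩
    exact ⟨h1, not_le.1 fun h => h2 (c k) h1 h rfl⟩

lemma atRisk_eq_recordedAtRisk {h : ℕ → StageRecord J}
    (hh : ∀ l < i, stageRecord L t c W n l = h l) : atRisk L t W n i = recordedAtRisk n h i := by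
  induction i with
  | zero => rfl
  | succ i ih =>
    have h1 := hh i (Nat.lt_succ_self i)
    rw [recordedAtRisk, ← ih fun l hl => hh l (hl.trans (Nat.lt_succ_self i)), ← h1]
    change survivors L t W n i \ W i = _
    rw [survivors_eq (c := c)]
    rfl

lemma recordedAtRisk_subset_range (h : ℕ → StageRecord J) (i : ℕ) :
    recordedAtRisk n h i ⊆ Finset.range n := by
  induction i with
  | zero => exact subset_rfl
  | succ i ih => exact Finset.sdiff_subset.trans (Finset.sdiff_subset.trans ih)

lemma measurableSet_outcome_preimage (S : Set (Option (Fin J))) :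
    MeasurableSet (outcome L i ⁻¹' S) := by
  have h : outcome L i ⁻¹' S = {x : ℝ × Fin J | L (i + 1) < x.1 ∧ none ∈ S} ∪
      {x : ℝ × Fin J | x.1 ≤ L (i + 1) ∧ some x.2 ∈ S} := by
    ext x
    by_cases hx : L (i + 1) < x.1
    · simp [outcome, hx, not_le.2 hx]
    · simp [outcome, hx, not_lt.1 hx]
  rw [h]
  refine ((measurableSet_lt measurable_const measurable_fst).inter (.const _)).union
    ((measurableSet_le measurable_fst measurable_const).inter ?_)
  exact measurable_snd (Set.toFinite {j | some j ∈ S}).measurableSet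

lemma measurableSet_aliveAt : MeasurableSet (aliveAt L i : Set (ℝ × Fin J)) := by
  cases i with
  | zero => exact MeasurableSet.univ
  | succ i => exact measurableSet_lt measurable_const measurable_fst

end Deterministic

namespace CompetingRisksModel.IsLifeTest

variable {J s M : ℕ} {m : CompetingRisksModel J s} {ζ : PICScheme M} {θ₀ : ParamSpace s}
  {Ω 𝒱 : Type*} [MeasurableSpace Ω] [MeasurableSpace 𝒱] {P : Measure Ω}
  {T : ℕ → Ω → ℝ} {C : ℕ → Ω → Fin J} {V : Ω → 𝒱}
  {rule : ℕ → ℕ → 𝒱 → (ℕ → Fin J → Finset ℕ) → Finset ℕ} {W : ℕ → Ω → ℕ → Finset ℕ}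

/-- A given history amounts to a condition on the randomization and to separate conditions on the
units. The condition on a unit that is still at risk is only that it is alive: the rule of
withdrawal is non-informative. -/
lemma exists_forall_stageRecord_eq_iff (htest : m.IsLifeTest ζ P θ₀ T C V rule W) (n : ℕ)
    (h : ℕ → StageRecord J) {i : ℕ} (hi : i ≤ M) :
    ∃ B : Set 𝒱, MeasurableSet B ∧ ∃ A : ℕ → Set (ℝ × Fin J), (∀ k, MeasurableSet (A k)) ∧
      (∀ k ∈ recordedAtRisk n h i, A k = aliveAt ζ.L i) ∧
      ∀ ω, (∀ l < i, stageRecord ζ.L (fun k => T k ω) (fun k => C k ω) (W n ω) n l = h l) ↔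
        V ω ∈ B ∧ ∀ k ∈ Finset.range n, (T k ω, C k ω) ∈ A k := by
  classical
  induction i with
  | zero => exact ⟨Set.univ, .univ, fun _ => Set.univ, fun _ => .univ, fun _ _ => rfl, by simp⟩
  | succ i ih =>
    obtain ⟨B, hB, A, hA, hAS, hiff⟩ := ih (Nat.le_of_succ_le hi)
    set S := recordedAtRisk n h i with hS
    let hist : ℕ → Fin J → Finset ℕ := fun l j => if l ≤ i then (h l).1 j else ∅
    let B' : Set 𝒱 := {v | v ∈ B ∧ rule n i v hist = (h i).2 ∧ ∀ j, (h i).1 j ⊆ S}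
    let A' : ℕ → Set (ℝ × Fin J) := fun k =>
      A k ∩ {x | k ∈ S → ∀ j, k ∈ (h i).1 j ↔ outcome ζ.L i x = some j}
    refine ⟨B', ?_, A', fun k => ?_, fun k hk => ?_, fun ω => ?_⟩
    · exact hB.inter ((htest.measurable_rule n i hist (h i).2).inter (MeasurableSet.const _))
    · have hset : {x : ℝ × Fin J | k ∈ S → ∀ j, k ∈ (h i).1 j ↔ outcome ζ.L i x = some j} =
          outcome ζ.L i ⁻¹' {o | k ∈ S → ∀ j, k ∈ (h i).1 j ↔ o = some j} := rfl
      refine (hA k).inter ?_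
      rw [hset]
      exact measurableSet_outcome_preimage _
    · simp only [recordedAtRisk, Finset.mem_sdiff, Finset.mem_biUnion, Finset.mem_univ, true_and,
        not_exists] at hk
      have hkS : k ∈ S := hk.1.1
      ext x
      simp only [A', hAS k hkS, Set.mem_inter_iff, Set.mem_ofPred_eq, hkS, hk.1.2, true_imp_iff,
        false_iff, aliveAt]
      have hlt := ζ.L_lt i hi
      rw [← Option.eq_none_iff_forall_ne_some, outcome_eq_none_iff]
      refine and_iff_right_of_imp fun hx => ?_
      cases i with
      | zero => exact Set.mem_univ x
      | succ i => exact hlt.trans hx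
    · rw [Nat.forall_lt_succ_right]
      have hstep : (∀ l < i, stageRecord ζ.L (fun k => T k ω) (fun k => C k ω) (W n ω) n l = h l) →
          (stageRecord ζ.L (fun k => T k ω) (fun k => C k ω) (W n ω) n i = h i ↔
            (rule n i (V ω) hist = (h i).2 ∧ ∀ j, (h i).1 j ⊆ S) ∧ ∀ k ∈ Finset.range n,
              k ∈ S → ∀ j, k ∈ (h i).1 j ↔ outcome ζ.L i (T k ω, C k ω) = some j) := by
        intro hpast
        have hR := atRisk_eq_recordedAtRisk hpast
        have hfail : failures ζ.L (fun k => T k ω) (fun k => C k ω) (W n ω) n i = (h i).1 ↔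
            (∀ j, (h i).1 j ⊆ S) ∧ ∀ k ∈ Finset.range n,
              k ∈ S → ∀ j, k ∈ (h i).1 j ↔ outcome ζ.L i (T k ω, C k ω) = some j := by
          simp only [funext_iff, failures_eq_filter_outcome, hR, ← hS]
          constructor
          · intro hf
            refine ⟨fun j => by rw [← hf j]; exact Finset.filter_subset _ _, fun k _ hk j => ?_⟩
            rw [← hf j, Finset.mem_filter]
            exact and_iff_right hk
          · rintro ⟨hsub, hf⟩ j
            ext k
            rw [Finset.mem_filter]
            constructor
            · rintro ⟨hk, ho⟩
              exact (hf k (recordedAtRisk_subset_range h i hk) hk j).2 ho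
            · intro hk
              have hkS := hsub j hk
              exact ⟨hkS, (hf k (recordedAtRisk_subset_range h i hkS) hkS j).1 hk⟩
        have hW : failures ζ.L (fun k => T k ω) (fun k => C k ω) (W n ω) n i = (h i).1 →
            W n ω i = rule n i (V ω) hist := by
          intro hf
          rw [htest.withdrawn_eq n i hi ω]
          congr 1
          funext l j
          simp only [history, hist]
          split_ifs with hl
          · rcases hl.lt_or_eq with hl | rfl
            · exact congrFun (congrArg Prod.fst (hpast l hl)) j
            · exact congrFun hf j
          · rfl
        rw [stageRecord, Prod.ext_iff]
        constructor
        · rintro ⟨h1, h2⟩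
          obtain ⟨h3, h4⟩ := hfail.1 h1
          exact ⟨⟨(hW h1).symm.trans h2, h3⟩, h4⟩
        · rintro ⟨⟨h1, h2⟩, h3⟩
          have h4 := hfail.2 ⟨h2, h3⟩
          exact ⟨h4, (hW h4).trans h1⟩
      rw [and_congr_right hstep, hiff ω]
      simp only [B', A', Set.mem_ofPred_eq, Set.mem_inter_iff, imp_and, forall_and]
      tauto

end CompetingRisksModel.IsLifeTest

end

noncomputable section

/-! ### Cell probabilities -/

namespace CompetingRisksModel

variable {J s M : ℕ} (m : CompetingRisksModel J s) (ζ : PICScheme M)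

/-- The conditional probability of the outcome `o` in the `i`-th interval, for a unit that is alive
at its start. -/
def cellProb (i : ℕ) : Option (Fin J) → ParamSpace s → ℝ
  | none => fun θ => 1 - m.q ζ i θ
  | some j => m.qc ζ i j

variable {m} {θ : ParamSpace s}

lemma G_mono (hθ : θ ∈ m.Θ) (j : Fin J) {t t' : ℝ} (h : t ≤ t') : m.G j t θ ≤ m.G j t' θ :=
  setIntegral_mono_set (m.g_integrable θ hθ j).integrableOn
    (Eventually.of_forall fun x => m.g_nonneg θ hθ j x)
    (Set.Iic_subset_Iic.2 h).eventuallyLE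

lemma G_eq_zero (hθ : θ ∈ m.Θ) (j : Fin J) : m.G j 0 θ = 0 := by
  rw [G, setIntegral_congr_fun measurableSet_Iic fun t ht => m.g_eq_zero θ hθ j t ht]
  simp

lemma FT_eq_sum_G (hθ : θ ∈ m.Θ) (t : ℝ) : m.FT t θ = ∑ j, m.G j t θ :=
  integral_finsetSum _ fun j _ => (m.g_integrable θ hθ j).integrableOn

lemma FT_eq_zero (hθ : θ ∈ m.Θ) : m.FT 0 θ = 0 := by
  rw [FT_eq_sum_G hθ]
  exact Finset.sum_eq_zero fun j _ => G_eq_zero hθ j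

lemma FT_le_one (hθ : θ ∈ m.Θ) (t : ℝ) : m.FT t θ ≤ 1 := by
  rw [FT_eq_sum_G hθ, ← m.g_total θ hθ]
  exact Finset.sum_le_sum fun j _ => setIntegral_le_integral (m.g_integrable θ hθ j)
    (Eventually.of_forall fun x => m.g_nonneg θ hθ j x)

lemma sum_qc (hθ : θ ∈ m.Θ) (i : ℕ) : ∑ j, m.qc ζ i j θ = m.q ζ i θ := by
  simp only [qc, q, FT_eq_sum_G hθ]
  rw [← Finset.sum_div, Finset.sum_sub_distrib]

lemma sum_cellProb (hθ : θ ∈ m.Θ) (i : ℕ) : ∑ o, m.cellProb ζ i o θ = 1 := by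
  rw [Fintype.sum_option]
  simp only [cellProb]
  rw [sum_qc ζ hθ]
  ring

lemma cellProb_nonneg (hθ : θ ∈ m.Θ) {i : ℕ} (hi : i < M) (o : Option (Fin J)) :
    0 ≤ m.cellProb ζ i o θ := by
  have hL := (ζ.L_lt i hi).le
  have h1 : 0 ≤ 1 - m.FT (ζ.L i) θ := sub_nonneg.2 (FT_le_one hθ _)
  cases o with
  | none =>
    refine sub_nonneg.2 (div_le_one_of_le₀ ?_ h1)
    linarith [FT_le_one hθ (ζ.L (i + 1))]
  | some j => exact div_nonneg (sub_nonneg.2 (G_mono hθ j hL)) h1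

lemma cellProb_le_one (hθ : θ ∈ m.Θ) {i : ℕ} (hi : i < M) (o : Option (Fin J)) :
    m.cellProb ζ i o θ ≤ 1 := by
  rw [← sum_cellProb ζ hθ i]
  exact Finset.single_le_sum (f := fun o => m.cellProb ζ i o θ)
    (fun o _ => cellProb_nonneg ζ hθ hi o) (Finset.mem_univ o)

variable {ζ} {Θ₀ : Set (ParamSpace s)} {θ₀ : ParamSpace s}

lemma Regular.mem_Θ (hreg : m.Regular ζ Θ₀ θ₀) : θ₀ ∈ m.Θ := hreg.subset hreg.mem

lemma Regular.cellProb_pos (hreg : m.Regular ζ Θ₀ θ₀) {i : ℕ} (hi : i < M)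
    (o : Option (Fin J)) : 0 < m.cellProb ζ i o θ₀ := by
  cases o with
  | none => exact sub_pos.2 (hreg.q_mem i hi).2
  | some j => exact (hreg.qc_mem i hi j).1

/-- Units live beyond `L i` with positive probability, as those alive at `L (i - 1)` do so with
probability `1 - q (i - 1) > 0`. -/
lemma Regular.FT_lt_one (hreg : m.Regular ζ Θ₀ θ₀) {i : ℕ} (hi : i ≤ M) :
    m.FT (ζ.L i) θ₀ < 1 := by
  induction i with
  | zero =>
    rw [ζ.L_zero, FT_eq_zero hreg.mem_Θ]
    exact one_pos
  | succ i ih =>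
    have h1 := ih (Nat.le_of_succ_le hi)
    have h2 := (hreg.q_mem i hi).2
    rw [q, div_lt_one (sub_pos.2 h1)] at h2
    linarith

namespace IsLifeTest

variable {Ω 𝒱 : Type*} [MeasurableSpace Ω] [MeasurableSpace 𝒱] {P : Measure Ω}
  {T : ℕ → Ω → ℝ} {C : ℕ → Ω → Fin J} {V : Ω → 𝒱}
  {rule : ℕ → ℕ → 𝒱 → (ℕ → Fin J → Finset ℕ) → Finset ℕ} {W : ℕ → Ω → ℕ → Finset ℕ}

lemma measurable_unit (htest : m.IsLifeTest ζ P θ₀ T C V rule W) (k : ℕ) :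
    Measurable fun ω => (T k ω, C k ω) := (htest.measurable_T k).prodMk (htest.measurable_C k)

lemma measurableSet_stageRecord_eq (htest : m.IsLifeTest ζ P θ₀ T C V rule W) (n : ℕ)
    (h : ℕ → StageRecord J) {i : ℕ} (hi : i ≤ M) :
    MeasurableSet {ω | ∀ l < i,
      stageRecord ζ.L (fun k => T k ω) (fun k => C k ω) (W n ω) n l = h l} := by
  obtain ⟨B, hB, A, hA, -, hiff⟩ := htest.exists_forall_stageRecord_eq_iff n h hi
  rw [Set.ext hiff]
  refine (htest.measurable_V hB).inter ?_
  have : {ω | ∀ k ∈ Finset.range n, (T k ω, C k ω) ∈ A k} =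
      ⋂ k ∈ Finset.range n, (fun ω => (T k ω, C k ω)) ⁻¹' A k := by
    ext ω
    simp
  change MeasurableSet {ω | ∀ k ∈ Finset.range n, (T k ω, C k ω) ∈ A k}
  rw [this]
  exact Finset.measurableSet_biInter _ fun k _ => htest.measurable_unit k (hA k)

variable [IsProbabilityMeasure P]

lemma measureReal_le_eq (htest : m.IsLifeTest ζ P θ₀ T C V rule W) (hθ₀ : θ₀ ∈ m.Θ) (k : ℕ)
    (t : ℝ) : P.real {ω | T k ω ≤ t} = m.FT t θ₀ := by
  have h : {ω | T k ω ≤ t} = ⋃ j, {ω | C k ω = j ∧ T k ω ≤ t} := by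
    ext ω
    simp
  rw [h, measureReal_iUnion_fintype, FT_eq_sum_G hθ₀]
  · exact Finset.sum_congr rfl fun j _ => htest.law k j t
  · intro j j' hjj
    refine Set.disjoint_left.2 fun ω h1 h2 => hjj ?_
    exact h1.1.symm.trans h2.1
  · intro j
    exact (htest.measurable_C k (measurableSet_singleton j)).inter
      (measurableSet_le (htest.measurable_T k) measurable_const)

lemma measureReal_alive_outcome (htest : m.IsLifeTest ζ P θ₀ T C V rule W)
    (hreg : m.Regular ζ Θ₀ θ₀) (k : ℕ) {i : ℕ} (hi : i < M) (o : Option (Fin J)) :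
    P.real {ω | (T k ω, C k ω) ∈ aliveAt ζ.L i ∧ outcome ζ.L i (T k ω, C k ω) = o} =
      m.cellProb ζ i o θ₀ * (1 - m.FT (ζ.L i) θ₀) := by
  have hne : 1 - m.FT (ζ.L i) θ₀ ≠ 0 := (sub_pos.2 (hreg.FT_lt_one hi.le)).ne'
  have hL := ζ.L_lt i hi
  cases o with
  | none =>
    have h : {ω | (T k ω, C k ω) ∈ aliveAt ζ.L i ∧ outcome ζ.L i (T k ω, C k ω) = none} =
        {ω | T k ω ≤ ζ.L (i + 1)}ᶜ := by
      ext ω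
      simp only [outcome_eq_none_iff, Set.mem_ofPred_eq, Set.mem_compl_iff, not_le]
      refine and_iff_right_of_imp fun hx => ?_
      cases i with
      | zero => exact Set.mem_univ _
      | succ i => exact hL.trans hx
    rw [h, probReal_compl_eq_one_sub (measurableSet_le (htest.measurable_T k) measurable_const),
      htest.measureReal_le_eq hreg.mem_Θ]
    simp only [cellProb, q]
    field_simp
    ring
  | some j =>
    simp only [cellProb, qc]
    rw [div_mul_cancel₀ _ hne]
    cases i with
    | zero =>
      rw [ζ.L_zero, G_eq_zero hreg.mem_Θ, sub_zero, ← htest.law k]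
      congr 1
      ext ω
      simp [outcome_eq_some_iff, aliveAt, and_comm]
    | succ i =>
      have h : {ω | (T k ω, C k ω) ∈ aliveAt ζ.L (i + 1) ∧
          outcome ζ.L (i + 1) (T k ω, C k ω) = some j} =
          {ω | C k ω = j ∧ T k ω ≤ ζ.L (i + 1 + 1)} \ {ω | C k ω = j ∧ T k ω ≤ ζ.L (i + 1)} := by
        ext ω
        simp only [outcome_eq_some_iff, aliveAt, Set.mem_ofPred_eq, Set.mem_sdiff, not_and, not_le]
        tauto
      rw [h, measureReal_sdiff, htest.law, htest.law]
      · exact fun ω hω => ⟨hω.1, hω.2.trans hL.le⟩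
      · exact (htest.measurable_C k (measurableSet_singleton j)).inter
          (measurableSet_le (htest.measurable_T k) measurable_const)

lemma integral_alive_outcome (htest : m.IsLifeTest ζ P θ₀ T C V rule W)
    (hreg : m.Regular ζ Θ₀ θ₀) (k : ℕ) {i : ℕ} (hi : i < M) (f : Option (Fin J) → ℂ) :
    ∫ ω, (aliveAt ζ.L i).indicator (fun x => f (outcome ζ.L i x)) (T k ω, C k ω) ∂P =
      (∑ o, m.cellProb ζ i o θ₀ * f o) * ((1 - m.FT (ζ.L i) θ₀ : ℝ) : ℂ) := by
  classical
  have hmeas : ∀ o, MeasurableSet {ω | (T k ω, C k ω) ∈ aliveAt ζ.L i ∧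
      outcome ζ.L i (T k ω, C k ω) = o} := fun o =>
    htest.measurable_unit k (measurableSet_aliveAt.inter (measurableSet_outcome_preimage {o}))
  have h : ∀ ω, (aliveAt ζ.L i).indicator (fun x => f (outcome ζ.L i x)) (T k ω, C k ω) =
      ∑ o, {ω | (T k ω, C k ω) ∈ aliveAt ζ.L i ∧
        outcome ζ.L i (T k ω, C k ω) = o}.indicator (fun _ => f o) ω := by
    intro ω
    by_cases ha : (T k ω, C k ω) ∈ aliveAt ζ.L i
    · simp [Set.indicator_apply, ha]
    · simp [ha]
  simp_rw [h]
  rw [integral_finsetSum _ fun o _ => (integrable_const (f o)).indicator (hmeas o),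
    Finset.sum_mul]
  refine Finset.sum_congr rfl fun o _ => ?_
  rw [integral_indicator_const _ (hmeas o), htest.measureReal_alive_outcome hreg k hi o,
    Complex.real_smul]
  push_cast
  ring

/-- Given the history, the outcomes of the units at risk are independent, with the cell
probabilities. -/
lemma setIntegral_prod_outcome (htest : m.IsLifeTest ζ P θ₀ T C V rule W)
    (hreg : m.Regular ζ Θ₀ θ₀) (n : ℕ) (h : ℕ → StageRecord J) {i : ℕ} (hi : i < M)
    (f : Option (Fin J) → ℂ) :
    ∫ ω in {ω | ∀ l < i,
        stageRecord ζ.L (fun k => T k ω) (fun k => C k ω) (W n ω) n l = h l},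
      ∏ k ∈ recordedAtRisk n h i, f (outcome ζ.L i (T k ω, C k ω)) ∂P =
      (∑ o, m.cellProb ζ i o θ₀ * f o) ^ (recordedAtRisk n h i).card *
        P.real {ω | ∀ l < i,
          stageRecord ζ.L (fun k => T k ω) (fun k => C k ω) (W n ω) n l = h l} := by
  classical
  obtain ⟨B, hB, A, hA, hAS, hiff⟩ := htest.exists_forall_stageRecord_eq_iff n h hi.le
  set S := recordedAtRisk n h i with hS
  have hSn : S ⊆ Finset.range n := recordedAtRisk_subset_range h i
  have hset : {ω | ∀ l < i,
      stageRecord ζ.L (fun k => T k ω) (fun k => C k ω) (W n ω) n l = h l} =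
      {ω | V ω ∈ B ∧ ∀ k ∈ Finset.range n, (T k ω, C k ω) ∈ A k} := Set.ext hiff
  rw [hset]
  have hmeas := hset ▸ htest.measurableSet_stageRecord_eq n h hi.le
  let K := (∏ k ∈ Finset.range n \ S, ((P.real {ω | (T k ω, C k ω) ∈ A k} : ℝ) : ℂ)) *
    ((1 - m.FT (ζ.L i) θ₀ : ℝ) : ℂ) ^ S.card * (P.real {ω | V ω ∈ B} : ℝ)
  have key : ∀ f : Option (Fin J) → ℂ,
      ∫ ω in {ω | V ω ∈ B ∧ ∀ k ∈ Finset.range n, (T k ω, C k ω) ∈ A k},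
        ∏ k ∈ S, f (outcome ζ.L i (T k ω, C k ω)) ∂P =
      (∑ o, m.cellProb ζ i o θ₀ * f o) ^ S.card * K := by
    intro f
    have hfm : Measurable fun x : ℝ × Fin J => f (outcome ζ.L i x) := fun s _ =>
      measurableSet_outcome_preimage (f ⁻¹' s)
    let g : ℕ → ℝ × Fin J → ℂ := fun k =>
      (A k).indicator fun x => if k ∈ S then f (outcome ζ.L i x) else 1
    have hg : ∀ k, Measurable (g k) := fun k =>
      (Measurable.ite (.const _) hfm measurable_const).indicator (hA k)
    have hprod : ∀ ω, {ω | V ω ∈ B ∧ ∀ k ∈ Finset.range n, (T k ω, C k ω) ∈ A k}.indicator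
        (fun ω => ∏ k ∈ S, f (outcome ζ.L i (T k ω, C k ω))) ω =
        B.indicator (fun _ => (1 : ℂ)) (V ω) * ∏ k : Fin n, g k (T k ω, C k ω) := by
      intro ω
      rw [Fin.prod_univ_eq_prod_range (fun k => g k (T k ω, C k ω)) n]
      by_cases hV : V ω ∈ B
      · by_cases hall : ∀ k ∈ Finset.range n, (T k ω, C k ω) ∈ A k
        · have hmem : ω ∈ {ω | V ω ∈ B ∧ ∀ k ∈ Finset.range n, (T k ω, C k ω) ∈ A k} := ⟨hV, hall⟩
          rw [Set.indicator_of_mem hmem, Set.indicator_of_mem hV, one_mul, ← Finset.prod_subset hSn]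
          · refine Finset.prod_congr rfl fun k hk => ?_
            simp only [g]
            rw [Set.indicator_of_mem (hall k (hSn hk)), if_pos hk]
          · intro k hk hkS
            simp only [g]
            rw [Set.indicator_of_mem (hall k hk), if_neg hkS]
        · rw [Set.indicator_of_notMem (fun h => hall h.2)]
          push Not at hall
          obtain ⟨k, hk, hkA⟩ := hall
          rw [Finset.prod_eq_zero hk (Set.indicator_of_notMem hkA _), mul_zero]
      · rw [Set.indicator_of_notMem (fun h => hV h.1), Set.indicator_of_notMem hV, zero_mul]
    have hindep : iIndepFun (fun (k : Fin n) ω => (T k ω, C k ω)) P :=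
      htest.indep.precomp Fin.val_injective
    have hgm : Measurable fun x : ℕ → ℝ × Fin J => ∏ k : Fin n, g k (x k) :=
      Finset.measurable_fun_prod Finset.univ fun k _ => (hg k).comp (measurable_pi_apply (k : ℕ))
    rw [← integral_indicator hmeas, integral_congr_ae (Eventually.of_forall hprod)]
    have hI := htest.indep_V.integral_fun_comp_mul_comp (𝕜 := ℂ)
      (f := B.indicator fun _ => (1 : ℂ)) (g := fun x => ∏ k : Fin n, g k (x k))
      htest.measurable_V.aemeasurable
      (measurable_pi_lambda _ fun k => htest.measurable_unit k).aemeasurable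
      (measurable_const.indicator hB).aestronglyMeasurable
      hgm.aestronglyMeasurable
    have hI' := hindep.integral_fun_prod_comp (𝕜 := ℂ) (f := fun (k : Fin n) => g k)
      (fun k => (htest.measurable_unit k).aemeasurable) fun k => (hg k).aestronglyMeasurable
    rw [hI, hI',
      Fin.prod_univ_eq_prod_range (fun k => ∫ ω, g k (T k ω, C k ω) ∂P) n,
      ← Finset.prod_sdiff hSn]
    have h1 : ∫ ω, B.indicator (fun _ => (1 : ℂ)) (V ω) ∂P = (P.real {ω | V ω ∈ B} : ℝ) := by
      have : (fun ω => B.indicator (fun _ => (1 : ℂ)) (V ω)) =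
          (V ⁻¹' B).indicator fun _ => (1 : ℂ) := rfl
      rw [this, integral_indicator_const _ (htest.measurable_V hB)]
      simp
      rfl
    have h2 : ∀ k ∈ Finset.range n \ S, ∫ ω, g k (T k ω, C k ω) ∂P =
        ((P.real {ω | (T k ω, C k ω) ∈ A k} : ℝ) : ℂ) := by
      intro k hk
      have : (fun ω => g k (T k ω, C k ω)) =
          ((fun ω => (T k ω, C k ω)) ⁻¹' A k).indicator fun _ => (1 : ℂ) := by
        funext ω
        simp only [g, if_neg (Finset.mem_sdiff.1 hk).2]
        rfl
      rw [this, integral_indicator_const _ (htest.measurable_unit k (hA k))]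
      simp
      rfl
    have h3 : ∀ k ∈ S, ∫ ω, g k (T k ω, C k ω) ∂P =
        (∑ o, m.cellProb ζ i o θ₀ * f o) * ((1 - m.FT (ζ.L i) θ₀ : ℝ) : ℂ) := by
      intro k hk
      rw [← htest.integral_alive_outcome hreg k hi f]
      simp only [g, hAS k hk, if_pos hk]
    rw [h1, Finset.prod_congr rfl h2, Finset.prod_congr rfl h3, Finset.prod_const, mul_pow]
    simp only [K]
    ring
  have h1 := key fun _ => 1
  have hsum : (∑ o, (m.cellProb ζ i o θ₀ : ℂ)) = 1 := by
    rw [← Complex.ofReal_sum, sum_cellProb ζ hreg.mem_Θ, Complex.ofReal_one]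
  simp only [Finset.prod_const_one, mul_one, hsum, one_pow, one_mul] at h1
  rw [key f, ← h1]
  simp

end IsLifeTest

end CompetingRisksModel

end

noncomputable section

/-! ### Characteristic functions of the outcome counts -/

section Counting

variable {J : ℕ} {L t : ℕ → ℝ} {c : ℕ → Fin J} {W : ℕ → Finset ℕ} {n i : ℕ}

lemma prod_pow_outcomeCount (f : Option (Fin J) → ℂ) :
    ∏ o, f o ^ outcomeCount L t c W n i o = ∏ k ∈ atRisk L t W n i, f (outcome L i (t k, c k)) := by
  rw [← Finset.prod_fiberwise' (atRisk L t W n i) (fun k => outcome L i (t k, c k)) f]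
  simp [outcomeCount]

lemma card_atRisk_le : (atRisk L t W n i).card ≤ n := by
  have h : atRisk L t W n i ⊆ Finset.range n := by
    induction i with
    | zero => exact subset_rfl
    | succ i ih => exact Finset.sdiff_subset.trans ((Finset.filter_subset _ _).trans ih)
  simpa using Finset.card_le_card h

lemma outcomeCount_eq_of_stageRecord_eq {t' : ℕ → ℝ} {c' : ℕ → Fin J} {W' : ℕ → Finset ℕ}
    (h : ∀ l < i + 1, stageRecord L t c W n l = stageRecord L t' c' W' n l) :
    outcomeCount L t c W n i = outcomeCount L t' c' W' n i := by
  have hR : atRisk L t W n i = atRisk L t' W' n i := by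
    rw [atRisk_eq_recordedAtRisk (c := c) (h := stageRecord L t c W n) fun _ _ => rfl,
      atRisk_eq_recordedAtRisk (c := c') (h := stageRecord L t c W n)
        fun l hl => (h l (hl.trans i.lt_succ_self)).symm]
  have hf : failures L t c W n i = failures L t' c' W' n i := congrArg Prod.fst (h i i.lt_succ_self)
  funext o
  cases o with
  | none => rw [outcomeCount_none, outcomeCount_none, survivors_eq (c := c), survivors_eq (c := c'),
      hR, hf]
  | some j => rw [outcomeCount_some, outcomeCount_some, hf]

end Counting

namespace CompetingRisksModel

variable {J s M : ℕ} {m : CompetingRisksModel J s} {ζ : PICScheme M} {Θ₀ : Set (ParamSpace s)}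
  {θ₀ : ParamSpace s} {Ω 𝒱 : Type*}
  {T : ℕ → Ω → ℝ} {C : ℕ → Ω → Fin J} {V : Ω → 𝒱}
  {rule : ℕ → ℕ → 𝒱 → (ℕ → Fin J → Finset ℕ) → Finset ℕ} {W : ℕ → Ω → ℕ → Finset ℕ}

/-- The record of the `l`-th interval in the test of size `n`, as a random object. -/
def record (ζ : PICScheme M) (T : ℕ → Ω → ℝ) (C : ℕ → Ω → Fin J) (W : ℕ → Ω → ℕ → Finset ℕ)
    (n : ℕ) (ω : Ω) (l : ℕ) : StageRecord J :=
  stageRecord ζ.L (fun k => T k ω) (fun k => C k ω) (W n ω) n l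

/-- The number of units at risk at the start of the `i`-th interval in the test of size `n`. -/
def numAtRisk (ζ : PICScheme M) (T : ℕ → Ω → ℝ) (W : ℕ → Ω → ℕ → Finset ℕ)
    (n i : ℕ) (ω : Ω) : ℕ :=
  (atRisk ζ.L (fun k => T k ω) (W n ω) n i).card

/-- The number of units that meet the outcome `o` in the `i`-th interval in the test of size `n`. -/
def numOutcome (ζ : PICScheme M) (T : ℕ → Ω → ℝ) (C : ℕ → Ω → Fin J) (W : ℕ → Ω → ℕ → Finset ℕ)
    (n i : ℕ) (o : Option (Fin J)) (ω : Ω) : ℕ :=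
  outcomeCount ζ.L (fun k => T k ω) (fun k => C k ω) (W n ω) n i o

/-- `F` is a function of the records of the intervals before the `i`-th, in the test of size `n`. -/
def DependsOnRecord {β : Type*} (ζ : PICScheme M) (T : ℕ → Ω → ℝ) (C : ℕ → Ω → Fin J)
    (W : ℕ → Ω → ℕ → Finset ℕ) (n i : ℕ) (F : Ω → β) : Prop :=
  ∀ ω ω', (∀ l < i, record ζ T C W n ω l = record ζ T C W n ω' l) → F ω = F ω'

lemma dependsOnRecord_numAtRisk (n i : ℕ) :
    DependsOnRecord ζ T C W n i (numAtRisk ζ T W n i) := by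
  intro ω ω' h
  rw [numAtRisk, numAtRisk, atRisk_eq_recordedAtRisk (c := fun k => C k ω) h,
    atRisk_eq_recordedAtRisk (c := fun k => C k ω') fun _ _ => rfl]
  rfl

lemma dependsOnRecord_numOutcome {n i l : ℕ} (hl : l < i) (o : Option (Fin J)) :
    DependsOnRecord ζ T C W n i (numOutcome ζ T C W n l o) := by
  intro ω ω' h
  exact congrFun (outcomeCount_eq_of_stageRecord_eq fun l' hl' => h l' (hl'.trans_le hl)) o

variable [MeasurableSpace Ω] [MeasurableSpace 𝒱] {P : Measure Ω}

namespace IsLifeTest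

/-- There are only countably many possible records, and each of them is a measurable event. -/
lemma measurable_of_dependsOnRecord (htest : m.IsLifeTest ζ P θ₀ T C V rule W) {β : Type*}
    [MeasurableSpace β] {n i : ℕ} (hi : i ≤ M) {F : Ω → β} (hF : DependsOnRecord ζ T C W n i F) :
    Measurable F := by
  intro S _
  let R : Ω → Fin i → StageRecord J := fun ω l => record ζ T C W n ω l
  have h : F ⁻¹' S = ⋃ h ∈ R '' (F ⁻¹' S), R ⁻¹' {h} := by
    ext ω
    simp only [Set.mem_preimage, Set.mem_iUnion, Set.mem_singleton_iff, exists_prop,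
      exists_eq_right', Set.mem_image]
    refine ⟨fun hω => ⟨ω, hω, rfl⟩, ?_⟩
    rintro ⟨ω', hω', he⟩
    rwa [hF ω ω' fun l hl => (congrFun he ⟨l, hl⟩).symm]
  rw [h]
  refine MeasurableSet.biUnion (Set.to_countable _) ?_
  rintro _ ⟨ω', -, rfl⟩
  convert htest.measurableSet_stageRecord_eq n (record ζ T C W n ω') hi using 1
  ext ω
  simp only [Set.mem_preimage, Set.mem_singleton_iff, Set.mem_ofPred_eq, R, funext_iff]
  exact ⟨fun h l hl => h ⟨l, hl⟩, fun h l => h l l.2⟩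

variable [IsProbabilityMeasure P]

/-- Conditionally on the records of the earlier intervals, the outcome counts in the `i`-th interval
are multinomial: here is their generating function, integrated against a function of those
records. -/
lemma integral_mul_prod_pow_numOutcome (htest : m.IsLifeTest ζ P θ₀ T C V rule W)
    (hreg : m.Regular ζ Θ₀ θ₀) {n i : ℕ} (hi : i < M) {f : Option (Fin J) → ℂ}
    (hf : ∀ o, ‖f o‖ ≤ 1) {z : Ω → ℂ} (hz : DependsOnRecord ζ T C W n i z) (hz1 : ∀ ω, ‖z ω‖ ≤ 1) :
    ∫ ω, z ω * ∏ o, f o ^ numOutcome ζ T C W n i o ω ∂P =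
      ∫ ω, z ω * (∑ o, m.cellProb ζ i o θ₀ * f o) ^ numAtRisk ζ T W n i ω ∂P := by
  set φ : ℂ := ∑ o, m.cellProb ζ i o θ₀ * f o with hφ
  have hφ1 : ‖φ‖ ≤ 1 := by
    rw [← sum_cellProb ζ hreg.mem_Θ i]
    refine (norm_sum_le _ _).trans (Finset.sum_le_sum fun o _ => ?_)
    rw [norm_mul, Complex.norm_real, Real.norm_of_nonneg (cellProb_nonneg ζ hreg.mem_Θ hi o)]
    exact mul_le_of_le_one_right (cellProb_nonneg ζ hreg.mem_Θ hi o) (hf o)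
  have hzm : Measurable z := htest.measurable_of_dependsOnRecord hi.le hz
  have hY1 : ∀ ω, ‖∏ o, f o ^ numOutcome ζ T C W n i o ω‖ ≤ 1 := fun ω => by
    rw [norm_prod]
    exact Finset.prod_le_one (fun _ _ => norm_nonneg _) fun o _ => by
      rw [norm_pow]
      exact pow_le_one₀ (norm_nonneg _) (hf o)
  have hYm : Measurable fun ω => ∏ o, f o ^ numOutcome ζ T C W n i o ω :=
    htest.measurable_of_dependsOnRecord (i := i + 1) (n := n) hi fun ω ω' h => by
      simp only [dependsOnRecord_numOutcome i.lt_succ_self _ ω ω' h]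
  have hNm : Measurable fun ω => φ ^ numAtRisk ζ T W n i ω :=
    htest.measurable_of_dependsOnRecord (n := n) hi.le fun ω ω' h => by
      simp only [dependsOnRecord_numAtRisk n i ω ω' h]
  have hI1 : Integrable (fun ω => z ω * ∏ o, f o ^ numOutcome ζ T C W n i o ω) P :=
    Integrable.of_bound (hzm.mul hYm).aestronglyMeasurable 1 (Eventually.of_forall fun ω => by
      rw [norm_mul]
      exact mul_le_one₀ (hz1 ω) (norm_nonneg _) (hY1 ω))
  have hI2 : Integrable (fun ω => z ω * φ ^ numAtRisk ζ T W n i ω) P :=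
    Integrable.of_bound (hzm.mul hNm).aestronglyMeasurable 1 (Eventually.of_forall fun ω => by
      rw [norm_mul, norm_pow]
      exact mul_le_one₀ (hz1 ω) (by positivity) (pow_le_one₀ (norm_nonneg _) hφ1))
  let R : Ω → Fin i → StageRecord J := fun ω l => record ζ T C W n ω l
  have hRm : ∀ ω', R ⁻¹' {R ω'} = {ω | ∀ l < i, stageRecord ζ.L (fun k => T k ω) (fun k => C k ω)
      (W n ω) n l = record ζ T C W n ω' l} := by
    intro ω'
    ext ω
    simp only [Set.mem_preimage, Set.mem_singleton_iff, Set.mem_ofPred_eq, R, funext_iff]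
    exact ⟨fun h l hl => h ⟨l, hl⟩, fun h l => h l l.2⟩
  have hmeas : ∀ h, MeasurableSet (R ⁻¹' {h}) := by
    intro h
    by_cases hh : ∃ ω', R ω' = h
    · obtain ⟨ω', rfl⟩ := hh
      rw [hRm]
      exact htest.measurableSet_stageRecord_eq n _ hi.le
    · have : R ⁻¹' {h} = ∅ := Set.eq_empty_of_forall_notMem fun ω hω => hh ⟨ω, hω⟩
      rw [this]
      exact .empty
  have hdisj : Pairwise (Function.onFun Disjoint fun h => R ⁻¹' {h}) := fun h h' hne =>
    Set.disjoint_left.2 fun ω h1 h2 => hne (h1.symm.trans h2)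
  have huniv : ⋃ h, R ⁻¹' {h} = Set.univ := by
    ext ω
    simp
  rw [← setIntegral_univ, ← setIntegral_univ (f := fun ω => z ω * φ ^ _), ← huniv,
    integral_iUnion hmeas hdisj hI1.integrableOn, integral_iUnion hmeas hdisj hI2.integrableOn]
  congr 1
  funext h
  by_cases hh : ∃ ω', R ω' = h
  · obtain ⟨ω', rfl⟩ := hh
    have hm := hmeas (R ω')
    have hrec : ∀ ω ∈ R ⁻¹' {R ω'}, ∀ l < i, record ζ T C W n ω l = record ζ T C W n ω' l :=
      fun ω hω l hl => congrFun hω ⟨l, hl⟩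
    have hAt : ∀ ω ∈ R ⁻¹' {R ω'}, atRisk ζ.L (fun k => T k ω) (W n ω) n i =
        recordedAtRisk n (record ζ T C W n ω') i := fun ω hω =>
      atRisk_eq_recordedAtRisk (c := fun k => C k ω) (hrec ω hω)
    have h1 : ∫ ω in R ⁻¹' {R ω'}, z ω * ∏ o, f o ^ numOutcome ζ T C W n i o ω ∂P =
        ∫ ω in R ⁻¹' {R ω'}, z ω' * ∏ k ∈ recordedAtRisk n (record ζ T C W n ω') i,
          f (outcome ζ.L i (T k ω, C k ω)) ∂P := by
      refine setIntegral_congr_fun hm fun ω hω => ?_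
      simp only [numOutcome]
      rw [hz ω ω' (hrec ω hω), prod_pow_outcomeCount, hAt ω hω]
    have h2 : ∫ ω in R ⁻¹' {R ω'}, z ω * φ ^ numAtRisk ζ T W n i ω ∂P =
        ∫ _ in R ⁻¹' {R ω'},
          z ω' * φ ^ (recordedAtRisk n (record ζ T C W n ω') i).card ∂P := by
      refine setIntegral_congr_fun hm fun ω hω => ?_
      rw [hz ω ω' (hrec ω hω), numAtRisk, hAt ω hω]
    rw [h1, h2, integral_const_mul, hRm, htest.setIntegral_prod_outcome hreg n _ hi,
      setIntegral_const, Complex.real_smul, ← hφ]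
    ring
  · have : R ⁻¹' {h} = ∅ := Set.eq_empty_of_forall_notMem fun ω hω => hh ⟨ω, hω⟩
    simp [this]

end IsLifeTest

end CompetingRisksModel

end

noncomputable section

/-! ### Limits of powers of characteristic functions -/

lemma norm_pow_sub_one_le {u : ℂ} (hu : ‖u‖ ≤ 1) (k : ℕ) : ‖u ^ k - 1‖ ≤ k * ‖u - 1‖ := by
  induction k with
  | zero => simp
  | succ k ih =>
    have h : u ^ (k + 1) - 1 = u ^ k * (u - 1) + (u ^ k - 1) := by ring
    rw [h]
    refine (norm_add_le _ _).trans ?_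
    rw [norm_mul, norm_pow]
    have := mul_le_of_le_one_left (norm_nonneg (u - 1)) (pow_le_one₀ (norm_nonneg u) hu (n := k))
    push_cast
    linarith

lemma prod_exp_pow {ι : Type*} [Fintype ι] (x : ι → ℝ) (k : ι → ℕ) :
    ∏ o, Complex.exp (x o * Complex.I) ^ k o =
      Complex.exp ((∑ o, x o * k o : ℝ) * Complex.I) := by
  simp_rw [← Complex.exp_nat_mul]
  rw [← Complex.exp_sum]
  push_cast
  rw [Finset.sum_mul]
  congr 1
  exact Finset.sum_congr rfl fun o _ => by ring

lemma tendsto_mul_exp_sub_one_sub (x : ℝ) :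
    Tendsto (fun n : ℕ => (n : ℂ) * (Complex.exp ((x / √n : ℝ) * Complex.I) - 1 -
      (x / √n : ℝ) * Complex.I)) atTop (𝓝 (-(x ^ 2 / 2 : ℝ))) := by
  rw [tendsto_iff_norm_sub_tendsto_zero]
  have hsq : Tendsto (fun n : ℕ => √(n : ℝ)) atTop atTop :=
    Real.tendsto_sqrt_atTop.comp tendsto_natCast_atTop_atTop
  have h1 : Tendsto (fun n : ℕ => |x| / √(n : ℝ)) atTop (𝓝 0) := tendsto_const_nhds.div_atTop hsq
  have h2 : Tendsto (fun n : ℕ => |x| ^ 2 * (|x| / √(n : ℝ))) atTop (𝓝 0) := by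
    have := h1.const_mul (|x| ^ 2)
    rwa [mul_zero] at this
  refine tendsto_of_tendsto_of_tendsto_of_le_of_le' tendsto_const_nhds h2
    (Eventually.of_forall fun _ => norm_nonneg _) ?_
  filter_upwards [h1.eventually_le_const one_pos, eventually_gt_atTop 0] with n hn hn0
  have hn' : (0 : ℝ) < n := by exact_mod_cast hn0
  set z : ℂ := (x / √n : ℝ) * Complex.I with hz
  have hznorm : ‖z‖ = |x| / √(n : ℝ) := by
    rw [hz, norm_mul, Complex.norm_I, mul_one, Complex.norm_real, Real.norm_eq_abs, abs_div,
      abs_of_nonneg (Real.sqrt_nonneg _)]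
  have hz2 : (n : ℂ) * z ^ 2 = -(x ^ 2 : ℝ) := by
    have hnc : (n : ℂ) ≠ 0 := by exact_mod_cast hn0.ne'
    rw [hz, mul_pow, Complex.I_sq, ← Complex.ofReal_pow, div_pow, Real.sq_sqrt hn'.le]
    push_cast
    field_simp
  have hb := Complex.exp_bound (x := z) (by rw [hznorm]; exact hn) (n := 3) (by norm_num)
  simp only [Finset.sum_range_succ, Finset.sum_range_zero, Nat.factorial] at hb
  norm_num at hb
  have heq : (n : ℂ) * (Complex.exp z - 1 - z) - -(x ^ 2 / 2 : ℝ) =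
      n * (Complex.exp z - (1 + z + z ^ 2 / 2)) := by
    push_cast at hz2 ⊢
    linear_combination (1 / 2 : ℂ) * hz2
  rw [heq, norm_mul, Complex.norm_natCast]
  calc (n : ℝ) * ‖Complex.exp z - (1 + z + z ^ 2 / 2)‖ ≤ n * ‖z‖ ^ 3 := by
        refine mul_le_mul_of_nonneg_left (hb.trans ?_) hn'.le
        nlinarith [pow_nonneg (norm_nonneg z) 3]
    _ = |x| ^ 2 * (|x| / √(n : ℝ)) := by
        rw [hznorm, div_pow]
        have h3 : √(n : ℝ) ^ 3 = n * √(n : ℝ) := by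
          rw [pow_succ, Real.sq_sqrt hn'.le]
        rw [h3]
        field_simp

/-- The characteristic function of a centred law on finitely many points, at scale `1 / √n`. -/
lemma tendsto_mul_sum_exp_sub_one {ι : Type*} [Fintype ι] {p x : ι → ℝ} (hp : ∑ o, p o = 1)
    (hx : ∑ o, p o * x o = 0) :
    Tendsto (fun n : ℕ => (n : ℂ) * (∑ o, p o * Complex.exp ((x o / √n : ℝ) * Complex.I) - 1))
      atTop (𝓝 (-(∑ o, p o * x o ^ 2 / 2 : ℝ))) := by
  have h : Tendsto (fun n : ℕ => ∑ o, (p o : ℂ) * ((n : ℂ) *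
      (Complex.exp ((x o / √n : ℝ) * Complex.I) - 1 - (x o / √n : ℝ) * Complex.I))) atTop
      (𝓝 (∑ o, (p o : ℂ) * (-(x o ^ 2 / 2 : ℝ)))) :=
    tendsto_finsetSum _ fun o _ => (tendsto_mul_exp_sub_one_sub (x o)).const_mul _
  have hlim : (∑ o, (p o : ℂ) * (-(x o ^ 2 / 2 : ℝ))) = (-(∑ o, p o * x o ^ 2 / 2 : ℝ)) := by
    push_cast
    rw [← Finset.sum_neg_distrib]
    exact Finset.sum_congr rfl fun o _ => by ring
  rw [← hlim]
  refine h.congr fun n => ?_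
  have h1 : (∑ o, (p o : ℂ)) = 1 := by exact_mod_cast hp
  have h2 : (∑ o, (p o : ℂ) * ((x o / √n : ℝ) * Complex.I)) = 0 := by
    have : (∑ o, (p o : ℂ) * ((x o / √n : ℝ) * Complex.I)) =
        ((∑ o, p o * x o : ℝ) : ℂ) * (Complex.I / (√n : ℝ)) := by
      push_cast
      rw [Finset.sum_mul]
      exact Finset.sum_congr rfl fun o _ => by ring
    rw [this, hx]
    simp
  calc _ = (n : ℂ) * (∑ o, p o * Complex.exp ((x o / √n : ℝ) * Complex.I) - (∑ o, (p o : ℂ)) -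
        ∑ o, (p o : ℂ) * ((x o / √n : ℝ) * Complex.I)) := by
        rw [← Finset.sum_sub_distrib, ← Finset.sum_sub_distrib, Finset.mul_sum]
        exact Finset.sum_congr rfl fun o _ => by ring
    _ = _ := by rw [h1, h2, sub_zero]

lemma tendsto_pow_of_mul_sub_one {α : Type*} {l : Filter α} {u : α → ℂ} {n k : α → ℕ} {b : ℝ}
    {c : ℂ} (hn : Tendsto n l atTop) (hu : Tendsto (fun x => (n x : ℂ) * (u x - 1)) l (𝓝 c))
    (hk : Tendsto (fun x => (k x : ℝ) / n x) l (𝓝 b)) :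
    Tendsto (fun x => u x ^ k x) l (𝓝 (Complex.exp (b * c))) := by
  have hninv : Tendsto (fun x => ((n x : ℝ))⁻¹) l (𝓝 0) :=
    tendsto_inv_atTop_zero.comp (tendsto_natCast_atTop_atTop.comp hn)
  have hn0 : ∀ᶠ x in l, n x ≠ 0 := (hn.eventually_gt_atTop 0).mono fun x hx => hx.ne'
  -- The increment `u - 1` is of the order `1 / n`, so its square is negligible.
  have hu0 : Tendsto (fun x => ‖u x - 1‖) l (𝓝 0) := by
    have := hninv.mul hu.norm
    rw [zero_mul] at this
    refine this.congr' ?_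
    filter_upwards [hn0] with x hx
    rw [norm_mul, Complex.norm_natCast, inv_mul_cancel_left₀ (by exact_mod_cast hx)]
  have hlog : Tendsto (fun x => (n x : ℂ) * Complex.log (u x)) l (𝓝 c) := by
    have hd : Tendsto (fun x => (n x : ℂ) * (Complex.log (u x) - (u x - 1))) l (𝓝 0) := by
      rw [tendsto_zero_iff_norm_tendsto_zero]
      have := hu.norm.mul hu0
      rw [mul_zero] at this
      refine tendsto_of_tendsto_of_tendsto_of_le_of_le' tendsto_const_nhds this
        (Eventually.of_forall fun _ => norm_nonneg _) ?_
      filter_upwards [hu0.eventually_le_const (show (0 : ℝ) < 1 / 2 by norm_num)] with x hx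
      have hb := Complex.norm_log_one_add_sub_self_le (z := u x - 1) (by linarith)
      rw [add_sub_cancel] at hb
      rw [norm_mul, norm_mul, mul_assoc]
      refine mul_le_mul_of_nonneg_left (hb.trans ?_) (norm_nonneg _)
      have : (1 - ‖u x - 1‖)⁻¹ ≤ 2 := by
        rw [inv_le_comm₀ (by linarith) two_pos]
        linarith
      nlinarith [sq_nonneg ‖u x - 1‖]
    have := hd.add hu
    rw [zero_add] at this
    exact this.congr fun x => by ring
  have hk' : Tendsto (fun x => (((k x : ℝ) / n x : ℝ) : ℂ)) l (𝓝 b) :=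
    (Complex.continuous_ofReal.tendsto b).comp hk
  refine ((Complex.continuous_exp.tendsto _).comp (hk'.mul hlog)).congr' ?_
  filter_upwards [hn0, hu0.eventually_lt_const (show (0 : ℝ) < 1 by norm_num)] with x hx hx1
  have hux : u x ≠ 0 := by
    rintro h
    rw [h] at hx1
    norm_num at hx1
  have hx' : (n x : ℂ) ≠ 0 := by exact_mod_cast hx
  rw [Function.comp_apply]
  conv_rhs => rw [← Complex.exp_log hux, ← Complex.exp_nat_mul]
  congr 1
  push_cast
  field_simp

end

noncomputable section

/-! ### Limit theorems for the outcome counts -/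

namespace CompetingRisksModel

variable {J s M : ℕ} {m : CompetingRisksModel J s} {ζ : PICScheme M} {Θ₀ : Set (ParamSpace s)}
  {θ₀ : ParamSpace s} {Ω 𝒱 : Type*}
  {T : ℕ → Ω → ℝ} {C : ℕ → Ω → Fin J} {V : Ω → 𝒱}
  {rule : ℕ → ℕ → 𝒱 → (ℕ → Fin J → Finset ℕ) → Finset ℕ} {W : ℕ → Ω → ℕ → Finset ℕ}

lemma numAtRisk_le (n i : ℕ) (ω : Ω) : numAtRisk ζ T W n i ω ≤ n := card_atRisk_le

lemma sum_numOutcome (n i : ℕ) (ω : Ω) :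
    ∑ o, numOutcome ζ T C W n i o ω = numAtRisk ζ T W n i ω := sum_outcomeCount

lemma numOutcome_le_numAtRisk (n i : ℕ) (o : Option (Fin J)) (ω : Ω) :
    numOutcome ζ T C W n i o ω ≤ numAtRisk ζ T W n i ω := by
  rw [← sum_numOutcome (C := C)]
  exact Finset.single_le_sum (f := fun o => numOutcome ζ T C W n i o ω) (fun _ _ => Nat.zero_le _)
    (Finset.mem_univ o)

variable [MeasurableSpace Ω] [MeasurableSpace 𝒱] {P : Measure Ω}

namespace IsLifeTest

lemma measurable_numAtRisk (htest : m.IsLifeTest ζ P θ₀ T C V rule W) (n : ℕ) {i : ℕ}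
    (hi : i ≤ M) : Measurable (numAtRisk ζ T W n i) :=
  htest.measurable_of_dependsOnRecord hi (dependsOnRecord_numAtRisk n i)

lemma measurable_numOutcome (htest : m.IsLifeTest ζ P θ₀ T C V rule W) (n : ℕ) {i : ℕ}
    (hi : i < M) (o : Option (Fin J)) : Measurable (numOutcome ζ T C W n i o) :=
  htest.measurable_of_dependsOnRecord (n := n) hi (dependsOnRecord_numOutcome i.lt_succ_self o)

variable [IsProbabilityMeasure P]

lemma norm_sum_cellProb_mul_le_one (hreg : m.Regular ζ Θ₀ θ₀) {i : ℕ} (hi : i < M)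
    {f : Option (Fin J) → ℂ} (hf : ∀ o, ‖f o‖ ≤ 1) : ‖∑ o, m.cellProb ζ i o θ₀ * f o‖ ≤ 1 := by
  rw [← sum_cellProb ζ hreg.mem_Θ i]
  refine (norm_sum_le _ _).trans (Finset.sum_le_sum fun o _ => ?_)
  rw [norm_mul, Complex.norm_real, Real.norm_of_nonneg (cellProb_nonneg ζ hreg.mem_Θ hi o)]
  exact mul_le_of_le_one_right (cellProb_nonneg ζ hreg.mem_Θ hi o) (hf o)

/-- Law of large numbers in one interval. The characteristic function of the centred count at scale
`1 / n` is within `1 / n` of one; as the centred count is bounded by `n`, this bounds its second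
moment, through `1 - cos x ≥ 2 x² / π²` for `|x| ≤ π`. -/
lemma tendsto_numOutcome_sub (htest : m.IsLifeTest ζ P θ₀ T C V rule W)
    (hreg : m.Regular ζ Θ₀ θ₀) {i : ℕ} (hi : i < M) (o : Option (Fin J)) :
    Tendsto (fun x : ℕ × Ω => ((numOutcome ζ T C W x.1 i o x.2 : ℝ) -
      m.cellProb ζ i o θ₀ * numAtRisk ζ T W x.1 i x.2) / x.1) (inProbability P) (𝓝 0) := by
  classical
  let α : Option (Fin J) → ℝ := fun o' => (if o' = o then 1 else 0) - m.cellProb ζ i o θ₀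
  let X : ℕ → Ω → ℝ := fun n ω => ((numOutcome ζ T C W n i o ω : ℝ) -
      m.cellProb ζ i o θ₀ * numAtRisk ζ T W n i ω) / n
  have hp0 := cellProb_nonneg ζ hreg.mem_Θ hi o
  have hp1 := cellProb_le_one ζ hreg.mem_Θ hi o
  have hα : ∀ o', |α o'| ≤ 1 := fun o' => by
    simp only [α]
    rw [abs_le]
    split_ifs <;> constructor <;> linarith
  have hXm : ∀ n, Measurable (X n) := fun n => by
    have h1 : Measurable fun ω => (numOutcome ζ T C W n i o ω : ℝ) :=
      (measurable_from_nat (f := fun k : ℕ => (k : ℝ))).comp (htest.measurable_numOutcome n hi o)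
    have h2 : Measurable fun ω => (numAtRisk ζ T W n i ω : ℝ) :=
      (measurable_from_nat (f := fun k : ℕ => (k : ℝ))).comp (htest.measurable_numAtRisk n hi.le)
    exact (h1.sub (h2.const_mul _)).div_const _
  have hX1 : ∀ n ω, |X n ω| ≤ 1 := fun n ω => by
    simp only [X]
    rw [abs_div, Nat.abs_cast]
    refine div_le_one_of_le₀ ?_ (Nat.cast_nonneg n)
    have h1 : (numOutcome ζ T C W n i o ω : ℝ) ≤ numAtRisk ζ T W n i ω := by
      exact_mod_cast numOutcome_le_numAtRisk n i o ω
    have h2 : (numAtRisk ζ T W n i ω : ℝ) ≤ n := by exact_mod_cast numAtRisk_le n i ω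
    have h3 : (0 : ℝ) ≤ numOutcome ζ T C W n i o ω := Nat.cast_nonneg _
    have h4 : (0 : ℝ) ≤ numAtRisk ζ T W n i ω := Nat.cast_nonneg _
    have h5 := mul_le_of_le_one_left h4 hp1
    have h6 := mul_nonneg hp0 h4
    rw [abs_le]
    constructor <;> linarith
  have hcf : ∀ n : ℕ, 0 < n → ‖∫ ω, Complex.exp (X n ω * Complex.I) ∂P - 1‖ ≤ 1 / n := by
    intro n hn
    have hn' : (0 : ℝ) < n := by exact_mod_cast hn
    let f : Option (Fin J) → ℂ := fun o' => Complex.exp ((α o' / n : ℝ) * Complex.I)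
    have hf : ∀ o', ‖f o'‖ ≤ 1 := fun o' => (Complex.norm_exp_ofReal_mul_I _).le
    have h := htest.integral_mul_prod_pow_numOutcome hreg (n := n) hi hf (z := fun _ => 1)
      (fun _ _ _ => rfl) (fun _ => by simp)
    have hexp : ∀ ω, ∏ o', f o' ^ numOutcome ζ T C W n i o' ω =
        Complex.exp (X n ω * Complex.I) := by
      intro ω
      simp only [f]
      rw [prod_exp_pow]
      congr 3
      have hsum : (∑ o', (numOutcome ζ T C W n i o' ω : ℝ)) = numAtRisk ζ T W n i ω := by
        exact_mod_cast sum_numOutcome n i ω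
      have hterm : ∀ o', α o' / n * numOutcome ζ T C W n i o' ω =
          ((if o' = o then (numOutcome ζ T C W n i o' ω : ℝ) else 0) -
            m.cellProb ζ i o θ₀ * numOutcome ζ T C W n i o' ω) / n := by
        intro o'
        simp only [α]
        split_ifs <;> ring
      rw [Finset.sum_congr rfl fun o' _ => hterm o', ← Finset.sum_div, Finset.sum_sub_distrib,
        ← Finset.mul_sum, hsum, Finset.sum_ite_eq' Finset.univ o, if_pos (Finset.mem_univ o)]
    simp only [one_mul, hexp] at h
    set φ : ℂ := ∑ o', m.cellProb ζ i o' θ₀ * f o' with hφ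
    have hφ1 : ‖φ‖ ≤ 1 := norm_sum_cellProb_mul_le_one hreg hi hf
    have hφsub : ‖φ - 1‖ ≤ 1 / n ^ 2 := by
      have h1 : (∑ o', (m.cellProb ζ i o' θ₀ : ℂ)) = 1 := by
        rw [← Complex.ofReal_sum, sum_cellProb ζ hreg.mem_Θ, Complex.ofReal_one]
      have h2 : (∑ o', (m.cellProb ζ i o' θ₀ : ℂ) * ((α o' / n : ℝ) * Complex.I)) = 0 := by
        have h3 : ∑ o', m.cellProb ζ i o' θ₀ * α o' = 0 := by
          simp only [α, mul_sub, Finset.sum_sub_distrib, mul_ite, mul_one, mul_zero,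
            Finset.sum_ite_eq', Finset.mem_univ, if_true]
          rw [← Finset.sum_mul, sum_cellProb ζ hreg.mem_Θ]
          ring
        have h4 : (∑ o', (m.cellProb ζ i o' θ₀ : ℂ) * ((α o' / n : ℝ) * Complex.I)) =
            ((∑ o', m.cellProb ζ i o' θ₀ * α o' : ℝ) : ℂ) * (Complex.I / n) := by
          push_cast
          rw [Finset.sum_mul]
          exact Finset.sum_congr rfl fun o' _ => by ring
        rw [h4, h3]
        simp
      have h5 : φ - 1 = ∑ o', (m.cellProb ζ i o' θ₀ : ℂ) *
          (f o' - 1 - (α o' / n : ℝ) * Complex.I) := by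
        have h6 : φ - 1 = φ - (∑ o', (m.cellProb ζ i o' θ₀ : ℂ)) -
            ∑ o', (m.cellProb ζ i o' θ₀ : ℂ) * ((α o' / n : ℝ) * Complex.I) := by
          rw [h1, h2, sub_zero]
        rw [h6, hφ, ← Finset.sum_sub_distrib, ← Finset.sum_sub_distrib]
        exact Finset.sum_congr rfl fun o' _ => by ring
      rw [h5]
      have hrhs : (1 / n ^ 2 : ℝ) = ∑ o', m.cellProb ζ i o' θ₀ * (1 / n ^ 2) := by
        rw [← Finset.sum_mul, sum_cellProb ζ hreg.mem_Θ, one_mul]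
      rw [hrhs]
      refine (norm_sum_le _ _).trans (Finset.sum_le_sum fun o' _ => ?_)
      rw [norm_mul, Complex.norm_real, Real.norm_of_nonneg (cellProb_nonneg ζ hreg.mem_Θ hi o')]
      refine mul_le_mul_of_nonneg_left ?_ (cellProb_nonneg ζ hreg.mem_Θ hi o')
      have hz : ‖((α o' / n : ℝ) : ℂ) * Complex.I‖ ≤ 1 / n := by
        rw [norm_mul, Complex.norm_I, mul_one, Complex.norm_real, Real.norm_eq_abs, abs_div,
          Nat.abs_cast]
        exact div_le_div_of_nonneg_right (hα o') hn'.le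
      have hz1 : (1 / n : ℝ) ≤ 1 := by
        rw [div_le_one hn']
        exact_mod_cast hn
      refine (Complex.norm_exp_sub_one_sub_id_le (hz.trans hz1)).trans ?_
      refine (pow_le_pow_left₀ (norm_nonneg _) hz 2).trans_eq ?_
      rw [div_pow, one_pow]
    have hbound : ∀ ω, ‖φ ^ numAtRisk ζ T W n i ω - 1‖ ≤ 1 / n := fun ω => by
      refine (norm_pow_sub_one_le hφ1 _).trans ?_
      have h2 : (numAtRisk ζ T W n i ω : ℝ) ≤ n := by exact_mod_cast numAtRisk_le n i ω
      calc _ ≤ (n : ℝ) * (1 / n ^ 2) := mul_le_mul h2 hφsub (norm_nonneg _) hn'.le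
        _ = 1 / n := by field_simp
    have hm : Measurable fun ω => φ ^ numAtRisk ζ T W n i ω :=
      (measurable_from_nat (f := fun k : ℕ => φ ^ k)).comp (htest.measurable_numAtRisk n hi.le)
    have hint : Integrable (fun ω => φ ^ numAtRisk ζ T W n i ω) P :=
      Integrable.of_bound hm.aestronglyMeasurable 1 (Eventually.of_forall fun ω => by
        rw [norm_pow]
        exact pow_le_one₀ (norm_nonneg _) hφ1)
    have h1 : ∫ ω, Complex.exp (X n ω * Complex.I) ∂P - 1 =
        ∫ ω, (φ ^ numAtRisk ζ T W n i ω - 1) ∂P := by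
      rw [integral_sub hint (integrable_const _), h]
      simp
    rw [h1]
    refine (norm_integral_le_of_norm_le_const (Eventually.of_forall hbound)).trans_eq ?_
    simp
  have hcos : ∀ n : ℕ, 0 < n → ∫ ω, (1 - Real.cos (X n ω)) ∂P ≤ 1 / n := by
    intro n hn
    refine le_trans ?_ (hcf n hn)
    have hexpint : Integrable (fun ω => Complex.exp (X n ω * Complex.I)) P :=
      Integrable.of_bound (by have := hXm n; fun_prop) 1
        (Eventually.of_forall fun ω => (Complex.norm_exp_ofReal_mul_I _).le)
    have hre : ∫ ω, Real.cos (X n ω) ∂P = (∫ ω, Complex.exp (X n ω * Complex.I) ∂P).re := by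
      have h := integral_re hexpint
      simp only [RCLike.re_to_complex, Complex.exp_ofReal_mul_I_re] at h
      exact h
    have hcosint : Integrable (fun ω => Real.cos (X n ω)) P :=
      Integrable.of_bound (by have := hXm n; fun_prop) 1
        (Eventually.of_forall fun ω => Real.abs_cos_le_one _)
    rw [integral_sub (integrable_const _) hcosint, hre]
    simp only [integral_const, probReal_univ, one_smul]
    rw [norm_sub_rev]
    exact (le_abs_self _).trans
      (Complex.abs_re_le_norm (1 - ∫ ω, Complex.exp (X n ω * Complex.I) ∂P))
  refine (tendstoInMeasure_const_iff (f := X)).1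
    (tendstoInMeasure_iff_measureReal_norm.2 fun ε hε => ?_)
  have hc : 0 < 2 / Real.pi ^ 2 * ε ^ 2 := by positivity
  have hlim : Tendsto (fun n : ℕ => (2 / Real.pi ^ 2 * ε ^ 2)⁻¹ * (1 / (n : ℝ))) atTop (𝓝 0) := by
    have := tendsto_one_div_atTop_nhds_zero_nat (𝕜 := ℝ).const_mul (2 / Real.pi ^ 2 * ε ^ 2)⁻¹
    rwa [mul_zero] at this
  refine tendsto_of_tendsto_of_tendsto_of_le_of_le' tendsto_const_nhds hlim
    (Eventually.of_forall fun _ => measureReal_nonneg) ?_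
  filter_upwards [eventually_gt_atTop 0] with n hn
  rw [le_inv_mul_iff₀ hc]
  have hcosint : Integrable (fun ω => 1 - Real.cos (X n ω)) P :=
    (integrable_const _).sub (Integrable.of_bound (by have := hXm n; fun_prop) 1
      (Eventually.of_forall fun ω => Real.abs_cos_le_one _))
  refine le_trans ?_ ((mul_meas_ge_le_integral_of_nonneg
    (Eventually.of_forall fun ω => sub_nonneg.2 (Real.cos_le_one _)) hcosint
      (2 / Real.pi ^ 2 * ε ^ 2)).trans (hcos n hn))
  refine mul_le_mul_of_nonneg_left (measureReal_mono fun ω hω => ?_) hc.le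
  simp only [Set.mem_ofPred_eq, sub_zero, Real.norm_eq_abs] at hω ⊢
  have hpi : |X n ω| ≤ Real.pi := (hX1 n ω).trans (by linarith [Real.pi_gt_three])
  have h1 := Real.cos_le_one_sub_mul_cos_sq hpi
  have h2 : 2 / Real.pi ^ 2 * ε ^ 2 ≤ 2 / Real.pi ^ 2 * X n ω ^ 2 := by
    refine mul_le_mul_of_nonneg_left ?_ (by positivity)
    rw [← sq_abs (X n ω)]
    exact pow_le_pow_left₀ hε.le hω 2
  linarith

end IsLifeTest

end CompetingRisksModel

end

noncomputable section

namespace CompetingRisksModel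

variable {J s M : ℕ} {m : CompetingRisksModel J s} {ζ : PICScheme M} {Θ₀ : Set (ParamSpace s)}
  {θ₀ : ParamSpace s} {Ω 𝒱 : Type*} [MeasurableSpace Ω] [MeasurableSpace 𝒱] {P : Measure Ω}
  {T : ℕ → Ω → ℝ} {C : ℕ → Ω → Fin J} {V : Ω → 𝒱}
  {rule : ℕ → ℕ → 𝒱 → (ℕ → Fin J → Finset ℕ) → Finset ℕ} {W : ℕ → Ω → ℕ → Finset ℕ}

namespace IsLifeTest

lemma numAtRisk_succ (htest : m.IsLifeTest ζ P θ₀ T C V rule W) (n : ℕ) {i : ℕ} (hi : i < M)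
    (ω : Ω) : numAtRisk ζ T W n (i + 1) ω = numOutcome ζ T C W n i none ω -
      ⌊ζ.p i * (numOutcome ζ T C W n i none ω : ℝ)⌋₊ := by
  have h := Finset.card_sdiff_of_subset (htest.withdrawn_subset n i hi ω)
  rw [htest.withdrawn_card n i hi ω] at h
  rw [numOutcome, outcomeCount_none]
  exact h

variable [IsProbabilityMeasure P]

/-- The fractions of units at risk. Rounding in the numbers of withdrawals changes them by at most
`1 / n`. -/
lemma tendsto_numAtRisk_div (htest : m.IsLifeTest ζ P θ₀ T C V rule W)
    (hreg : m.Regular ζ Θ₀ θ₀) {i : ℕ} (hi : i < M) :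
    Tendsto (fun x : ℕ × Ω => (numAtRisk ζ T W x.1 i x.2 : ℝ) / x.1) (inProbability P)
      (𝓝 (m.limitFraction ζ i θ₀)) := by
  have hinv : Tendsto (fun x : ℕ × Ω => 1 / (x.1 : ℝ)) (inProbability P) (𝓝 0) :=
    (tendsto_one_div_atTop_nhds_zero_nat (𝕜 := ℝ)).comp tendsto_fst_inProbability
  have hpos : ∀ᶠ x in inProbability P, 0 < (x : ℕ × Ω).1 :=
    tendsto_fst_inProbability.eventually_gt_atTop 0
  induction i with
  | zero =>
    simp only [limitFraction, Finset.range_zero, Finset.prod_empty]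
    refine tendsto_const_nhds.congr' ?_
    filter_upwards [hpos] with x hx
    have : (x.1 : ℝ) ≠ 0 := by exact_mod_cast hx.ne'
    simp [numAtRisk, atRisk, this]
  | succ i ih =>
    have hi' : i < M := i.lt_succ_self.trans hi
    have hp0 := ζ.p_nonneg i hi
    have hp1 := (ζ.p_lt_one i hi).le
    have hsurv : Tendsto (fun x : ℕ × Ω => (numOutcome ζ T C W x.1 i none x.2 : ℝ) / x.1)
        (inProbability P) (𝓝 (m.cellProb ζ i none θ₀ * m.limitFraction ζ i θ₀)) := by
      have := (htest.tendsto_numOutcome_sub hreg hi' none).add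
        ((ih hi').const_mul (m.cellProb ζ i none θ₀))
      rw [zero_add] at this
      exact this.congr fun x => by ring
    have hlim : m.limitFraction ζ (i + 1) θ₀ =
        (1 - ζ.p i) * (m.cellProb ζ i none θ₀ * m.limitFraction ζ i θ₀) := by
      rw [limitFraction, Finset.prod_range_succ]
      simp only [cellProb, limitFraction]
      ring
    rw [hlim]
    have hmain := hsurv.const_mul (1 - ζ.p i)
    have hdiff : Tendsto (fun x : ℕ × Ω => (numAtRisk ζ T W x.1 (i + 1) x.2 : ℝ) / x.1 -
        (1 - ζ.p i) * ((numOutcome ζ T C W x.1 i none x.2 : ℝ) / x.1)) (inProbability P) (𝓝 0) := by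
      rw [tendsto_zero_iff_abs_tendsto_zero]
      refine tendsto_of_tendsto_of_tendsto_of_le_of_le tendsto_const_nhds hinv
        (fun _ => abs_nonneg _) fun x => ?_
      simp only [Function.comp_apply]
      rw [htest.numAtRisk_succ x.1 hi' x.2]
      set k := numOutcome ζ T C W x.1 i none x.2
      have hk : (0 : ℝ) ≤ ζ.p i * k := mul_nonneg hp0 (Nat.cast_nonneg k)
      have hfl1 := Nat.floor_le hk
      have hfl2 := Nat.lt_floor_add_one (ζ.p i * k)
      have hle : ⌊ζ.p i * (k : ℝ)⌋₊ ≤ k := by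
        refine Nat.floor_le_of_le ?_
        exact mul_le_of_le_one_left (Nat.cast_nonneg k) hp1
      rw [Nat.cast_sub hle]
      have : ((k : ℝ) - ⌊ζ.p i * (k : ℝ)⌋₊) / x.1 - (1 - ζ.p i) * (k / x.1) =
          (ζ.p i * k - ⌊ζ.p i * (k : ℝ)⌋₊) / x.1 := by ring
      rw [this, abs_div, Nat.abs_cast]
      refine div_le_div_of_nonneg_right ?_ (Nat.cast_nonneg _)
      rw [abs_le]
      constructor <;> linarith
    have := hdiff.add hmain
    rw [zero_add] at this
    exact this.congr fun x => by ring

lemma tendsto_numOutcome_div (htest : m.IsLifeTest ζ P θ₀ T C V rule W)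
    (hreg : m.Regular ζ Θ₀ θ₀) {i : ℕ} (hi : i < M) (o : Option (Fin J)) :
    Tendsto (fun x : ℕ × Ω => (numOutcome ζ T C W x.1 i o x.2 : ℝ) / x.1) (inProbability P)
      (𝓝 (m.limitFraction ζ i θ₀ * m.cellProb ζ i o θ₀)) := by
  have := (htest.tendsto_numOutcome_sub hreg hi o).add
    ((htest.tendsto_numAtRisk_div hreg hi).const_mul (m.cellProb ζ i o θ₀))
  rw [zero_add, mul_comm] at this
  exact this.congr fun x => by ring

/-- Central limit theorem for sums over the intervals of linear functions of the outcome counts that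
are centred given the past. The conditional characteristic functions of the summands have constant
limits in probability, so the intervals can be split off one after the other. -/
lemma tendsto_integral_prod_exp (htest : m.IsLifeTest ζ P θ₀ T C V rule W)
    (hreg : m.Regular ζ Θ₀ θ₀) {α : ℕ → Option (Fin J) → ℝ}
    (hα : ∀ i < M, ∑ o, m.cellProb ζ i o θ₀ * α i o = 0) {i : ℕ} (hi : i ≤ M) :
    Tendsto (fun n : ℕ => ∫ ω, ∏ l ∈ Finset.range i, ∏ o,
      Complex.exp ((α l o / √n : ℝ) * Complex.I) ^ numOutcome ζ T C W n l o ω ∂P) atTop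
      (𝓝 (Complex.exp (-(∑ l ∈ Finset.range i,
        m.limitFraction ζ l θ₀ * ∑ o, m.cellProb ζ l o θ₀ * α l o ^ 2 : ℝ) / 2))) := by
  induction i with
  | zero => simp
  | succ i ih =>
    have hi' : i < M := hi
    let f : ℕ → ℕ → Option (Fin J) → ℂ := fun n l o =>
      Complex.exp ((α l o / √n : ℝ) * Complex.I)
    have hf : ∀ n l o, ‖f n l o‖ ≤ 1 := fun n l o => (Complex.norm_exp_ofReal_mul_I _).le
    let z : ℕ → Ω → ℂ := fun n ω => ∏ l ∈ Finset.range i, ∏ o, f n l o ^ numOutcome ζ T C W n l o ω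
    let φ : ℕ → ℂ := fun n => ∑ o, m.cellProb ζ i o θ₀ * f n i o
    have hφ1 : ∀ n, ‖φ n‖ ≤ 1 := fun n => norm_sum_cellProb_mul_le_one hreg hi' (hf n i)
    have hz : ∀ n, DependsOnRecord ζ T C W n i (z n) := fun n ω ω' h =>
      Finset.prod_congr rfl fun l hl => Finset.prod_congr rfl fun o _ => by
        rw [dependsOnRecord_numOutcome (Finset.mem_range.1 hl) o ω ω' h]
    have hz1 : ∀ n ω, ‖z n ω‖ ≤ 1 := fun n ω => by
      simp only [z]
      rw [norm_prod]
      refine Finset.prod_le_one (fun _ _ => norm_nonneg _) fun l _ => ?_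
      rw [norm_prod]
      refine Finset.prod_le_one (fun _ _ => norm_nonneg _) fun o _ => ?_
      rw [norm_pow]
      exact pow_le_one₀ (norm_nonneg _) (hf n l o)
    have hzm : ∀ n, Measurable (z n) := fun n => htest.measurable_of_dependsOnRecord hi'.le (hz n)
    set v : ℝ := ∑ o, m.cellProb ζ i o θ₀ * α i o ^ 2 with hv
    set c : ℂ := Complex.exp (m.limitFraction ζ i θ₀ * (-(v / 2 : ℝ))) with hc
    have hφlim : Tendsto (fun x : ℕ × Ω => φ x.1 ^ numAtRisk ζ T W x.1 i x.2) (inProbability P)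
        (𝓝 c) := by
      refine tendsto_pow_of_mul_sub_one tendsto_fst_inProbability ?_
        (htest.tendsto_numAtRisk_div hreg hi')
      have := (tendsto_mul_sum_exp_sub_one (sum_cellProb ζ hreg.mem_Θ i) (hα i hi')).comp
        (tendsto_fst_inProbability (P := P))
      rw [← Finset.sum_div] at this
      exact this
    have hφm : ∀ n, Measurable fun ω => φ n ^ numAtRisk ζ T W n i ω := fun n =>
      (measurable_from_nat (f := fun k : ℕ => φ n ^ k)).comp (htest.measurable_numAtRisk n hi'.le)
    have hdiff : Tendsto (fun n => ∫ ω, z n ω * (φ n ^ numAtRisk ζ T W n i ω - c) ∂P) atTop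
        (𝓝 0) := by
      refine tendsto_integral_of_tendsto_inProbability (K := 1 + ‖c‖)
        (fun n => ((hzm n).mul ((hφm n).sub_const c)).aestronglyMeasurable) (fun n ω => ?_) ?_
      · rw [norm_mul]
        refine (mul_le_of_le_one_left (norm_nonneg _) (hz1 n ω)).trans ((norm_sub_le _ _).trans ?_)
        rw [norm_pow]
        linarith [pow_le_one₀ (norm_nonneg _) (hφ1 n) (n := numAtRisk ζ T W n i ω)]
      · rw [tendsto_zero_iff_norm_tendsto_zero]
        have h0 := (hφlim.sub_const c).norm
        rw [sub_self, norm_zero] at h0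
        refine tendsto_of_tendsto_of_tendsto_of_le_of_le tendsto_const_nhds h0
          (fun _ => norm_nonneg _) fun x => ?_
        rw [norm_mul]
        exact mul_le_of_le_one_left (norm_nonneg _) (hz1 _ _)
    have hsum := hdiff.add ((ih hi'.le).mul_const c)
    rw [zero_add] at hsum
    have hlim : Complex.exp (-(∑ l ∈ Finset.range i,
        m.limitFraction ζ l θ₀ * ∑ o, m.cellProb ζ l o θ₀ * α l o ^ 2 : ℝ) / 2) * c =
        Complex.exp (-(∑ l ∈ Finset.range (i + 1),
          m.limitFraction ζ l θ₀ * ∑ o, m.cellProb ζ l o θ₀ * α l o ^ 2 : ℝ) / 2) := by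
      rw [hc, ← Complex.exp_add, Finset.sum_range_succ, ← hv]
      congr 1
      push_cast
      ring
    rw [← hlim]
    refine hsum.congr fun n => ?_
    have hI := htest.integral_mul_prod_pow_numOutcome hreg hi' (hf n i) (hz n) (hz1 n)
    have hint1 : Integrable (fun ω => z n ω * φ n ^ numAtRisk ζ T W n i ω) P :=
      Integrable.of_bound ((hzm n).mul (hφm n)).aestronglyMeasurable 1
        (Eventually.of_forall fun ω => by
          rw [norm_mul, norm_pow]
          exact mul_le_one₀ (hz1 n ω) (by positivity) (pow_le_one₀ (norm_nonneg _) (hφ1 n)))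
    have hint2 : Integrable (fun ω => z n ω * c) P :=
      (Integrable.of_bound (hzm n).aestronglyMeasurable 1
        (Eventually.of_forall (hz1 n))).mul_const c
    simp only [Finset.prod_range_succ, mul_sub]
    rw [integral_sub hint1 hint2, integral_mul_const]
    change _ = ∫ ω, z n ω * ∏ o, f n i o ^ numOutcome ζ T C W n i o ω ∂P
    rw [hI]
    exact sub_add_cancel _ _

end IsLifeTest

end CompetingRisksModel

end

noncomputable section

/-! ### The model as a family of cell probabilities -/

namespace CompetingRisksModel

variable {J s M : ℕ} {m : CompetingRisksModel J s} {ζ : PICScheme M} {Θ₀ : Set (ParamSpace s)}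
  {θ₀ : ParamSpace s}

/-- The conditional cell probabilities of all intervals, as one family indexed by the pairs of an
interval and an outcome. -/
def cell (m : CompetingRisksModel J s) (ζ : PICScheme M) (k : Fin M × Option (Fin J)) :
    ParamSpace s → ℝ := m.cellProb ζ k.1 k.2

/-- The limiting fraction of units that enter the interval of a cell. -/
def cellWeight (m : CompetingRisksModel J s) (ζ : PICScheme M) (θ₀ : ParamSpace s)
    (k : Fin M × Option (Fin J)) : ℝ := m.limitFraction ζ k.1 θ₀

lemma Regular.limitFraction_pos (hreg : m.Regular ζ Θ₀ θ₀) {i : ℕ} (hi : i < M) :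
    0 < m.limitFraction ζ i θ₀ := by
  refine Finset.prod_pos fun l hl => ?_
  have hl := Finset.mem_range.1 hl
  exact mul_pos (sub_pos.2 (ζ.p_lt_one l (by omega))) (sub_pos.2 (hreg.q_mem l (by omega)).2)

lemma Regular.cell_pos (hreg : m.Regular ζ Θ₀ θ₀) (k : Fin M × Option (Fin J)) :
    0 < m.cell ζ k θ₀ := hreg.cellProb_pos k.1.2 k.2

lemma Regular.cellWeight_pos (hreg : m.Regular ζ Θ₀ θ₀) (k : Fin M × Option (Fin J)) :
    0 < m.cellWeight ζ θ₀ k := hreg.limitFraction_pos k.1.2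

lemma sum_cellWeight_mul_cell {θ : ParamSpace s} (hθ : θ ∈ m.Θ) :
    ∑ k, m.cellWeight ζ θ₀ k * m.cell ζ k θ = ∑ i : Fin M, m.limitFraction ζ i θ₀ := by
  rw [Fintype.sum_prod_type]
  refine Finset.sum_congr rfl fun i _ => ?_
  simp only [cellWeight, cell]
  rw [← Finset.mul_sum, sum_cellProb ζ hθ, mul_one]

lemma Regular.contDiffOn_FT (hreg : m.Regular ζ Θ₀ θ₀) {i : ℕ} (hi : i ≤ M) :
    ContDiffOn ℝ 2 (m.FT (ζ.L i)) Θ₀ := by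
  cases i with
  | zero =>
    refine (contDiffOn_const (c := (0 : ℝ))).congr fun θ hθ => ?_
    rw [ζ.L_zero, FT_eq_zero (hreg.subset hθ)]
  | succ i => exact (hreg.FT_partials i hi).contDiffOn hreg.isOpen

lemma Regular.contDiffOn_G (hreg : m.Regular ζ Θ₀ θ₀) {i : ℕ} (hi : i ≤ M) (j : Fin J) :
    ContDiffOn ℝ 2 (m.G j (ζ.L i)) Θ₀ := by
  cases i with
  | zero =>
    refine (contDiffOn_const (c := (0 : ℝ))).congr fun θ hθ => ?_
    rw [ζ.L_zero, G_eq_zero (hreg.subset hθ)]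
  | succ i => exact (hreg.G_partials i hi j).contDiffOn hreg.isOpen

/-- Near `θ₀` the cell probabilities are positive and twice continuously differentiable. -/
lemma Regular.exists_isOpen_cell (hreg : m.Regular ζ Θ₀ θ₀) :
    ∃ U, IsOpen U ∧ θ₀ ∈ U ∧ U ⊆ Θ₀ ∧
      (∀ k : Fin M × Option (Fin J), ContDiffOn ℝ 2 (m.cell ζ k) U) ∧
      ∀ k, ∀ θ ∈ U, 0 < m.cell ζ k θ := by
  have hΘ₀ : Θ₀ ∈ 𝓝 θ₀ := hreg.isOpen.mem_nhds hreg.mem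
  have h1 : ∀ᶠ θ in 𝓝 θ₀, θ ∈ Θ₀ ∧ ∀ i : Fin M, m.FT (ζ.L i) θ < 1 := by
    refine (eventually_mem_set.2 hΘ₀).and (eventually_all.2 fun i => ?_)
    exact ((hreg.contDiffOn_FT i.2.le).continuousOn.continuousAt hΘ₀).eventually_lt_const
      (hreg.FT_lt_one i.2.le)
  obtain ⟨V, hV, hVo, hθV⟩ := eventually_nhds_iff.1 h1
  have hVΘ : V ⊆ Θ₀ := fun θ hθ => (hV θ hθ).1
  have hC : ∀ k : Fin M × Option (Fin J), ContDiffOn ℝ 2 (m.cell ζ k) V := by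
    rintro ⟨i, o⟩
    have hden : ∀ θ ∈ V, 1 - m.FT (ζ.L i) θ ≠ 0 := fun θ hθ => (sub_pos.2 ((hV θ hθ).2 i)).ne'
    have hF := (hreg.contDiffOn_FT i.2.le).mono hVΘ
    cases o with
    | none =>
      exact contDiffOn_const.sub
        ((((hreg.contDiffOn_FT i.2).mono hVΘ).sub hF).div (contDiffOn_const.sub hF) hden)
    | some j =>
      exact (((hreg.contDiffOn_G i.2 j).mono hVΘ).sub ((hreg.contDiffOn_G i.2.le j).mono hVΘ)).div
        (contDiffOn_const.sub hF) hden
  have h2 : ∀ᶠ θ in 𝓝 θ₀, θ ∈ V ∧ ∀ k, 0 < m.cell ζ k θ := by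
    have hVn := hVo.mem_nhds hθV
    refine (eventually_mem_set.2 hVn).and (eventually_all.2 fun k => ?_)
    exact ((hC k).continuousOn.continuousAt hVn).eventually_const_lt (hreg.cell_pos k)
  obtain ⟨U, hU, hUo, hθU⟩ := eventually_nhds_iff.1 h2
  exact ⟨U, hUo, hθU, fun θ hθ => hVΘ (hU θ hθ).1,
    fun k => (hC k).mono fun θ hθ => (hU θ hθ).1, fun k θ hθ => (hU θ hθ).2 k⟩

lemma Regular.differentiableAt_cell (hreg : m.Regular ζ Θ₀ θ₀) (k : Fin M × Option (Fin J)) :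
    DifferentiableAt ℝ (m.cell ζ k) θ₀ := by
  obtain ⟨U, hUo, hθU, -, hC, -⟩ := hreg.exists_isOpen_cell
  exact ((hC k).contDiffAt (hUo.mem_nhds hθU)).differentiableAt two_ne_zero

/-- The cell probabilities of an interval add up to one, so that their derivatives cancel. -/
lemma Regular.sum_fderiv_cellProb (hreg : m.Regular ζ Θ₀ θ₀) {i : ℕ} (hi : i < M)
    (v : ParamSpace s) : ∑ o, fderiv ℝ (m.cellProb ζ i o) θ₀ v = 0 := by
  have h : HasFDerivAt (fun θ => ∑ o, m.cellProb ζ i o θ)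
      (∑ o, fderiv ℝ (m.cellProb ζ i o) θ₀) θ₀ :=
    HasFDerivAt.fun_sum fun o _ => (hreg.differentiableAt_cell (⟨i, hi⟩, o)).hasFDerivAt
  have h' : HasFDerivAt (fun θ => ∑ o, m.cellProb ζ i o θ) (0 : ParamSpace s →L[ℝ] ℝ) θ₀ := by
    refine (hasFDerivAt_const (1 : ℝ) θ₀).congr_of_eventuallyEq ?_
    filter_upwards [hreg.isOpen.mem_nhds hreg.mem] with θ hθ
    exact sum_cellProb ζ (hreg.subset hθ) i
  have := congrArg (fun l : ParamSpace s →L[ℝ] ℝ => l v) (h.unique h')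
  simpa using this

/-! ### The asymptotic information matrix -/

lemma Regular.partialDeriv_cell (hreg : m.Regular ζ Θ₀ θ₀) (k : Fin M × Option (Fin J))
    (u : Fin s) : partialDeriv u (m.cell ζ k) θ₀ = fderiv ℝ (m.cell ζ k) θ₀ (coordDir u) :=
  (hreg.differentiableAt_cell k).lineDeriv_eq_fderiv

lemma Regular.partialDeriv_q (hreg : m.Regular ζ Θ₀ θ₀) (i : Fin M) (u : Fin s) :
    partialDeriv u (m.q ζ i) θ₀ = -fderiv ℝ (m.cell ζ (i, none)) θ₀ (coordDir u) := by
  have hq : m.q ζ i = fun θ => 1 - m.cell ζ (i, none) θ := by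
    funext θ
    simp [cell, cellProb]
  have hd := hreg.differentiableAt_cell (i, none)
  rw [hq, partialDeriv, (hd.const_sub 1).lineDeriv_eq_fderiv, fderiv_const_sub]
  rfl

lemma Regular.unitInfo_apply (hreg : m.Regular ζ Θ₀ θ₀) (u v : Fin s) :
    m.unitInfo ζ θ₀ u v =
      cellInfo (m.cell ζ) (m.cellWeight ζ θ₀) θ₀ (coordDir u) (coordDir v) := by
  rw [cellInfo_apply, Fintype.sum_prod_type, unitInfo, fisherInfo, Matrix.sum_apply]
  refine Finset.sum_congr rfl fun i _ => ?_
  rw [Matrix.smul_apply, Fintype.sum_option]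
  simp only [stageInfo, Matrix.of_apply, smul_eq_mul, hreg.partialDeriv_q, cellWeight]
  have h1 : ∀ j u, partialDeriv u (m.qc ζ i j) θ₀ =
    fderiv ℝ (m.cell ζ (i, some j)) θ₀ (coordDir u) := fun j u =>
    hreg.partialDeriv_cell (i, some j) u
  have h2 : 1 - m.q ζ i θ₀ = m.cell ζ (i, none) θ₀ := rfl
  have h3 : ∀ j, m.qc ζ i j θ₀ = m.cell ζ (i, some j) θ₀ := fun j => rfl
  simp only [h1, h2, h3, mul_add, Finset.mul_sum]
  rw [add_comm]
  congr 1
  · ring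
  · exact Finset.sum_congr rfl fun j _ => by ring

lemma sum_smul_coordDir (c : ParamSpace s) : ∑ u, c u • coordDir u = c := by
  ext v
  simp [coordDir, Pi.single_apply]

lemma Regular.cellInfo_eq_dotProduct (hreg : m.Regular ζ Θ₀ θ₀) (c d : ParamSpace s) :
    cellInfo (m.cell ζ) (m.cellWeight ζ θ₀) θ₀ c d = c.ofLp ⬝ᵥ (m.unitInfo ζ θ₀).mulVec d.ofLp := by
  conv_lhs => rw [← sum_smul_coordDir c, ← sum_smul_coordDir d]
  simp only [map_sum, map_smul, sum_apply, smul_apply,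
    smul_eq_mul, ← hreg.unitInfo_apply, dotProduct, Matrix.mulVec, Finset.mul_sum]
  rw [Finset.sum_comm]
  exact Finset.sum_congr rfl fun u _ => Finset.sum_congr rfl fun v _ => by ring

/-- A direction without information leaves all the `q_i` stationary, which the rank condition
excludes. -/
lemma Regular.cellInfo_pos (hreg : m.Regular ζ Θ₀ θ₀) {c : ParamSpace s} (hc : c ≠ 0) :
    0 < cellInfo (m.cell ζ) (m.cellWeight ζ θ₀) θ₀ c c := by
  have hnn : ∀ k ∈ Finset.univ, 0 ≤ m.cellWeight ζ θ₀ k / m.cell ζ k θ₀ *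
      (fderiv ℝ (m.cell ζ k) θ₀ c * fderiv ℝ (m.cell ζ k) θ₀ c) := fun k _ =>
    mul_nonneg (div_pos (hreg.cellWeight_pos k) (hreg.cell_pos k)).le (mul_self_nonneg _)
  rw [cellInfo_apply]
  refine (Finset.sum_nonneg hnn).lt_of_ne' fun h0 => hc ?_
  have hd : ∀ k, fderiv ℝ (m.cell ζ k) θ₀ c = 0 := by
    intro k
    have := (Finset.sum_eq_zero_iff_of_nonneg hnn).1 h0 k (Finset.mem_univ k)
    simpa [(hreg.cellWeight_pos k).ne', (hreg.cell_pos k).ne'] using this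
  set A := Matrix.of fun (u : Fin s) (i : Fin M) => partialDeriv u (m.q ζ i) θ₀ with hA
  have hrow : LinearIndependent ℝ A.row := by
    rw [linearIndependent_iff_card_eq_finrank_span, Fintype.card_fin, Set.finrank,
      ← Matrix.rank_eq_finrank_span_row]
    exact hreg.rank_grad.symm
  have hv : A.vecMul c.ofLp = A.vecMul 0 := by
    rw [Matrix.zero_vecMul]
    funext i
    have h := hd (i, none)
    rw [← sum_smul_coordDir c] at h
    simp only [map_sum, map_smul, smul_eq_mul] at h
    simp only [Matrix.vecMul, dotProduct, hA, Matrix.of_apply, hreg.partialDeriv_q, mul_neg,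
      Finset.sum_neg_distrib, h, neg_zero, Pi.zero_apply]
  have := Matrix.vecMul_injective_iff.2 hrow hv
  ext u
  exact congrFun this u

lemma Regular.posDef_unitInfo (hreg : m.Regular ζ Θ₀ θ₀) : (m.unitInfo ζ θ₀).PosDef := by
  refine Matrix.PosDef.of_dotProduct_mulVec_pos ?_ fun x hx => ?_
  · ext u v
    rw [Matrix.conjTranspose_apply, star_trivial, hreg.unitInfo_apply, hreg.unitInfo_apply,
      cellInfo_apply, cellInfo_apply]
    exact Finset.sum_congr rfl fun k _ => by ring
  · have h := hreg.cellInfo_pos (c := WithLp.toLp 2 x) (by simpa using hx)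
    rw [hreg.cellInfo_eq_dotProduct] at h
    simpa using h

end CompetingRisksModel

end

noncomputable section

/-! ### The likelihood in terms of cell counts -/

namespace CompetingRisksModel

variable {J s M : ℕ} {m : CompetingRisksModel J s} {ζ : PICScheme M} {Θ₀ : Set (ParamSpace s)}
  {θ₀ : ParamSpace s}

/-- The number of units in each cell, computed from the failure counts. -/
def cellCount (ζ : PICScheme M) (n : ℕ) (d : CountData M J) : Fin M × Option (Fin J) → ℕ
  | (i, none) => atRiskCount ζ.p n d i - totalFailures d i
  | (i, some j) => d i j

/-- The numbers of units in the cells, relative to the sample size. -/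
def cellFreq (ζ : PICScheme M) (n : ℕ) (d : CountData M J) (k : Fin M × Option (Fin J)) : ℝ :=
  (cellCount ζ n d k : ℝ) / n

lemma likelihood_eq_prod (n : ℕ) (d : CountData M J) (θ : ParamSpace s) :
    m.likelihood ζ n d θ = ∏ k, m.cell ζ k θ ^ cellCount ζ n d k := by
  rw [likelihood, Fintype.prod_prod_type]
  refine Finset.prod_congr rfl fun i _ => ?_
  rw [Fintype.prod_option, mul_comm]
  rfl

lemma logLikelihood_eq (n : ℕ) (d : CountData M J) :
    m.logLikelihood ζ n d = cellLogLik (m.cell ζ) fun k => (cellCount ζ n d k : ℝ) := by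
  funext θ
  rw [logLikelihood, cellLogLik, Fintype.sum_prod_type]
  refine Finset.sum_congr rfl fun i _ => ?_
  rw [Fintype.sum_option, add_comm]
  rfl

lemma likelihood_eq_exp {n : ℕ} (hn : 0 < n) (d : CountData M J) {θ : ParamSpace s}
    (hθ : ∀ k, 0 < m.cell ζ k θ) :
    m.likelihood ζ n d θ = Real.exp (n * cellLogLik (m.cell ζ) (cellFreq ζ n d) θ) := by
  have hn' : (n : ℝ) ≠ 0 := Nat.cast_ne_zero.2 hn.ne'
  rw [likelihood_eq_prod, cellLogLik, Finset.mul_sum, Real.exp_sum]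
  refine Finset.prod_congr rfl fun k _ => ?_
  rw [cellFreq, ← mul_assoc, mul_div_cancel₀ _ hn', Real.exp_nat_mul, Real.exp_log (hθ k)]

lemma likelihood_le_likelihood_iff {n : ℕ} (hn : 0 < n) (d : CountData M J) {θ θ' : ParamSpace s}
    (hθ : ∀ k, 0 < m.cell ζ k θ) (hθ' : ∀ k, 0 < m.cell ζ k θ') :
    m.likelihood ζ n d θ ≤ m.likelihood ζ n d θ' ↔
      cellLogLik (m.cell ζ) (cellFreq ζ n d) θ ≤ cellLogLik (m.cell ζ) (cellFreq ζ n d) θ' := by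
  rw [likelihood_eq_exp hn d hθ, likelihood_eq_exp hn d hθ', Real.exp_le_exp,
    mul_le_mul_iff_right₀ (Nat.cast_pos.2 hn)]

lemma isMLE_iff {n : ℕ} (hn : 0 < n) (d : CountData M J) {K : Set (ParamSpace s)}
    (hK : ∀ k, ∀ θ ∈ K, 0 < m.cell ζ k θ) {θ : ParamSpace s} :
    m.IsMLE ζ K n d θ ↔ θ ∈ K ∧ IsMaxOn (cellLogLik (m.cell ζ) (cellFreq ζ n d)) K θ := by
  refine and_congr_right fun hθ => ?_
  simp only [isMaxOn_iff]
  exact forall₂_congr fun θ' hθ' => likelihood_le_likelihood_iff hn d (fun k => hK k θ' hθ')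
    fun k => hK k θ hθ

lemma isLikelihoodRoot_iff {n : ℕ} (hn : 0 < n) (d : CountData M J) {U : Set (ParamSpace s)}
    (hU : IsOpen U) (hC : ∀ k, ContDiffOn ℝ 2 (m.cell ζ k) U)
    (hpos : ∀ k, ∀ θ ∈ U, 0 < m.cell ζ k θ) {θ : ParamSpace s} (hθ : θ ∈ U) :
    m.IsLikelihoodRoot ζ n d θ ↔ cellScore (m.cell ζ) (cellFreq ζ n d) θ = 0 := by
  have hn' : (n : ℝ)⁻¹ ≠ 0 := inv_ne_zero (Nat.cast_ne_zero.2 hn.ne')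
  have hw : cellFreq ζ n d = (n : ℝ)⁻¹ • fun k => (cellCount ζ n d k : ℝ) := by
    funext k
    simp [cellFreq, div_eq_inv_mul]
  rw [hw, cellScore_smul, smul_eq_zero_iff_right hn', IsLikelihoodRoot, logLikelihood_eq]
  set w : Fin M × Option (Fin J) → ℝ := fun k => (cellCount ζ n d k : ℝ)
  have h := hasFDerivAt_cellLogLik hU hC hpos w hθ
  refine ⟨fun h0 => ?_, fun h0 u => ?_⟩
  · ext c
    rw [← sum_smul_coordDir c, map_sum]
    refine Finset.sum_eq_zero fun u _ => ?_
    rw [map_smul, (h.hasLineDerivAt (coordDir u)).unique (h0 u), smul_zero]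
  · have := h.hasLineDerivAt (coordDir u)
    rwa [h0] at this

variable {Ω 𝒱 : Type*}
  {T : ℕ → Ω → ℝ} {C : ℕ → Ω → Fin J} {V : Ω → 𝒱}
  {rule : ℕ → ℕ → 𝒱 → (ℕ → Fin J → Finset ℕ) → Finset ℕ} {W : ℕ → Ω → ℕ → Finset ℕ}

lemma numOutcome_none_eq (n : ℕ) {i : ℕ} (hi : i < M) (ω : Ω) :
    numOutcome ζ T C W n i none ω =
      numAtRisk ζ T W n i ω - totalFailures (counts ζ T C W n ω) i := by
  have h := sum_outcomeCount (L := ζ.L) (t := fun k => T k ω) (c := fun k => C k ω) (W := W n ω)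
    (n := n) (i := i)
  rw [Fintype.sum_option] at h
  simp only [outcomeCount_some] at h
  rw [totalFailures, dif_pos hi]
  simp only [counts, numOutcome, numAtRisk]
  omega

variable [MeasurableSpace Ω] [MeasurableSpace 𝒱] {P : Measure Ω}

namespace IsLifeTest

lemma atRiskCount_counts (htest : m.IsLifeTest ζ P θ₀ T C V rule W) (n : ℕ) {i : ℕ} (hi : i ≤ M)
    (ω : Ω) : atRiskCount ζ.p n (counts ζ T C W n ω) i = numAtRisk ζ T W n i ω := by
  induction i with
  | zero => simp [atRiskCount, numAtRisk, atRisk]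
  | succ i ih =>
    rw [htest.numAtRisk_succ n hi, atRiskCount, ih (Nat.le_of_succ_le hi),
      numOutcome_none_eq n hi]

lemma cellCount_counts (htest : m.IsLifeTest ζ P θ₀ T C V rule W) (n : ℕ)
    (k : Fin M × Option (Fin J)) (ω : Ω) :
    cellCount ζ n (counts ζ T C W n ω) k = numOutcome ζ T C W n k.1 k.2 ω := by
  obtain ⟨i, o⟩ := k
  cases o with
  | none => rw [cellCount, htest.atRiskCount_counts n i.2.le, numOutcome_none_eq n i.2]
  | some j =>
    rw [numOutcome, outcomeCount_some]
    rfl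

lemma measurable_counts (htest : m.IsLifeTest ζ P θ₀ T C V rule W) (n : ℕ) :
    Measurable (counts (M := M) ζ T C W n) := by
  refine measurable_pi_lambda _ fun i => measurable_pi_lambda _ fun j => ?_
  convert htest.measurable_numOutcome n i.2 (some j) using 1
  funext ω
  rw [numOutcome, outcomeCount_some]
  rfl

lemma measurableSet_counts (htest : m.IsLifeTest ζ P θ₀ T C V rule W) (n : ℕ)
    (A : CountData M J → Prop) : MeasurableSet {ω | A (counts ζ T C W n ω)} :=
  htest.measurable_counts n (Set.to_countable {d | A d}).measurableSet

lemma measurable_comp_counts (htest : m.IsLifeTest ζ P θ₀ T C V rule W) (n : ℕ) {β : Type*}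
    [MeasurableSpace β] (f : CountData M J → β) : Measurable fun ω => f (counts ζ T C W n ω) :=
  (measurable_of_countable f).comp (htest.measurable_counts n)

variable [IsProbabilityMeasure P]

lemma tendsto_cellFreq (htest : m.IsLifeTest ζ P θ₀ T C V rule W) (hreg : m.Regular ζ Θ₀ θ₀) :
    Tendsto (fun x : ℕ × Ω => cellFreq ζ x.1 (counts ζ T C W x.1 x.2)) (inProbability P)
      (𝓝 fun k => m.cellWeight ζ θ₀ k * m.cell ζ k θ₀) := by
  refine tendsto_pi_nhds.2 fun k => ?_
  simp only [cellFreq, htest.cellCount_counts]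
  exact htest.tendsto_numOutcome_div hreg k.1.2 k.2

lemma tendsto_integral_numAtRisk_div (htest : m.IsLifeTest ζ P θ₀ T C V rule W)
    (hreg : m.Regular ζ Θ₀ θ₀) {i : ℕ} (hi : i < M) :
    Tendsto (fun n : ℕ => ∫ ω, (numAtRisk ζ T W n i ω : ℝ) / n ∂P) atTop
      (𝓝 (m.limitFraction ζ i θ₀)) := by
  refine tendsto_integral_of_tendsto_inProbability (K := 1) (fun n => ?_) (fun n ω => ?_)
    (htest.tendsto_numAtRisk_div hreg hi)
  · exact ((measurable_from_nat (f := fun k : ℕ => (k : ℝ) / n)).comp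
      (htest.measurable_numAtRisk n hi.le)).aestronglyMeasurable
  · rw [Real.norm_of_nonneg (by positivity)]
    exact div_le_one_of_le₀ (Nat.cast_le.2 (numAtRisk_le n i ω)) n.cast_nonneg

lemma tendsto_fisherInfo (htest : m.IsLifeTest ζ P θ₀ T C V rule W)
    (hreg : m.Regular ζ Θ₀ θ₀) :
    Tendsto (fun n : ℕ => (n : ℝ)⁻¹ • m.fisherInfo ζ
      (fun i => ∫ ω, (atRiskCount ζ.p n (counts ζ T C W n ω) i : ℝ) ∂P) θ₀) atTop
      (𝓝 (m.unitInfo ζ θ₀)) := by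
  have h : ∀ n : ℕ, (n : ℝ)⁻¹ • m.fisherInfo ζ
      (fun i => ∫ ω, (atRiskCount ζ.p n (counts ζ T C W n ω) i : ℝ) ∂P) θ₀ =
      ∑ i : Fin M, (∫ ω, (numAtRisk ζ T W n i ω : ℝ) / n ∂P) • m.stageInfo ζ i θ₀ := by
    intro n
    rw [fisherInfo, Finset.smul_sum]
    refine Finset.sum_congr rfl fun i _ => ?_
    simp only [htest.atRiskCount_counts n i.2.le]
    rw [integral_div, smul_smul, inv_mul_eq_div]
  simp only [h]
  exact tendsto_finsetSum _ fun i _ =>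
    (htest.tendsto_integral_numAtRisk_div hreg i.2).smul_const _

end IsLifeTest

end CompetingRisksModel

end

noncomputable section

/-! ### Asymptotic normality -/

namespace CompetingRisksModel

variable {J s M : ℕ} {m : CompetingRisksModel J s} {ζ : PICScheme M} {Θ₀ : Set (ParamSpace s)}
  {θ₀ : ParamSpace s}

/-- The inverse of the asymptotic information matrix, applied to a linear form (in place of its
vector of coefficients). -/
def infoInv (m : CompetingRisksModel J s) (ζ : PICScheme M) (θ₀ : ParamSpace s) :
    (ParamSpace s →L[ℝ] ℝ) →ₗ[ℝ] ParamSpace s where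
  toFun f := WithLp.toLp 2 ((m.unitInfo ζ θ₀)⁻¹.mulVec fun u => f (coordDir u))
  map_add' f g := by
    rw [← WithLp.toLp_add, ← Matrix.mulVec_add]
    rfl
  map_smul' c f := by
    rw [RingHom.id_apply, ← WithLp.toLp_smul, ← Matrix.mulVec_smul]
    rfl

lemma Regular.isUnit_det_unitInfo (hreg : m.Regular ζ Θ₀ θ₀) : IsUnit (m.unitInfo ζ θ₀).det :=
  (Matrix.isUnit_iff_isUnit_det _).1 hreg.posDef_unitInfo.isUnit

lemma Regular.infoInv_cellInfo (hreg : m.Regular ζ Θ₀ θ₀) (v : ParamSpace s) :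
    infoInv m ζ θ₀ (cellInfo (m.cell ζ) (m.cellWeight ζ θ₀) θ₀ v) = v := by
  have h : (fun u => cellInfo (m.cell ζ) (m.cellWeight ζ θ₀) θ₀ v (coordDir u)) =
      (m.unitInfo ζ θ₀).mulVec v.ofLp := by
    funext u
    have hsymm : cellInfo (m.cell ζ) (m.cellWeight ζ θ₀) θ₀ v (coordDir u) =
        cellInfo (m.cell ζ) (m.cellWeight ζ θ₀) θ₀ (coordDir u) v := by
      simp only [cellInfo_apply, mul_comm]
    rw [hsymm, hreg.cellInfo_eq_dotProduct]
    simp [coordDir]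
  simp only [infoInv, LinearMap.coe_mk, AddHom.coe_mk, h, Matrix.mulVec_mulVec,
    Matrix.nonsing_inv_mul _ hreg.isUnit_det_unitInfo, Matrix.one_mulVec]

lemma Regular.inner_infoInv (hreg : m.Regular ζ Θ₀ θ₀) (f : ParamSpace s →L[ℝ] ℝ)
    (t : ParamSpace s) :
    inner ℝ (infoInv m ζ θ₀ f) t = f (WithLp.toLp 2 ((m.unitInfo ζ θ₀)⁻¹.mulVec t.ofLp)) := by
  have hsymm : ∀ u v, (m.unitInfo ζ θ₀)⁻¹ u v = (m.unitInfo ζ θ₀)⁻¹ v u := fun u v => by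
    simpa using (hreg.posDef_unitInfo.inv.isHermitian.apply u v).symm
  rw [← sum_smul_coordDir (WithLp.toLp 2 ((m.unitInfo ζ θ₀)⁻¹.mulVec t.ofLp))]
  simp only [infoInv, LinearMap.coe_mk, AddHom.coe_mk, PiLp.inner_apply, map_sum, map_smul,
    Matrix.mulVec, dotProduct, Finset.sum_mul, smul_eq_mul]
  simp only [RCLike.inner_apply, conj_trivial, Finset.mul_sum]
  rw [Finset.sum_comm]
  refine Finset.sum_congr rfl fun u _ => Finset.sum_congr rfl fun v _ => ?_
  rw [hsymm v u]
  ring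

variable {Ω 𝒱 : Type*} [MeasurableSpace Ω] [MeasurableSpace 𝒱] {P : Measure Ω}
  [IsProbabilityMeasure P] {T : ℕ → Ω → ℝ} {C : ℕ → Ω → Fin J} {V : Ω → 𝒱}
  {rule : ℕ → ℕ → 𝒱 → (ℕ → Fin J → Finset ℕ) → Finset ℕ} {W : ℕ → Ω → ℕ → Finset ℕ}

namespace IsLifeTest

/-- Central limit theorem for the score at the true parameter, premultiplied by the inverse
information. -/
lemma tendstoInDistribution_infoInv_cellScore (htest : m.IsLifeTest ζ P θ₀ T C V rule W)
    (hreg : m.Regular ζ Θ₀ θ₀) :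
    TendstoInDistribution (fun (n : ℕ) ω => √(n : ℝ) • infoInv m ζ θ₀
      (cellScore (m.cell ζ) (cellFreq ζ n (counts ζ T C W n ω)) θ₀)) atTop
      (id : ParamSpace s → ParamSpace s) (fun _ => P)
      (multivariateGaussian 0 (m.unitInfo ζ θ₀)⁻¹) := by
  have hmeas : ∀ n : ℕ, Measurable fun ω => √(n : ℝ) • infoInv m ζ θ₀
      (cellScore (m.cell ζ) (cellFreq ζ n (counts ζ T C W n ω)) θ₀) := fun n =>
    htest.measurable_comp_counts n fun d => √(n : ℝ) • infoInv m ζ θ₀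
      (cellScore (m.cell ζ) (cellFreq ζ n d) θ₀)
  refine ⟨fun n => (hmeas n).aemeasurable, aemeasurable_id, ?_⟩
  refine ProbabilityMeasure.tendsto_of_tendsto_charFun fun t => ?_
  simp only [ProbabilityMeasure.coe_mk, Measure.map_id]
  rw [charFun_multivariateGaussian hreg.posDef_unitInfo.inv.posSemidef]
  -- The inner product of the vector with `t` is a linear function of the counts, with coefficients
  -- `α / √n`: the relative derivatives of the cell probabilities in the direction `v`.
  set v : ParamSpace s := WithLp.toLp 2 ((m.unitInfo ζ θ₀)⁻¹.mulVec t.ofLp) with hv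
  let α : ℕ → Option (Fin J) → ℝ := fun i o =>
    fderiv ℝ (m.cellProb ζ i o) θ₀ v / m.cellProb ζ i o θ₀
  have hα : ∀ i < M, ∑ o, m.cellProb ζ i o θ₀ * α i o = 0 := fun i hi => by
    rw [← hreg.sum_fderiv_cellProb hi v]
    exact Finset.sum_congr rfl fun o _ => mul_div_cancel₀ _ (hreg.cellProb_pos hi o).ne'
  have hvar : ∑ i ∈ Finset.range M, m.limitFraction ζ i θ₀ *
      ∑ o, m.cellProb ζ i o θ₀ * α i o ^ 2 =
      t.ofLp ⬝ᵥ (m.unitInfo ζ θ₀)⁻¹.mulVec t.ofLp := by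
    have h1 : t.ofLp ⬝ᵥ (m.unitInfo ζ θ₀)⁻¹.mulVec t.ofLp =
        cellInfo (m.cell ζ) (m.cellWeight ζ θ₀) θ₀ v v := by
      rw [hreg.cellInfo_eq_dotProduct, hv]
      simp only [Matrix.mulVec_mulVec, Matrix.mul_nonsing_inv _ hreg.isUnit_det_unitInfo,
        Matrix.one_mulVec]
      exact dotProduct_comm _ _
    rw [h1, cellInfo_apply, Fintype.sum_prod_type, ← Fin.sum_univ_eq_sum_range]
    refine Finset.sum_congr rfl fun i _ => ?_
    rw [Finset.mul_sum]
    refine Finset.sum_congr rfl fun o _ => ?_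
    have := (hreg.cellProb_pos i.2 o).ne'
    simp only [α, cell, cellWeight]
    field_simp
  have hlim := htest.tendsto_integral_prod_exp hreg hα le_rfl
  rw [hvar] at hlim
  have hgoal : Complex.exp (-(t.ofLp ⬝ᵥ (m.unitInfo ζ θ₀)⁻¹.mulVec t.ofLp : ℝ) / 2) =
      Complex.exp ((inner ℝ t (0 : ParamSpace s) : ℝ) * Complex.I -
        (t.ofLp ⬝ᵥ (m.unitInfo ζ θ₀)⁻¹.mulVec t.ofLp : ℝ) / 2) := by
    rw [inner_zero_right, Complex.ofReal_zero, zero_mul, zero_sub, neg_div]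
  rw [← hgoal]
  refine hlim.congr fun n => ?_
  rw [charFun_apply, integral_map (hmeas n).aemeasurable (by fun_prop)]
  refine integral_congr_ae (Eventually.of_forall fun ω => ?_)
  simp only [prod_exp_pow]
  rw [← Complex.exp_sum, ← Finset.sum_mul, ← Complex.ofReal_sum, real_inner_smul_left,
    hreg.inner_infoInv, ← hv]
  congr 3
  rw [← Fin.sum_univ_eq_sum_range
    (fun l => ∑ o, α l o / √(n : ℝ) * numOutcome ζ T C W n l o ω) M]
  simp only [cellScore, Fintype.sum_prod_type, sum_apply, smul_apply, smul_eq_mul, Finset.mul_sum,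
    cellFreq, htest.cellCount_counts]
  refine Finset.sum_congr rfl fun i _ => Finset.sum_congr rfl fun o _ => ?_
  simp only [α, cell]
  rw [div_eq_mul_inv _ √(n : ℝ), ← Real.sqrt_div_self]
  ring

/-- By the expansion of the score, the error of a consistent root of the likelihood equations is the
score premultiplied by the inverse information, up to a relative error that tends to zero. -/
lemma isAsymptoticallyNormal_of_isLikelihoodRoot (htest : m.IsLifeTest ζ P θ₀ T C V rule W)
    (hreg : m.Regular ζ Θ₀ θ₀) {est : ℕ → CountData M J → ParamSpace s}
    (hroot : ∀ᶠ x in inProbability P, m.IsLikelihoodRoot ζ x.1 (counts ζ T C W x.1 x.2)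
      (est x.1 (counts ζ T C W x.1 x.2)))
    (hcons : IsConsistent P (counts ζ T C W) est θ₀) :
    IsAsymptoticallyNormal P (counts ζ T C W) est θ₀ (m.unitInfo ζ θ₀)⁻¹ := by
  obtain ⟨U, hUo, hθU, hUΘ, hC, hpos⟩ := hreg.exists_isOpen_cell
  have hθ : Tendsto (fun x : ℕ × Ω => est x.1 (counts ζ T C W x.1 x.2)) (inProbability P)
      (𝓝 θ₀) :=
    tendstoInMeasure_const_iff (f := fun n ω => est n (counts ζ T C W n ω)).1 hcons
  have hscore : ∀ᶠ x in inProbability P, cellScore (m.cell ζ)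
      (cellFreq ζ x.1 (counts ζ T C W x.1 x.2)) (est x.1 (counts ζ T C W x.1 x.2)) = 0 := by
    filter_upwards [hroot, hθ.eventually_mem (hUo.mem_nhds hθU),
      tendsto_fst_inProbability.eventually_gt_atTop 0] with x hx hxU hn
    exact (isLikelihoodRoot_iff hn _ hUo hC hpos hxU).1 hx
  have hexp := isLittleO_cellScore_sub_cellInfo hUo hθU hC hpos
    (fun θ hθ => sum_cellWeight_mul_cell (hreg.subset (hUΘ hθ)))
    (htest.tendsto_cellFreq hreg) hθ hscore
  have hexp' := ((infoInv m ζ θ₀).toContinuousLinearMap.isBigO_comp _ _).trans_isLittleO hexp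
  simp only [LinearMap.coe_toContinuousLinearMap', map_sub, hreg.infoInv_cellInfo] at hexp'
  have hequiv : Asymptotics.IsEquivalent (inProbability P)
      (fun x : ℕ × Ω => infoInv m ζ θ₀
        (cellScore (m.cell ζ) (cellFreq ζ x.1 (counts ζ T C W x.1 x.2)) θ₀))
      fun x => est x.1 (counts ζ T C W x.1 x.2) - θ₀ := hexp'
  have hsymm := (Asymptotics.isBigO_refl (fun x : ℕ × Ω => √(x.1 : ℝ))
    (inProbability P)).smul_isLittleO hequiv.symm.isLittleO
  refine tendstoInDistribution_of_isLittleO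
    (htest.tendstoInDistribution_infoInv_cellScore hreg) (fun n => ?_) ?_
  · exact (htest.measurable_comp_counts n fun d => √(n : ℝ) • (est n d - θ₀)).aemeasurable
  · exact hsymm.congr_left fun x => smul_sub _ _ _

/-- A consistent maximizer over a set that contains a neighbourhood of `θ₀` solves the likelihood
equations. -/
lemma isAsymptoticallyNormal_of_isMLE (htest : m.IsLifeTest ζ P θ₀ T C V rule W)
    (hreg : m.Regular ζ Θ₀ θ₀) {K : Set (ParamSpace s)} (hK : K ∈ 𝓝 θ₀)
    {est : ℕ → CountData M J → ParamSpace s}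
    (hmle : ∀ᶠ x in inProbability P, m.IsMLE ζ K x.1 (counts ζ T C W x.1 x.2)
      (est x.1 (counts ζ T C W x.1 x.2)))
    (hcons : IsConsistent P (counts ζ T C W) est θ₀) :
    IsAsymptoticallyNormal P (counts ζ T C W) est θ₀ (m.unitInfo ζ θ₀)⁻¹ := by
  refine htest.isAsymptoticallyNormal_of_isLikelihoodRoot hreg ?_ hcons
  obtain ⟨U, hUo, hθU, -, hC, hpos⟩ := hreg.exists_isOpen_cell
  have hθ : Tendsto (fun x : ℕ × Ω => est x.1 (counts ζ T C W x.1 x.2)) (inProbability P)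
      (𝓝 θ₀) :=
    tendstoInMeasure_const_iff (f := fun n ω => est n (counts ζ T C W n ω)).1 hcons
  have hO : interior K ∩ U ∈ 𝓝 θ₀ :=
    inter_mem (interior_mem_nhds.2 hK) (hUo.mem_nhds hθU)
  filter_upwards [hmle, hθ.eventually_mem hO,
    tendsto_fst_inProbability.eventually_gt_atTop 0] with x hx hxO hn
  have hsub : m.IsMLE ζ (interior K ∩ U) x.1 (counts ζ T C W x.1 x.2)
      (est x.1 (counts ζ T C W x.1 x.2)) :=
    ⟨hxO, hx.2.on_subset (Set.inter_subset_left.trans interior_subset)⟩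
  have hmax := ((isMLE_iff hn _ fun k θ hθ => hpos k θ hθ.2).1 hsub).2
  rw [isLikelihoodRoot_iff hn _ hUo hC hpos hxO.2]
  exact (hmax.isLocalMax ((isOpen_interior.inter hUo).mem_nhds hxO)).hasFDerivAt_eq_zero
    (hasFDerivAt_cellLogLik hUo hC hpos _ hxO.2)

/-- With probability tending to one all cells are occupied, so that a maximizer of the likelihood
has positive cell probabilities, which fit the cell frequencies at least as well as the true
ones. -/
lemma isConsistent_of_isMLE (htest : m.IsLifeTest ζ P θ₀ T C V rule W)
    (hreg : m.Regular ζ Θ₀ θ₀) {est : ℕ → CountData M J → ParamSpace s}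
    (hmle : ∀ᶠ x in inProbability P, m.IsMLE ζ m.Θ x.1 (counts ζ T C W x.1 x.2)
      (est x.1 (counts ζ T C W x.1 x.2)))
    (hsep : m.SeparatedOn ζ m.Θ θ₀) : IsConsistent P (counts ζ T C W) est θ₀ := by
  have hfreq := htest.tendsto_cellFreq hreg
  have hocc : ∀ᶠ x in inProbability P, ∀ k, 0 < cellFreq ζ x.1 (counts ζ T C W x.1 x.2) k :=
    eventually_all.2 fun k => (tendsto_pi_nhds.1 hfreq k).eventually_const_lt
      (mul_pos (hreg.cellWeight_pos k) (hreg.cell_pos k))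
  have hcell : ∀ k, Tendsto (fun x : ℕ × Ω => m.cell ζ k (est x.1 (counts ζ T C W x.1 x.2)))
      (inProbability P) (𝓝 (m.cell ζ k θ₀)) := by
    refine tendsto_of_sum_mul_log_le (a := m.cellWeight ζ θ₀) (p₀ := fun k => m.cell ζ k θ₀)
      (w := fun x : ℕ × Ω => cellFreq ζ x.1 (counts ζ T C W x.1 x.2))
      (p := fun x k => m.cell ζ k (est x.1 (counts ζ T C W x.1 x.2)))
      hreg.cellWeight_pos hreg.cell_pos hfreq ?_
    filter_upwards [hmle, hocc, tendsto_fst_inProbability.eventually_gt_atTop 0] with x hx hw hn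
    set d := counts ζ T C W x.1 x.2
    have hle : m.likelihood ζ x.1 d θ₀ ≤ m.likelihood ζ x.1 d (est x.1 d) := hx.2 hreg.mem_Θ
    have hpos : ∀ k, 0 < m.cell ζ k (est x.1 d) := by
      intro k
      refine lt_of_le_of_ne (cellProb_nonneg ζ hx.1 k.1.2 k.2) fun h0 => ?_
      have hl0 : 0 < m.likelihood ζ x.1 d θ₀ := by
        rw [likelihood_eq_exp hn d hreg.cell_pos]
        exact Real.exp_pos _
      refine (hl0.trans_le hle).ne' ?_
      rw [likelihood_eq_prod]
      refine Finset.prod_eq_zero (Finset.mem_univ k) ?_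
      rw [← h0, zero_pow]
      intro hc
      have := hw k
      simp [cellFreq, hc] at this
    refine ⟨fun k => (hw k).le, fun k => ⟨hpos k, cellProb_le_one ζ hx.1 k.1.2 k.2⟩, ?_,
      (likelihood_le_likelihood_iff hn d hreg.cell_pos hpos).1 hle⟩
    rw [sum_cellWeight_mul_cell hx.1, sum_cellWeight_mul_cell hreg.mem_Θ]
  refine tendstoInMeasure_const_iff (f := fun n ω => est n (counts ζ T C W n ω)).2
    (Metric.tendsto_nhds.2 fun ε hε => ?_)
  obtain ⟨δ, hδ, hsepδ⟩ := hsep ε hε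
  have hclose : ∀ᶠ x in inProbability P, ∀ k : Fin M × Option (Fin J),
      dist (m.cell ζ k (est x.1 (counts ζ T C W x.1 x.2))) (m.cell ζ k θ₀) < δ :=
    eventually_all.2 fun k => Metric.tendsto_nhds.1 (hcell k) δ hδ
  filter_upwards [hmle, hclose] with x hx hxδ
  by_contra! hdist
  obtain ⟨i, j, hij⟩ := hsepδ _ hx.1 hdist
  exact (hxδ (i, some j)).not_ge hij

end IsLifeTest

end CompetingRisksModel

end

/-! ### Consistency and asymptotic normality of the estimators -/

theorem theorem2 {J s M : ℕ} (m : CompetingRisksModel J s) (ζ : PICScheme M)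
    (Θ₀ : Set (ParamSpace s)) (θ₀ : ParamSpace s) (hreg : m.Regular ζ Θ₀ θ₀)
    {Ω 𝒱 : Type*} [MeasurableSpace Ω] [MeasurableSpace 𝒱]
    (P : Measure Ω) [IsProbabilityMeasure P]
    (T : ℕ → Ω → ℝ) (C : ℕ → Ω → Fin J) (V : Ω → 𝒱)
    (rule : ℕ → ℕ → 𝒱 → (ℕ → Fin J → Finset ℕ) → Finset ℕ)
    (W : ℕ → Ω → ℕ → Finset ℕ) (htest : m.IsLifeTest ζ P θ₀ T C V rule W)
    (D : ℕ → Ω → CountData M J) (hD : D = CompetingRisksModel.counts ζ T C W) :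
    -- the Fisher information matrix, divided by `n`, has a positive definite limit
    ((m.unitInfo ζ θ₀).PosDef ∧
      Tendsto (fun n : ℕ => (n : ℝ)⁻¹ • m.fisherInfo ζ
        (fun i => ∫ ω, (atRiskCount ζ.p n (D n ω) i : ℝ) ∂P) θ₀) atTop (𝓝 (m.unitInfo ζ θ₀))) ∧
    -- the maximum likelihood estimator near the true parameter
    (∃ r₀ > 0, ∀ r, 0 < r → r ≤ r₀ → Metric.closedBall θ₀ r ⊆ Θ₀ ∧
      WithProbTendingToOne P (fun n ω => ∃ θ ∈ Metric.ball θ₀ r,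
        m.IsLikelihoodRoot ζ n (D n ω) θ ∧ m.IsMLE ζ (Metric.closedBall θ₀ r) n (D n ω) θ ∧
        ∀ θ' ∈ Metric.closedBall θ₀ r, m.IsLikelihoodRoot ζ n (D n ω) θ' ∨
          m.IsMLE ζ (Metric.closedBall θ₀ r) n (D n ω) θ' → θ' = θ) ∧
      ∀ est : ℕ → CountData M J → ParamSpace s,
        WithProbTendingToOne P (fun n ω =>
          m.IsMLE ζ (Metric.closedBall θ₀ r) n (D n ω) (est n (D n ω))) →
        IsConsistent P D est θ₀ ∧
          IsAsymptoticallyNormal P D est θ₀ (m.unitInfo ζ θ₀)⁻¹) ∧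
    -- consistent solutions of the likelihood equations
    (∀ est : ℕ → CountData M J → ParamSpace s,
      WithProbTendingToOne P (fun n ω => m.IsLikelihoodRoot ζ n (D n ω) (est n (D n ω))) →
      IsConsistent P D est θ₀ → IsAsymptoticallyNormal P D est θ₀ (m.unitInfo ζ θ₀)⁻¹) ∧
    -- the maximum likelihood estimator over the whole parameter space
    (∀ est : ℕ → CountData M J → ParamSpace s,
      WithProbTendingToOne P (fun n ω => m.IsMLE ζ m.Θ n (D n ω) (est n (D n ω))) →
      (m.SeparatedOn ζ m.Θ θ₀ → IsConsistent P D est θ₀) ∧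
      (IsConsistent P D est θ₀ →
        IsAsymptoticallyNormal P D est θ₀ (m.unitInfo ζ θ₀)⁻¹)) := by
  subst hD
  -- Events of probability tending to one are eventual along the filter, since they are measurable:
  -- they depend on the counts only.
  have hev : ∀ {A : ℕ → CountData M J → Prop}, WithProbTendingToOne P
      (fun n ω => A n (CompetingRisksModel.counts ζ T C W n ω)) →
      ∀ᶠ x in inProbability P, A x.1 (CompetingRisksModel.counts ζ T C W x.1 x.2) := fun h =>
    h.eventually fun n => htest.measurableSet_counts n _
  refine ⟨⟨hreg.posDef_unitInfo, htest.tendsto_fisherInfo hreg⟩, ?_, fun est hroot hcons =>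
    htest.isAsymptoticallyNormal_of_isLikelihoodRoot hreg
      (hev (A := fun n d => m.IsLikelihoodRoot ζ n d (est n d)) hroot) hcons,
    fun est hmle => ?_⟩
  · obtain ⟨U, hUo, hθU, hUΘ, hC, hpos⟩ := hreg.exists_isOpen_cell
    obtain ⟨r₀, hr₀, hrU, huniq⟩ := exists_forall_eventually_unique_critical_point hUo hθU hC hpos
      (fun θ hθ => CompetingRisksModel.sum_cellWeight_mul_cell (hreg.subset (hUΘ hθ)))
      fun c hc => hreg.cellInfo_pos hc
    have hfreq := htest.tendsto_cellFreq hreg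
    refine ⟨r₀, hr₀, fun r hr hrr => ?_⟩
    have hrU' : Metric.closedBall θ₀ r ⊆ U :=
      (Metric.closedBall_subset_closedBall hrr).trans hrU
    refine ⟨hrU'.trans hUΘ, withProbTendingToOne_of_eventually ?_, fun est hmle => ?_⟩
    · filter_upwards [hfreq.eventually (huniq r hr hrr),
        tendsto_fst_inProbability.eventually_gt_atTop 0] with x ⟨θ, hθ, hs, hmax, hun⟩ hn
      have hθ' := Metric.ball_subset_closedBall hθ
      refine ⟨θ, hθ, (CompetingRisksModel.isLikelihoodRoot_iff hn _ hUo hC hpos (hrU' hθ')).2 hs,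
        (CompetingRisksModel.isMLE_iff hn _ fun k θ hθ => hpos k θ (hrU' hθ)).2 ⟨hθ', hmax⟩,
        fun θ' hθ' h => hun θ' hθ' ?_⟩
      rw [CompetingRisksModel.isLikelihoodRoot_iff hn _ hUo hC hpos (hrU' hθ'),
        CompetingRisksModel.isMLE_iff hn _ fun k θ hθ => hpos k θ (hrU' hθ)] at h
      exact h.imp_right And.right
    · have hmle := hev (A := fun n d => m.IsMLE ζ (Metric.closedBall θ₀ r) n d (est n d)) hmle
      have hcons : IsConsistent P (CompetingRisksModel.counts ζ T C W) est θ₀ := by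
        refine tendstoInMeasure_const_iff.2
          (tendsto_of_isMaxOn_closedBall huniq hr hrr hfreq ?_)
        filter_upwards [hmle, tendsto_fst_inProbability.eventually_gt_atTop 0] with x hx hn
        exact (CompetingRisksModel.isMLE_iff hn _ fun k θ hθ => hpos k θ (hrU' hθ)).1 hx
      exact ⟨hcons, htest.isAsymptoticallyNormal_of_isMLE hreg (Metric.closedBall_mem_nhds θ₀ hr)
        hmle hcons⟩
  · have hmle := hev (A := fun n d => m.IsMLE ζ m.Θ n d (est n d)) hmle
    exact ⟨htest.isConsistent_of_isMLE hreg hmle, htest.isAsymptoticallyNormal_of_isMLE hreg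
      (mem_of_superset (hreg.isOpen.mem_nhds hreg.mem) hreg.subset) hmle⟩
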